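/- **Conventions.** Graphs are finite and simple; $N[v]$ is the closed neighbourhood; a graph is *twin-free* if $N[u]=N[v]$ implies $u=v$. A *representation* assigns to each vertex $v$ a bounded interval $I(v)$ with endpoints $L(v),R(v)$, each endpoint being open or closed and coloured white or red. It *represents* $G$ if distinct $u,v$ are adjacent exactly when $I(u)\cap I(v)\ne\emptyset$. $I(u)$ is *strictly contained* in $I(v)$ if $I(u)\subset I(v)$ and they do not have the same two endpoints; the representation is *strict* if there is no strict containment. A vertex $x$ *peeks into* $ab$ if $I(x)$ meets $I(a)$ but not $I(b)$; *from the left* if also $R(x)\le L(b)$, *from the right* if also $R(b)\le L(x)$. **Forbidden graphs.** $G$ is $\mathcal F$-free if it has none of the following as an induced subgraph. (i) $K_{1,4}$; $K_{2,3}$ with the two vertices of the small side joined; two adjacent vertices with two nonadjacent common neighbours and one pendant neighbour each; a vertex joined to a triangle and to two pendant vertices; a vertex joined to a path on four vertices and to one pendant vertex. (ii) For $k\ge1$ let $H_k$ have vertices $a_0,\dots,a_k,c_1,\dots,c_k,b_0,v$ and edges $a_0b_0,\ a_0v,\ a_{i-1}a_i,\ a_{i-1}c_i,\ a_ic_i$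 ($1\le i\le k$). Add to $H_k$: pairwise adjacent vertices $x,y,z$, joined to $a_k$; or $x,y,z$ with edges $xy,yz$, joined to $a_k$, and the edge $zc_k$; or nonadjacent $x,y$, joined to $a_k$; or $x,c',u$ with edges $xc',xu,xa_k,c'a_k,xc_k$. (iii) For $k,n\ge1$: disjoint copies of $H_k$ and $H_n$, with $a_n',c_n'$ denoting the vertices $a_n,c_n$ of the copy of $H_n$, together with the edges $a_ka_n',\ c_ka_n',\ a_kc_n'$. **Input.** A twin-free, $\mathcal F$-free graph $G$ with a representation by closed intervals whose $2|V|$ endpoints are distinct and white, such that whenever $I(u)\subset I(v)$ is a proper inclusion some vertex peeks into $vu$ from the left and some vertex peeks into $vu$ from the right. **The algorithm SWEEP.** While there is an *$ab$-pair* $a_0b_0$, i.e. $I(b_0)$ is strictly contained in $I(a_0)$, choose one (any choice is allowed) and perform a sweep. *Identification* (positions and colours are those at the beginning of the sweep): $c_0$ (resp. $d_0$) is a vertex whose closed neighbourhood is $N[a_0]$ without the vertices peeking into $a_0b_0$ from the left (resp. right), if one exists. Given step $k$, the one or two vertices peeking into $a_kb_k$ or $a_kc_k$ from the left are $a_{k+1}$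 and, if there are two, $c_{k+1}$, where $R(a_{k+1})<R(c_{k+1})$; $b_{k+1}$ is the vertex whose interval is strictly contained in $I(a_{k+1})$, if it exists. If neither $b_{k+1}$ nor $c_{k+1}$ exists ($a_{k+1}$ is *terminal*), or if $c_{k+1}$ exists and $L(a_{k+1})$ is red ($a_{k+1}$, $c_{k+1}$ are *merging*), the left part ends with this step. Otherwise $d_{k+1}$ is a vertex with closed neighbourhood $N[a_{k+1}]\setminus\{a_k,d_k\}$ if one exists, and one continues. The right part is the mirror image, starting from the same $a_0,b_0,c_0,d_0$, with vertices $a_k',b_k',d_k',c_k'$ in the roles of $a_k,b_k,c_k,d_k$ (so a merging vertex there is a $d_k'$). *Operations.* Let $M_0=L(a_0)$, $M_0'=R(a_0)$; set $I(b_0):=(M_0,M_0')$, and, if $d_0$ (resp. $c_0$) exists and has two white endpoints, $I(d_0):=[M_0,M_0')$ (resp. $I(c_0):=(M_0,M_0']$); colour the endpoints of the redefined intervals and of $I(a_0)$ red. In step $k\ge1$ of the left part set $I(a_k):=[L(a_k),M_{k-1}]$ and colour $R(a_k)$ red. If $a_k$ is merging, set $I(c_k):=(L(a_k),M_{k-1}]$,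 with red endpoints. If the part does not end, colour $L(a_k)$ red, put $M_k=L(a_k)$, set $I(b_k):=(M_k,M_{k-1})$ and $I(c_k):=(M_k,M_{k-1}]$ if these vertices exist, with red endpoints; and if $d_k$ exists with two white endpoints, and $d_{k-1}$ does not exist or $I(d_{k-1})=[M_{k-1},M_{k-2})$ (with $M_{-1}=M_0'$), set $I(d_k):=[M_k,M_{k-1})$ with red endpoints. Then perform the mirror image on the right. The numbers $M_k$ and $M_k'$ are the *zone lines* of the sweep, $M_0$ counting as left and $M_0'$ as right. An endpoint of $I(v)$ *participates* in the sweep if $v$ was identified as type a, b, c or d and at the end of the sweep the endpoint lies on a zone line of the sweep; left endpoints of merging $c$'s and right endpoints of merging $d$'s participate too. A vertex participates if one of its endpoints does. **Theorem.** For such an input and every choice of the $ab$-pairs, the following hold after any number $i\ge0$ of sweeps $S_1,\dots,S_i$. (0) Every white endpoint is still in its initial position and closed. (1) If $I(u)$ is strictly contained in $I(v)$, then (a) the four endpoints of $I(u),I(v)$ are white; (b) if $x$ peeks into $vu$ from the left then $R(x)$ is white, and if $x$ peeks into $vu$ from the right then $L(x)$ is white. (2) From every $ab$-pair the next sweep is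 well defined: all vertices to be identified exist where required and are unique, both parts end, no vertex has two roles, $L(a_k)<L(c_k)$ and $R(d_k')<R(a_k')$ ($k\ge1$) at the beginning of the sweep whenever both vertices exist, and at the end of the sweep all intervals satisfy $L(v)<R(v)$. Every endpoint participating in this sweep is white at its beginning and red at its end, and endpoints that are red at its beginning are not changed by it. (3) For each zone line $M$ of a sweep $S_j$, $j\le i$: (a) every endpoint on $M$ is red; (b) there are type-a vertices $a,\hat a$ participating in $S_j$ with $R(a)=L(\hat a)=M$; (c) each interval with an endpoint on $M$ has the same two endpoints as $I(a)$ for some type-a vertex $a$ participating in $S_j$; (d) if $M$ is a left (right) zone line, some vertex of type b or c of the base step or left part (b or d of the base step or right part) of $S_j$ has an open left (right) endpoint on $M$; (e) each vertex whose interval has an endpoint on $M$ participates in $S_j$ or, for some $\ell$ with $j<\ell\le i$, is a merging $c$ (merging $d$) of $S_\ell$ whose left (right) endpoint lies on $M$ at the end of $S_\ell$. (4) The represented graph is $G$. Moreover $i\le|V|$. Consequently the algorithm terminates, with a strict mixed interval representation of $G$. It can be carried out in $O(|V|^2)$ elementary steps, with an absolute constant: there is an explicit implementation whose running time is at most $C(|V|+1)^2$,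 where reading or writing an array entry indexed by a vertex, and a bounded number of comparisons of entries, count as one step. -/

import Mathlib

universe u

/-! ## Coloured mixed intervals and representations -/

/-- The two ends of an interval. -/
inductive Side where
  | left
  | right

/-- An endpoint of a mixed interval: its position, whether it belongs to the interval, and its
colour (`red = false` means white). -/
structure Endpoint where
  pos : ℝ
  closed : Bool
  red : Bool

/-- A bounded real interval, open, closed or half-open, with coloured endpoints. -/
structure MInterval where
  L : Endpoint
  R : Endpoint

namespace MInterval

def pt (I : MInterval) : Side → Endpoint
  | .left => I.L
  | .right => I.R

/-- The set of real numbers that the interval stands for. -/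
def toSet (I : MInterval) : Set ℝ :=
  {x | (I.L.pos < x ∨ (I.L.closed = true ∧ x = I.L.pos)) ∧
       (x < I.R.pos ∨ (I.R.closed = true ∧ x = I.R.pos))}

/-- The two intervals intersect. -/
def Meets (I J : MInterval) : Prop := (I.toSet ∩ J.toSet).Nonempty

def SameEnds (I J : MInterval) : Prop := I.L.pos = J.L.pos ∧ I.R.pos = J.R.pos

/-- `I` is strictly contained in `J`: a proper inclusion, with different endpoints. -/
def StrictlyIn (I J : MInterval) : Prop := I.toSet ⊂ J.toSet ∧ ¬ I.SameEnds J

def isWhite (I : MInterval) : Bool := !I.L.red && !I.R.red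

/-- The reflection `x ↦ -x`. -/
def mirror (I : MInterval) : MInterval :=
  ⟨⟨-I.R.pos, I.R.closed, I.R.red⟩, ⟨-I.L.pos, I.L.closed, I.L.red⟩⟩

/-- `I = [x, y)`. -/
noncomputable def isClosedOpen (I : MInterval) (x y : ℝ) : Bool :=
  decide (I.L.pos = x) && decide (I.R.pos = y) && I.L.closed && !I.R.closed

end MInterval

/-- The interval from `x` to `y` with both endpoints red; `cl`, `cr` tell whether the left, right
endpoint is closed. -/
def redInterval (cl : Bool) (x y : ℝ) (cr : Bool) : MInterval := ⟨⟨x, cl, true⟩, ⟨y, cr, true⟩⟩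

/-- An assignment of coloured mixed intervals to the vertices. -/
abbrev MixedRep (V : Type u) := V → MInterval

section Representations

variable {V : Type u}

def MixedRep.mirror (σ : MixedRep V) : MixedRep V := fun v => (σ v).mirror

/-- `G` is the graph represented by the intervals. -/
def Represents (σ : MixedRep V) (G : SimpleGraph V) : Prop :=
  ∀ u v, u ≠ v → (G.Adj u v ↔ (σ u).Meets (σ v))

/-- No interval is strictly contained in another. -/
def MixedRep.IsStrict (σ : MixedRep V) : Prop := ∀ u v, ¬ (σ u).StrictlyIn (σ v)

/-- `x` peeks into `ab` from the left. -/
def PeeksLeft (σ : MixedRep V) (x a b : V) : Prop :=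
  (σ x).Meets (σ a) ∧ ¬ (σ x).Meets (σ b) ∧ (σ x).R.pos ≤ (σ b).L.pos

/-- `x` peeks into `ab` from the right. -/
def PeeksRight (σ : MixedRep V) (x a b : V) : Prop :=
  (σ x).Meets (σ a) ∧ ¬ (σ x).Meets (σ b) ∧ (σ b).R.pos ≤ (σ x).L.pos

def closedNbhd (G : SimpleGraph V) (v : V) : Set V := insert v (G.neighborSet v)

def TwinFree (G : SimpleGraph V) : Prop := ∀ u v, closedNbhd G u = closedNbhd G v → u = v

end Representations

/-! ## The forbidden graphs -/

def edgeListGraph (m : ℕ) (E : List (ℕ × ℕ)) : SimpleGraph (Fin m) :=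
  SimpleGraph.fromRel fun i j => ((i : ℕ), (j : ℕ)) ∈ E

/-- The star with centre `0` and four leaves. -/
def graphK14 : SimpleGraph (Fin 5) := edgeListGraph 5 [(0, 1), (0, 2), (0, 3), (0, 4)]

/-- `K_{2,3}` with the two vertices `0`, `1` of the small side joined. -/
def graphK23s : SimpleGraph (Fin 5) :=
  edgeListGraph 5 [(0, 1), (0, 2), (0, 3), (0, 4), (1, 2), (1, 3), (1, 4)]

/-- Adjacent vertices `0`, `1` with two common neighbours and one pendant neighbour each. -/
def graphK24s : SimpleGraph (Fin 6) :=
  edgeListGraph 6 [(0, 1), (0, 2), (0, 3), (1, 2), (1, 3), (0, 4), (1, 5)]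

/-- Centre `0`, joined to a triangle and to two pendant vertices. -/
def graphB : SimpleGraph (Fin 6) :=
  edgeListGraph 6 [(0, 1), (0, 2), (0, 3), (0, 4), (0, 5), (1, 2), (1, 3), (2, 3)]

/-- Centre `0`, joined to a path on four vertices and to one pendant vertex. -/
def graphA : SimpleGraph (Fin 6) :=
  edgeListGraph 6 [(0, 1), (0, 2), (0, 3), (0, 4), (0, 5), (1, 2), (2, 3), (3, 4)]

/-- The vertices of `H_k`: `a_0, …, a_k`, `c_1, …, c_k` (`c i` is `c_{i+1}`), `b_0` and `v`. -/
inductive HVertex (k : ℕ) where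
  | a (i : Fin (k + 1))
  | c (i : Fin k)
  | b
  | v

/-- Edges of `H_k`: `a_i a_{i+1}`, `a_i c_{i+1}`, `a_i c_i`, `a_0 b_0`, `a_0 v`. -/
def HRel (k : ℕ) : HVertex k → HVertex k → Prop
  | .a i, .a j => (j : ℕ) = i + 1
  | .a i, .c j => (j : ℕ) = i ∨ (j : ℕ) + 1 = i
  | .a i, .b => (i : ℕ) = 0
  | .a i, .v => (i : ℕ) = 0
  | _, _ => False

/-- `H_{k+1}` with `m` additional vertices `0, …, m - 1`: those in `atA` are joined to the tail
vertex `a_{k+1}`, those in `atC` to the tail vertex `c_{k+1}`, and `E` lists the edges between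
them. -/
def attachTail (k m : ℕ) (atA atC : List ℕ) (E : List (ℕ × ℕ)) :
    SimpleGraph (HVertex (k + 1) ⊕ Fin m) :=
  SimpleGraph.fromRel fun p q => match p, q with
    | .inl x, .inl y => HRel (k + 1) x y
    | .inl x, .inr i =>
        (x = .a (Fin.last (k + 1)) ∧ (i : ℕ) ∈ atA) ∨ (x = .c (Fin.last k) ∧ (i : ℕ) ∈ atC)
    | .inr i, .inr j => ((i : ℕ), (j : ℕ)) ∈ E
    | .inr _, .inl _ => False

def family1 (k : ℕ) := attachTail k 3 [0, 1, 2] [] [(0, 1), (1, 2), (0, 2)]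

def family2 (k : ℕ) := attachTail k 3 [0, 1, 2] [2] [(0, 1), (1, 2)]

def family3 (k : ℕ) := attachTail k 2 [0, 1] [] []

def family4 (k : ℕ) := attachTail k 3 [0, 1] [0] [(0, 1), (0, 2)]

/-- `H_{k+1}` and `H_{n+1}`, with all edges between the two pairs of tail vertices except the one
between `c_{k+1}` and its counterpart. -/
def family5 (k n : ℕ) : SimpleGraph (HVertex (k + 1) ⊕ HVertex (n + 1)) :=
  SimpleGraph.fromRel fun p q => match p, q with
    | .inl x, .inl y => HRel (k + 1) x y
    | .inr x, .inr y => HRel (n + 1) x y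
    | .inl x, .inr y =>
        (x = .a (Fin.last (k + 1)) ∧ y = .a (Fin.last (n + 1))) ∨
        (x = .c (Fin.last k) ∧ y = .a (Fin.last (n + 1))) ∨
        (x = .a (Fin.last (k + 1)) ∧ y = .c (Fin.last n))
    | .inr _, .inl _ => False

/-- No graph of the forbidden set is an induced subgraph of `G`. -/
structure ForbiddenFree {V : Type u} (G : SimpleGraph V) : Prop where
  k14 : ¬ graphK14.IsIndContained G
  k23 : ¬ graphK23s.IsIndContained G
  k24 : ¬ graphK24s.IsIndContained G
  b : ¬ graphB.IsIndContained G
  a : ¬ graphA.IsIndContained G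
  fam1 : ∀ k, ¬ (family1 k).IsIndContained G
  fam2 : ∀ k, ¬ (family2 k).IsIndContained G
  fam3 : ∀ k, ¬ (family3 k).IsIndContained G
  fam4 : ∀ k, ¬ (family4 k).IsIndContained G
  fam5 : ∀ k n, ¬ (family5 k n).IsIndContained G

/-- The input of the algorithm: a twin-free graph without forbidden induced subgraphs, with a closed
interval representation with pairwise distinct endpoints, all of them white, that has the inclusion
property. -/
structure InitialHyp {V : Type u} (G : SimpleGraph V) (σ : MixedRep V) : Prop where
  twinFree : TwinFree G
  forbiddenFree : ForbiddenFree G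
  represents : Represents σ G
  closed : ∀ v s, ((σ v).pt s).closed = true
  white : ∀ v s, ((σ v).pt s).red = false
  lt : ∀ v, (σ v).L.pos < (σ v).R.pos
  distinct : Function.Injective fun p : V × Side => ((σ p.1).pt p.2).pos
  inclusion : ∀ u v, (σ u).toSet ⊂ (σ v).toSet →
    (∃ x, PeeksLeft σ x v u) ∧ ∃ y, PeeksRight σ y v u

/-! ## One sweep: the vertices that are identified -/

/-- The vertices `a_k`, `b_k`, `c_k`, `d_k` of one step (the last three need not exist). The steps of
the right part are stored as steps of the reflected representation, so there the field `c` holds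
the vertex `d_k'` and the field `d` holds the vertex `c_k'`. -/
structure Step (V : Type u) where
  a : V
  b : Option V
  c : Option V
  d : Option V

section Identify

variable {V : Type u}

def Step.swap (s : Step V) : Step V := ⟨s.a, s.b, s.d, s.c⟩

/-- The identified vertices of a step. -/
def Step.roles (s : Step V) : List V := s.a :: (s.b.toList ++ s.c.toList ++ s.d.toList)

/-- `o` is a vertex with property `P`, if there is one, and is absent otherwise. -/
def Picks (P : V → Prop) : Option V → Prop
  | some v => P v
  | none => ∀ v, ¬ P v

/-- The identification of `c_0` and `d_0` for an `ab`-pair. -/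
def IsBase (G : SimpleGraph V) (σ : MixedRep V) (s : Step V) : Prop :=
  ∃ b, s.b = some b ∧ (σ b).StrictlyIn (σ s.a) ∧
    Picks (fun v => closedNbhd G v = closedNbhd G s.a \ {x | PeeksLeft σ x s.a b}) s.c ∧
    Picks (fun v => closedNbhd G v = closedNbhd G s.a \ {x | PeeksRight σ x s.a b}) s.d

/-- The vertices that peek into `a_k b_k` or `a_k c_k` from the left. -/
def peekers (σ : MixedRep V) (s : Step V) : Set V :=
  {x | (∃ b, s.b = some b ∧ PeeksLeft σ x s.a b) ∨ (∃ c, s.c = some c ∧ PeeksLeft σ x s.a c)}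

/-- `t` consists of the vertices `a_{k+1}`, `b_{k+1}`, `c_{k+1}`, `d_{k+1}` that follow the step `s`
towards the left. -/
def NextStep (G : SimpleGraph V) (σ : MixedRep V) (s t : Step V) : Prop :=
  ((t.c = none ∧ peekers σ s = {t.a}) ∨
    (∃ c, t.c = some c ∧ peekers σ s = {t.a, c} ∧ (σ t.a).R.pos < (σ c).R.pos)) ∧
  Picks (fun v => (σ v).StrictlyIn (σ t.a)) t.b ∧
  Picks (fun v => closedNbhd G v = closedNbhd G t.a \ {x | x = s.a ∨ s.d = some x}) t.d

/-- `a_k` is a terminal `a`. -/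
def Step.Terminal (t : Step V) : Prop := t.b = none ∧ t.c = none

/-- `a_k` is a merging `a`; `σ` is the representation at the beginning of the sweep. -/
def Step.Merging (σ : MixedRep V) (t : Step V) : Prop := (∃ c, t.c = some c) ∧ (σ t.a).L.red = true

/-- `LeftSteps G σ s l`: `l` lists the steps of the left part that follow `s`. The part ends with the
first terminal or merging `a`, for which no vertex `d` is identified. -/
inductive LeftSteps (G : SimpleGraph V) (σ : MixedRep V) : Step V → List (Step V) → Prop
  | finish {s t : Step V} : NextStep G σ s t → (t.Terminal ∨ t.Merging σ) →
      LeftSteps G σ s [{ t with d := none }]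
  | cont {s t : Step V} {l : List (Step V)} : NextStep G σ s t → ¬ (t.Terminal ∨ t.Merging σ) →
      LeftSteps G σ t l → LeftSteps G σ s (t :: l)

end Identify

/-- A sweep: the representation at its beginning, the vertices `a_0, b_0, c_0, d_0`, and the steps
`1, 2, …` of its left and of its right part. -/
structure SweepData (V : Type u) where
  start : MixedRep V
  base : Step V
  left : List (Step V)
  right : List (Step V)

/-- The vertices of `D` are those that the sweep has to identify, all of them with respect to the
representation at the beginning of the sweep. -/
def IsSweep {V : Type u} (G : SimpleGraph V) (D : SweepData V) : Prop :=
  IsBase G D.start D.base ∧ LeftSteps G D.start D.base D.left ∧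
    LeftSteps G D.start.mirror D.base.swap D.right

/-! ## One sweep: the operations -/

noncomputable section Operations

variable {V : Type u} [DecidableEq V]

/-- Redefine the interval of a vertex, if the vertex exists. -/
def setIv (σ : MixedRep V) (o : Option V) (I : MInterval) : MixedRep V :=
  match o with
  | some v => Function.update σ v I
  | none => σ

/-- Redefine the interval of a vertex, if the vertex exists and its interval has white endpoints. -/
def setIfWhite (σ : MixedRep V) (o : Option V) (I : MInterval) : MixedRep V :=
  match o with
  | some v => if (σ v).isWhite then Function.update σ v I else σ
  | none => σ

/-- The operations of the base step. -/
def execBase (σ : MixedRep V) (s : Step V) : MixedRep V :=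
  let m := (σ s.a).L.pos
  let m' := (σ s.a).R.pos
  let σ₁ := setIv σ s.b (redInterval false m m' false)
  let σ₂ := setIfWhite σ₁ s.d (redInterval true m m' false)
  let σ₃ := setIfWhite σ₂ s.c (redInterval false m m' true)
  Function.update σ₃ s.a ⟨{ (σ₃ s.a).L with red := true }, { (σ₃ s.a).R with red := true }⟩

/-- The operations of the steps `k, k + 1, …` of the left part, where `m₂ = M_{k-2}`, `m₁ = M_{k-1}`
and `e = d_{k-1}`. The result is the new representation together with the zone lines
`M_k, M_{k+1}, …` that are established. -/
def execLeft : MixedRep V → ℝ → ℝ → Option V → List (Step V) → MixedRep V × List ℝ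
  | σ, _, _, _, [] => (σ, [])
  | σ, _, m₁, _, [t] =>
      let x := (σ t.a).L
      let σ₁ := Function.update σ t.a ⟨⟨x.pos, true, x.red⟩, ⟨m₁, true, true⟩⟩
      (setIv σ₁ t.c (redInterval false x.pos m₁ true), [])
  | σ, m₂, m₁, e, t :: t' :: l =>
      let m := (σ t.a).L.pos
      let σ₁ := Function.update σ t.a (redInterval true m m₁ true)
      let σ₂ := setIv σ₁ t.b (redInterval false m m₁ false)
      let σ₃ := setIv σ₂ t.c (redInterval false m m₁ true)
      let σ₄ := if e.all (fun w => (σ₃ w).isClosedOpen m₁ m₂)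
        then setIfWhite σ₃ t.d (redInterval true m m₁ false) else σ₃
      let r := execLeft σ₄ m₁ m t.d (t' :: l)
      (r.1, m :: r.2)

namespace SweepData

/-- The zone lines `M_0` and `M_0'`. -/
def m0 (D : SweepData V) : ℝ := (D.start D.base.a).L.pos

def m0' (D : SweepData V) : ℝ := (D.start D.base.a).R.pos

def leftResult (D : SweepData V) : MixedRep V × List ℝ :=
  execLeft (execBase D.start D.base) D.m0' D.m0 D.base.d D.left

/-- The right part, carried out in the reflected representation. -/
def rightResult (D : SweepData V) : MixedRep V × List ℝ :=
  execLeft (MixedRep.mirror D.leftResult.1) (-D.m0) (-D.m0') D.base.c D.right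

/-- The representation at the end of the sweep. -/
def final (D : SweepData V) : MixedRep V := MixedRep.mirror D.rightResult.1

def leftLines (D : SweepData V) : List ℝ := D.m0 :: D.leftResult.2

def rightLines (D : SweepData V) : List ℝ := D.m0' :: D.rightResult.2.map (fun x => -x)

def IsZoneLine (D : SweepData V) (x : ℝ) : Prop := x ∈ D.leftLines ∨ x ∈ D.rightLines

def steps (D : SweepData V) : List (Step V) := D.base :: (D.left ++ D.right)

/-- All vertices identified in the sweep as being of type `a`, `b`, `c` or `d`. -/
def roles (D : SweepData V) : List V := D.steps.flatMap Step.roles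

def IsTypeA (D : SweepData V) (v : V) : Prop := ∃ t ∈ D.steps, t.a = v

/-- `v` is of type `b` or `c` in the base step or in the left part. -/
def IsLeftTypeBC (D : SweepData V) (v : V) : Prop :=
  ∃ t ∈ D.base :: D.left, t.b = some v ∨ t.c = some v

/-- `v` is of type `b` or `d` in the base step or in the right part. -/
def IsRightTypeBD (D : SweepData V) (v : V) : Prop :=
  ∃ t ∈ D.base.swap :: D.right, t.b = some v ∨ t.c = some v

def IsMergingC (D : SweepData V) (v : V) : Prop :=
  ∃ t ∈ D.left.getLast?, t.Merging D.start ∧ t.c = some v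

def IsMergingD (D : SweepData V) (v : V) : Prop :=
  ∃ t ∈ D.right.getLast?, t.Merging D.start.mirror ∧ t.c = some v

/-- The endpoint of `v` on side `s` participates in the sweep. -/
def EndParticipates (D : SweepData V) (v : V) (s : Side) : Prop :=
  (v ∈ D.roles ∧ D.IsZoneLine ((D.final v).pt s).pos) ∨
    (s = .left ∧ D.IsMergingC v) ∨ (s = .right ∧ D.IsMergingD v)

def Participates (D : SweepData V) (v : V) : Prop := ∃ s, D.EndParticipates v s

/-- The operations of the sweep are consistent: no vertex is identified in two roles, the vertices
`a_k`, `c_k` (and `a_k'`, `d_k'`) that peek into the same pair are in the right order, and all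
intervals stay nondegenerate. -/
structure Consistent (D : SweepData V) : Prop where
  nodup : D.roles.Nodup
  left_lt : ∀ t ∈ D.left, ∀ c, t.c = some c → (D.start t.a).L.pos < (D.start c).L.pos
  right_lt : ∀ t ∈ D.right, ∀ d, t.c = some d → (D.start d).R.pos < (D.start t.a).R.pos
  lt : ∀ v, (D.final v).L.pos < (D.final v).R.pos

end SweepData

/-! ## Runs of the algorithm -/

/-- `IsRun G σ₀ H σ`: starting from `σ₀`, the algorithm has performed the complete sweeps listed in
`H`, for some choice of the `ab`-pairs with which the sweeps start, and has arrived at `σ`. -/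
inductive IsRun (G : SimpleGraph V) (σ₀ : MixedRep V) :
    List (SweepData V) → MixedRep V → Prop
  | nil : IsRun G σ₀ [] σ₀
  | snoc {H : List (SweepData V)} {σ : MixedRep V} {D : SweepData V} :
      IsRun G σ₀ H σ → D.start = σ → IsSweep G D → IsRun G σ₀ (H ++ [D]) D.final

/-- The assertions about a zone line `x` of the sweep `D` in the representation `σ` that is reached
after the later sweeps listed in `later`. -/
structure ZoneLineProps (σ : MixedRep V) (D : SweepData V) (later : List (SweepData V))
    (x : ℝ) : Prop where
  red : ∀ v s, ((σ v).pt s).pos = x → ((σ v).pt s).red = true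
  typeA : ∃ a a', D.IsTypeA a ∧ D.Participates a ∧ D.IsTypeA a' ∧ D.Participates a' ∧
    (σ a).R.pos = x ∧ (σ a').L.pos = x
  sameEnds : ∀ v s, ((σ v).pt s).pos = x →
    ∃ a, D.IsTypeA a ∧ D.Participates a ∧ (σ v).SameEnds (σ a)
  openLeft : x ∈ D.leftLines → ∃ v, D.IsLeftTypeBC v ∧
    (σ v).L.pos = x ∧ (σ v).L.closed = false
  openRight : x ∈ D.rightLines → ∃ v, D.IsRightTypeBD v ∧
    (σ v).R.pos = x ∧ (σ v).R.closed = false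
  origin : ∀ v s, ((σ v).pt s).pos = x →
    D.Participates v ∨ ∃ E ∈ later,
      (E.IsMergingC v ∧ (E.final v).L.pos = x) ∨ (E.IsMergingD v ∧ (E.final v).R.pos = x)

end Operations

/-! ## Step counting

The algorithm is now written as a program for a random access machine. The intervals are held in an
array indexed by the vertices; reading and writing array entries, and any fixed Boolean combination
of comparisons between a bounded number of entries, counts as one elementary step. -/

/-- The result of a computation together with the number of elementary steps it has taken. -/
structure Timed (α : Type*) where
  val : α
  time : ℕ

namespace Timed

/-- A computation of `k` elementary steps with result `x`. -/
def charge {α : Type*} (k : ℕ) (x : α) : Timed α := ⟨x, k⟩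

/-- Sequential composition: the numbers of steps add up. -/
def bind {α β : Type*} (x : Timed α) (f : α → Timed β) : Timed β :=
  ⟨(f x.val).val, x.time + (f x.val).time⟩

end Timed

noncomputable section Program

namespace MInterval

/-- Intersection test for nondegenerate intervals. -/
def meetsTest (I J : MInterval) : Bool :=
  (decide (I.L.pos < J.R.pos) ||
    (decide (I.L.pos = J.R.pos) && I.L.closed && J.R.closed)) &&
  (decide (J.L.pos < I.R.pos) ||
    (decide (J.L.pos = I.R.pos) && J.L.closed && I.R.closed))

/-- Test for strict containment of nondegenerate intervals. -/
def strictTest (I J : MInterval) : Bool :=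
  (decide (J.L.pos < I.L.pos) ||
    (decide (J.L.pos = I.L.pos) && (J.L.closed || !I.L.closed))) &&
  (decide (I.R.pos < J.R.pos) ||
    (decide (I.R.pos = J.R.pos) && (J.R.closed || !I.R.closed))) &&
  !(decide (I.L.pos = J.L.pos) && decide (I.R.pos = J.R.pos))

end MInterval

variable {V : Type u} [DecidableEq V]

def peekTest (σ : MixedRep V) (x a b : V) : Bool :=
  (σ x).meetsTest (σ a) && !(σ x).meetsTest (σ b) && decide ((σ x).R.pos ≤ (σ b).L.pos)

/-- One pass through a list of vertices, collecting those that pass the test `p`. -/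
def scan (p : V → Timed Bool) : List V → Timed (List V)
  | [] => .charge 1 []
  | v :: l => (p v).bind fun h => (scan p l).bind fun r =>
      .charge 1 (if h then v :: r else r)

/-- One pass through a list of vertices, counting those that pass the test `p`. -/
def count (p : V → Timed Bool) : List V → Timed ℕ
  | [] => .charge 1 0
  | v :: l => (p v).bind fun h => (count p l).bind fun r =>
      .charge 1 (if h then r + 1 else r)

/-- Fill an array indexed by the vertices `vs`. -/
def tabulate {β : Type*} (f : V → Timed β) (vs : List V) : Timed (V → β) :=
  ⟨fun v => (f v).val, (vs.map fun v => (f v).time + 1).sum⟩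

/-- What is kept from the input: the initial intervals and, for every vertex, the numbers of vertices
whose initial intervals lie completely to the left and completely to the right of its own. -/
structure Tables (V : Type u) where
  init : MixedRep V
  before : V → ℕ
  after : V → ℕ

def makeTables (vs : List V) (σ₀ : MixedRep V) : Timed (Tables V) :=
  (tabulate (fun v =>
    count (fun w => .charge 1 (decide ((σ₀ w).R.pos < (σ₀ v).L.pos))) vs) vs).bind fun p =>
  (tabulate (fun v =>
    count (fun w => .charge 1 (decide ((σ₀ v).R.pos < (σ₀ w).L.pos))) vs) vs).bind fun q =>
  .charge vs.length ⟨σ₀, p, q⟩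

/-- Test whether the closed neighbourhood of `v` is that of `a` without the vertices in `X`, where `X`
lists distinct vertices of the closed neighbourhood of `a`. -/
def trimTest (T : Tables V) (a : V) (X : List V) (v : V) : Timed Bool :=
  .charge (X.length + 1)
    ((T.init v).meetsTest (T.init a) && decide (T.before a ≤ T.before v) &&
      decide (T.after a ≤ T.after v) &&
      decide (T.before v + T.after v = T.before a + T.after a + X.length) &&
      X.all fun x => !(T.init v).meetsTest (T.init x))

/-- Those of the vertices `a_{k-1}`, `d_{k-1}` of the step `s` that are neighbours of `a = a_k`. -/
def trimList (T : Tables V) (s : Step V) (a : V) : List V :=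
  (s.a :: s.d.toList).filter fun x => (T.init x).meetsTest (T.init a)

/-- The vertices that peek into `a_k b_k` or `a_k c_k` from the left. -/
def findPeekers (vs : List V) (σ : MixedRep V) (s : Step V) : Timed (List V) :=
  scan (fun x => .charge 1
    (s.b.any (fun b => peekTest σ x s.a b) || s.c.any (fun c => peekTest σ x s.a c))) vs

/-- Find the steps of the left part that follow the step `s`; the first argument bounds the number of
rounds. -/
def findSteps (vs : List V) (T : Tables V) (σ : MixedRep V) :
    ℕ → Step V → Timed (List (Step V))
  | 0, _ => .charge 1 []
  | k + 1, s => (findPeekers vs σ s).bind fun pk =>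
      match pk with
      | [] => .charge 1 []
      | x :: l =>
        let ac : V × Option V := match l with
          | [] => (x, none)
          | y :: _ => if (σ x).R.pos < (σ y).R.pos then (x, some y) else (y, some x)
        (scan (fun u => .charge 1 ((σ u).strictTest (σ ac.1))) vs).bind fun bs =>
        if (bs.isEmpty && ac.2.isNone) || (ac.2.isSome && (σ ac.1).L.red) then
          .charge 1 [⟨ac.1, bs.head?, ac.2, none⟩]
        else
          (scan (trimTest T ac.1 (trimList T s ac.1)) vs).bind fun ds =>
          let t : Step V := ⟨ac.1, bs.head?, ac.2, ds.head?⟩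
          (findSteps vs T σ k t).bind fun r => .charge 1 (t :: r)

/-- One sweep from the `ab`-pair `a`, `b`. Reflecting a representation takes one step for each
vertex; each step of the sweep redefines at most four intervals. -/
def sweepOnce (vs : List V) (T : Tables V) (σ : MixedRep V) (a b : V) : Timed (MixedRep V) :=
  (Timed.charge vs.length σ.mirror).bind fun σ' =>
  (scan (fun x => .charge 1 (peekTest σ x a b)) vs).bind fun pl =>
  (scan (fun x => .charge 1 (peekTest σ' x a b)) vs).bind fun pr =>
  (scan (trimTest T a pl) vs).bind fun cs =>
  (scan (trimTest T a pr) vs).bind fun ds =>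
  let s : Step V := ⟨a, some b, cs.head?, ds.head?⟩
  (findSteps vs T σ vs.length s).bind fun l =>
  (findSteps vs T σ' vs.length s.swap).bind fun r =>
  .charge (10 * (l.length + r.length + 1) + 2 * vs.length) (SweepData.mk σ s l r).final

/-- Go once through a list of pairs of vertices, and perform a sweep at each pair that is an `ab`-pair
at that moment. -/
def sweepPairs (vs : List V) (T : Tables V) : List (V × V) → MixedRep V → Timed (MixedRep V)
  | [], σ => .charge 1 σ
  | p :: l, σ =>
      (Timed.charge 1 ((σ p.2).strictTest (σ p.1))).bind fun h =>
      (if h then sweepOnce vs T σ p.1 p.2 else .charge 1 σ).bind fun σ' =>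
      sweepPairs vs T l σ'

/-- The whole algorithm, for the vertices listed in `vs` and the initial representation `σ₀`. -/
def sweepProgram (vs : List V) (σ₀ : MixedRep V) : Timed (MixedRep V) :=
  (makeTables vs σ₀).bind fun T => sweepPairs vs T (vs ×ˢ vs) σ₀

end Program

/-! ## Discrete interval models -/

/-! The maximal cliques are numbered along the line, and by twin-freeness a vertex is determined by
the first and the last clique it occupies, `lo v` and `hi v`. In every clique some vertex starts and
some vertex ends. The inclusion property says that the initial endpoints belonging to one clique are
ordered without nesting. The static structure thus becomes integer arithmetic, and each forbidden
graph an impossible pattern of integers.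

A sweep to the left runs along pairs `(a, x)`, formalised by `LLink`: first a vertex with another
one nested in it, then again and again the two vertices that end in the first clique of `a`. The
pairs passed so far form a copy of some `H_k`, so the forbidden families apply at its tail and make
the situation rigid: `x` starts exactly one clique after `a` (`LLink.lo_eq`), at most two vertices
end in the first clique of `a` (`LLink.block_le_two`), `a` is dominated by no other vertex
(`LLink.max`), and a left link never collides with a right link (`LLink.no_conflict`).
Identification of the vertices of a sweep is therefore forced.

The dynamics rest on a single invariant, `SweepInv`. A sweep collapses certain cliques to zone
lines. A red endpoint lies closed on the line of its own clique, or open on the line of the adjacent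
clique; the second kind is harmless because all opposite endpoints of that adjacent clique lie on
the same line. Hence intersection still encodes `lo u ≤ hi v` (`SweepInv.reach_iff`), and the graph
is preserved. The remaining strict containments are exactly the nested pairs that are still entirely
white (`SweepInv.strictlyIn_iff`). During a sweep, the cliques whose opposite endpoints have not
been moved yet are recorded as pending; `Wrote.base_inv`, `Wrote.step_inv` and `WroteLast.last_inv`
pass this obligation on and finally discharge it. The right part is the left part of the reflected
representation.

Red endpoints never change again, and an old zone line receives new endpoints only through merging
vertices; this gives the history of the zone lines. For the running time, each step of a sweep costs
linear time and turns its own white endpoint red, so all sweeps together have at most `2|V|` steps.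
Strict containments are never created, so one pass through all pairs suffices. -/

/-- A discrete interval model of a graph without forbidden induced subgraphs: the vertex `v`
occupies the maximal cliques `lo v, …, hi v` of a clique path. -/
structure Model {V : Type u} (G : SimpleGraph V) (lo hi : V → ℤ) : Prop where
  le : ∀ v, lo v ≤ hi v
  adj : ∀ u v, u ≠ v → (G.Adj u v ↔ lo u ≤ hi v ∧ lo v ≤ hi u)
  inj : ∀ u v, lo u = lo v → hi u = hi v → u = v
  exLo : ∀ i u v, lo u ≤ i → i ≤ hi v → ∃ x, lo x = i
  exHi : ∀ i u v, lo u ≤ i → i ≤ hi v → ∃ x, hi x = i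
  free : ForbiddenFree G

section Static

variable {V : Type u} {G : SimpleGraph V} {lo hi : V → ℤ}

namespace Model

/-- Reversing the order of the cliques exchanges first and last cliques. Statements about the right
side are deduced from their left versions in this way. -/
theorem mirror (M : Model G lo hi) : Model G (fun v => -hi v) (fun v => -lo v) where
  le v := by have := M.le v; omega
  adj u v h := by rw [M.adj u v h]; constructor <;> rintro ⟨h₁, h₂⟩ <;> constructor <;> omega
  inj u v h₁ h₂ := M.inj u v (by omega) (by omega)
  exLo i u v h₁ h₂ := by
    obtain ⟨x, hx⟩ := M.exHi (-i) v u (by omega) (by omega)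
    exact ⟨x, by omega⟩
  exHi i u v h₁ h₂ := by
    obtain ⟨x, hx⟩ := M.exLo (-i) v u (by omega) (by omega)
    exact ⟨x, by omega⟩
  free := M.free

theorem ne_coord (M : Model G lo hi) {u v : V} (h : u ≠ v) : lo u ≠ lo v ∨ hi u ≠ hi v := by
  by_contra! hc
  exact h (M.inj u v hc.1 hc.2)

/-- Images with pairwise different coordinates make the map injective, and adjacency is overlap of
coordinates, so an induced copy is found by checking integer inequalities. -/
theorem contained_of_rel (M : Model G lo hi) {W : Type*} (r : W → W → Prop) (f : W → V)
    (h : ∀ p q, p ≠ q → (lo (f p) ≠ lo (f q) ∨ hi (f p) ≠ hi (f q)) ∧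
      ((lo (f p) ≤ hi (f q) ∧ lo (f q) ≤ hi (f p)) ↔ r p q ∨ r q p)) :
    (SimpleGraph.fromRel r).IsIndContained G := by
  have hinj : Function.Injective f := by
    intro p q hpq
    by_contra hne
    have := (h p q hne).1
    rw [hpq] at this
    simp at this
  refine ⟨⟨⟨f, hinj⟩, ?_⟩⟩
  intro p q
  by_cases hpq : p = q
  · subst hpq; simp
  · simp only [Function.Embedding.coeFn_mk, SimpleGraph.fromRel_adj, ne_eq, hpq,
      not_false_eq_true, true_and]
    rw [M.adj _ _ (fun e => hpq (hinj e))]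
    exact (h p q hpq).2

theorem contained_edgeList (M : Model G lo hi) {m : ℕ} (E : List (ℕ × ℕ)) (f : Fin m → V)
    (h : ∀ i j : Fin m, i < j → (lo (f i) ≠ lo (f j) ∨ hi (f i) ≠ hi (f j)) ∧
      ((lo (f i) ≤ hi (f j) ∧ lo (f j) ≤ hi (f i)) ↔
        ((i : ℕ), (j : ℕ)) ∈ E ∨ ((j : ℕ), (i : ℕ)) ∈ E)) :
    (edgeListGraph m E).IsIndContained G := by
  refine M.contained_of_rel _ f fun p q hpq => ?_
  rcases lt_or_gt_of_ne hpq with hlt | hlt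
  · exact h p q hlt
  · obtain ⟨h₁, h₂⟩ := h q p hlt
    refine ⟨?_, ?_⟩
    · rcases h₁ with h₁ | h₁
      · exact .inl h₁.symm
      · exact .inr h₁.symm
    · rw [and_comm, h₂, or_comm]

/-! ### Small forbidden graphs as patterns of coordinates -/

/-- No vertex meets four pairwise disjoint intervals. -/
theorem no_k14 (M : Model G lo hi) {c x₁ x₂ x₃ x₄ : V} (h₁ : lo c ≤ hi x₁) (h₁₂ : hi x₁ < lo x₂)
    (h₂₃ : hi x₂ < lo x₃) (h₃₄ : hi x₃ < lo x₄) (h₄ : lo x₄ ≤ hi c) : False := by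
  have l₀ := M.le c; have l₁ := M.le x₁; have l₂ := M.le x₂; have l₃ := M.le x₃; have l₄ := M.le x₄
  refine M.free.k14 (M.contained_edgeList _ ![c, x₁, x₂, x₃, x₄] ?_)
  intro i j hij
  fin_cases i <;> fin_cases j <;> simp at hij ⊢ <;> omega

/-- Two vertices cannot both meet the same three pairwise disjoint intervals. -/
theorem no_k23 (M : Model G lo hi) {u w x₁ x₂ x₃ : V} (hu : u ≠ w) (h₁₂ : hi x₁ < lo x₂)
    (h₂₃ : hi x₂ < lo x₃) (hu₁ : lo u ≤ hi x₁) (hu₃ : lo x₃ ≤ hi u) (hw₁ : lo w ≤ hi x₁)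
    (hw₃ : lo x₃ ≤ hi w) : False := by
  have l₀ := M.le u; have l := M.le w
  have l₁ := M.le x₁; have l₂ := M.le x₂; have l₃ := M.le x₃
  have hne := M.ne_coord hu
  refine M.free.k23 (M.contained_edgeList _ ![u, w, x₁, x₂, x₃] ?_)
  intro i j hij
  fin_cases i <;> fin_cases j <;> simp at hij ⊢ <;> omega

/-- The disjoint intervals lie in the order `p`, `x`, `y`, `q`; `u` meets the first three and `w`
the last three. So `x`, `y` are the common neighbours and `p`, `q` the pendant ones. -/
theorem no_k24 (M : Model G lo hi) {u w p x y q : V} (hpx : hi p < lo x) (hxy : hi x < lo y)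
    (hyq : hi y < lo q) (hup : lo u ≤ hi p) (huy : lo y ≤ hi u) (huq : hi u < lo q)
    (hwp : hi p < lo w) (hwx : lo w ≤ hi x) (hwq : lo q ≤ hi w) : False := by
  have l₀ := M.le u; have l := M.le w
  have l₁ := M.le x; have l₂ := M.le y; have l₃ := M.le p; have l₄ := M.le q
  refine M.free.k24 (M.contained_edgeList _ ![u, w, x, y, p, q] ?_)
  intro i j hij
  fin_cases i <;> fin_cases j <;> simp at hij ⊢ <;> omega

/-- A vertex that meets a triangle and two further vertices to its right. -/
theorem no_b (M : Model G lo hi) {c x y z p q : V} {i : ℤ} (hxy : x ≠ y) (hyz : y ≠ z)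
    (hxz : x ≠ z) (hx : hi x = i) (hy : hi y = i) (hz : hi z = i) (hc : lo c ≤ i) (hp : i < lo p)
    (hpq : hi p < lo q) (hq : lo q ≤ hi c) : False := by
  have l₀ := M.le c
  have l₁ := M.le x; have l₂ := M.le y; have l₃ := M.le z; have l₄ := M.le p; have l₅ := M.le q
  have n₁ := M.ne_coord hxy; have n₂ := M.ne_coord hyz; have n₃ := M.ne_coord hxz
  refine M.free.b (M.contained_edgeList _ ![c, x, y, z, p, q] ?_)
  intro i j hij
  fin_cases i <;> fin_cases j <;> simp at hij ⊢ <;> omega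

/-- A vertex that meets a path on four vertices and a further vertex to its right. -/
theorem no_a (M : Model G lo hi) {c x₁ x₂ x₃ x₄ q : V} (hc : lo c ≤ hi x₁)
    (h₁₂ : lo x₂ ≤ hi x₁) (h₁₃ : hi x₁ < lo x₃)
    (h₂₃ : lo x₃ ≤ hi x₂) (h₂₄ : hi x₂ < lo x₄) (h₃₄ : lo x₄ ≤ hi x₃) (h₃q : hi x₃ < lo q)
    (h₄q : hi x₄ < lo q) (hq : lo q ≤ hi c) : False := by
  have l₀ := M.le c; have l₁ := M.le x₁; have l₂ := M.le x₂; have l₃ := M.le x₃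
  have l₄ := M.le x₄; have l₅ := M.le q
  refine M.free.a (M.contained_edgeList _ ![c, x₁, x₂, x₃, x₄, q] ?_)
  intro i j hij
  fin_cases i <;> fin_cases j <;> simp at hij ⊢ <;> omega

end Model

/-! ### Chains of pairs, i.e. copies of the graphs `H_k` -/

/-- The vertices `A 0, …, A k`, `C 1, …, C k`, `C 0`, `v` form a copy of `H_k` that extends to the
left. -/
structure Chain (lo hi : V → ℤ) (k : ℕ) (A C : ℕ → V) (v : V) : Prop where
  lo_lt : ∀ t ≤ k, lo (A t) < lo (C t)
  hi_lt : hi (C 0) < hi (A 0)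
  lo_v : lo v = hi (A 0)
  hiA : ∀ t < k, hi (A (t + 1)) = lo (A t)
  hiC : ∀ t < k, hi (C (t + 1)) = lo (A t)

namespace Chain

variable {k : ℕ} {A C : ℕ → V} {v : V}

theorem hiC_le (H : Chain lo hi k A C v) {t : ℕ} (ht : t ≤ k) : hi (C t) ≤ hi (A t) := by
  cases t with
  | zero => exact H.hi_lt.le
  | succ t => rw [H.hiA t ht, H.hiC t ht]

theorem hiC_eq (H : Chain lo hi k A C v) {t : ℕ} (ht : t ≤ k) (h0 : 1 ≤ t) :
    hi (C t) = hi (A t) := by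
  cases t with
  | zero => omega
  | succ t => rw [H.hiA t ht, H.hiC t ht]

theorem lo_lt_hi (M : Model G lo hi) (H : Chain lo hi k A C v) {t : ℕ} (ht : t ≤ k) :
    lo (A t) < hi (A t) := by
  have h₁ := H.lo_lt t ht
  have h₂ := H.hiC_le ht
  have h₃ := M.le (C t)
  omega

/-- The chain marches to the left: each `A (t + 1)` ends where `A t` starts and occupies more than
one clique, so only consecutive ones touch. -/
theorem hi_le_lo (M : Model G lo hi) (H : Chain lo hi k A C v) {s t : ℕ} (hst : s < t)
    (ht : t ≤ k) : hi (A t) ≤ lo (A s) ∧ (hi (A t) = lo (A s) ↔ t = s + 1) := by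
  induction t, hst using Nat.le_induction with
  | base => have := H.hiA s ht; constructor <;> simp [this]
  | succ t hst ih =>
    have h₁ := ih (by omega)
    have h₂ := H.hiA t ht
    have h₃ := H.lo_lt_hi M (t := t) (by omega)
    constructor
    · omega
    · constructor <;> intro h <;> simp only [Nat.succ_eq_add_one] at * <;> omega

/-- The vertices of a chain, indexed by the vertices of `H_k`. -/
def vertex (k : ℕ) (A C : ℕ → V) (v : V) : HVertex k → V
  | .a i => A i
  | .c i => C (i + 1)
  | .b => C 0
  | .v => v

/-- All contact between consecutive links happens in the clique `lo (A t)`: there `A (t + 1)` and `C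
(t + 1)` end and `A t` starts, while `C t` starts only later. `C 0` plays the part of `b_0`. -/
theorem rel_aux (M : Model G lo hi) (H : Chain lo hi k A C v) (p q : HVertex k) (hpq : p ≠ q) :
    (lo (vertex k A C v p) ≠ lo (vertex k A C v q) ∨
      hi (vertex k A C v p) ≠ hi (vertex k A C v q)) ∧
      ((lo (vertex k A C v p) ≤ hi (vertex k A C v q) ∧
        lo (vertex k A C v q) ≤ hi (vertex k A C v p)) ↔ HRel k p q ∨ HRel k q p) := by
  have hAA : ∀ s t : ℕ, s < t → t ≤ k → (lo (A s) ≠ lo (A t)) ∧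
      ((lo (A s) ≤ hi (A t) ∧ lo (A t) ≤ hi (A s)) ↔ t = s + 1) := by
    intro s t h ht
    have h₁ := H.hi_le_lo M h ht
    have h₂ := H.lo_lt_hi M ht
    have h₃ := H.lo_lt_hi M (t := s) (by omega)
    omega
  have hAC : ∀ s t : ℕ, s ≤ k → t ≤ k → (lo (A s) ≠ lo (C t) ∨ hi (A s) ≠ hi (C t)) ∧
      ((lo (A s) ≤ hi (C t) ∧ lo (C t) ≤ hi (A s)) ↔ t = s + 1 ∨ t = s) := by
    intro s t hs ht
    have h₀ := H.lo_lt t ht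
    have h₁ := H.hiC_le ht
    have h₂ := H.lo_lt_hi M hs
    have h₃ := M.le (C t)
    rcases lt_trichotomy s t with h | rfl | h
    · have h₄ := H.hi_le_lo M h ht
      have h₅ := H.hiC_eq ht (by omega)
      omega
    · omega
    · have h₄ := H.hi_le_lo M h hs
      omega
  have hCC : ∀ s t : ℕ, s < t → t ≤ k → hi (C t) < lo (C s) := by
    intro s t h ht
    have h₀ := H.lo_lt s (by omega)
    have h₁ := H.hiC_le ht
    have h₄ := H.hi_le_lo M h ht
    omega
  have hAv : ∀ s : ℕ, s ≤ k → (lo (A s) ≠ lo v) ∧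
      ((lo (A s) ≤ hi v ∧ lo v ≤ hi (A s)) ↔ s = 0) := by
    intro s hs
    have h₀ := H.lo_v
    have h₁ := H.lo_lt_hi M hs
    have h₂ := M.le v
    rcases Nat.eq_zero_or_pos s with rfl | h
    · omega
    · have h₄ := H.hi_le_lo M h hs
      have h₅ := H.lo_lt_hi M (Nat.zero_le k)
      omega
  have hCv : ∀ s : ℕ, s ≤ k → hi (C s) < lo v := by
    intro s hs
    have h₀ := H.lo_v
    have h₁ := H.hiC_le hs
    rcases Nat.eq_zero_or_pos s with rfl | h
    · have := H.hi_lt; omega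
    · have h₄ := H.hi_le_lo M h hs
      have h₅ := H.lo_lt_hi M (Nat.zero_le k)
      omega
  have lC : ∀ t, lo (C t) ≤ hi (C t) := fun t => M.le (C t)
  have lv := M.le v
  rcases p with i | i | _ | _ <;> rcases q with j | j | _ | _ <;>
    simp only [vertex, HRel, ne_eq, HVertex.a.injEq, HVertex.c.injEq, Fin.ext_iff, reduceCtorEq,
      not_false_eq_true, not_true_eq_false, or_false, false_or, or_self, iff_false] at hpq ⊢
  · rcases lt_or_gt_of_ne hpq with h | h
    · have := hAA i j h (by omega); omega
    · have := hAA j i h (by omega); omega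
  · have := hAC i (j + 1) (by omega) (by omega); omega
  · have := hAC i 0 (by omega) (by omega); omega
  · have := hAv i (by omega); omega
  · have := hAC j (i + 1) (by omega) (by omega); omega
  · have h₁ := lC (i + 1); have h₂ := lC (j + 1)
    rcases lt_or_gt_of_ne hpq with h | h
    · have := hCC (i + 1) (j + 1) (by omega) (by omega); omega
    · have := hCC (j + 1) (i + 1) (by omega) (by omega); omega
  · have h₁ := lC (i + 1); have h₂ := lC 0
    have := hCC 0 (i + 1) (by omega) (by omega); omega
  · have h₁ := lC (i + 1)
    have := hCv (i + 1) (by omega); omega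
  · have := hAC j 0 (by omega) (by omega); omega
  · have h₁ := lC (j + 1); have h₂ := lC 0
    have := hCC 0 (j + 1) (by omega) (by omega); omega
  · have h₁ := lC 0
    have := hCv 0 (by omega); omega
  · have := hAv j (by omega); omega
  · have h₁ := lC (j + 1)
    have := hCv (j + 1) (by omega); omega
  · have h₁ := lC 0
    have := hCv 0 (by omega); omega

/-- The additional vertices end before `A (k + 1)` does, and the rest of the chain starts no earlier
than the last clique of `A (k + 1)`. Hence they can meet only the two tail vertices. -/
theorem attach_contained (M : Model G lo hi) (H : Chain lo hi (k + 1) A C v) {m : ℕ}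
    {atA atC : List ℕ} {E : List (ℕ × ℕ)} (f : Fin m → V)
    (hf : ∀ i, hi (f i) < hi (A (k + 1)))
    (hA : ∀ i, (lo (f i) ≤ hi (A (k + 1)) ∧ lo (A (k + 1)) ≤ hi (f i)) ↔ (i : ℕ) ∈ atA)
    (hC : ∀ i, (lo (f i) ≤ hi (C (k + 1)) ∧ lo (C (k + 1)) ≤ hi (f i)) ↔ (i : ℕ) ∈ atC)
    (hE : ∀ i j : Fin m, i < j → (lo (f i) ≠ lo (f j) ∨ hi (f i) ≠ hi (f j)) ∧
      ((lo (f i) ≤ hi (f j) ∧ lo (f j) ≤ hi (f i)) ↔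
        ((i : ℕ), (j : ℕ)) ∈ E ∨ ((j : ℕ), (i : ℕ)) ∈ E)) :
    (attachTail k m atA atC E).IsIndContained G := by
  have key : ∀ (x : HVertex (k + 1)) (i : Fin m),
      hi (vertex (k + 1) A C v x) ≠ hi (f i) ∧
      ((lo (vertex (k + 1) A C v x) ≤ hi (f i) ∧ lo (f i) ≤ hi (vertex (k + 1) A C v x)) ↔
        (x = .a (Fin.last (k + 1)) ∧ (i : ℕ) ∈ atA) ∨ (x = .c (Fin.last k) ∧ (i : ℕ) ∈ atC)) := by
    intro x i
    have h₀ := hf i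
    have h₁ := H.lo_lt_hi M le_rfl
    have h₂ := H.hiC_eq le_rfl (by omega)
    have h₄ := M.le (f i)
    have hlow : ∀ t ≤ k, hi (A (k + 1)) ≤ lo (A t) := fun t ht =>
      (H.hi_le_lo M (by omega) le_rfl).1
    rcases x with t | t | _ | _ <;> simp only [vertex, HVertex.a.injEq, HVertex.c.injEq, Fin.ext_iff,
      reduceCtorEq, false_and, or_false, false_or, Fin.val_last]
    · by_cases ht : (t : ℕ) = k + 1
      · rw [ht, ← hA i]
        simp only [true_and]
        constructor
        · omega
        · exact and_comm
      · have := hlow t (by omega)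
        have := H.lo_lt_hi M (t := t) (by omega)
        simp only [ht, false_and, iff_false]
        omega
    · by_cases ht : (t : ℕ) = k
      · rw [ht, ← hC i]
        simp only [true_and]
        constructor
        · omega
        · exact and_comm
      · have := hlow (t + 1) (by omega)
        have := H.lo_lt (t + 1) (by omega)
        have := M.le (C (t + 1))
        simp only [ht, false_and, iff_false]
        omega
    · have := hlow 0 (by omega)
      have := H.lo_lt 0 (by omega)
      have := M.le (C 0)
      simp only [iff_false]
      omega
    · have := hlow 0 (by omega)
      have := H.lo_lt_hi M (t := 0) (by omega)
      have := H.lo_v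
      have := M.le v
      simp only [iff_false]
      omega
  refine M.contained_of_rel _ (Sum.elim (vertex (k + 1) A C v) f) ?_
  rintro (x | i) (y | j) hne
  · exact H.rel_aux M x y (fun e => hne (by rw [e]))
  · simp only [Sum.elim_inl, Sum.elim_inr, or_false]
    exact ⟨.inr (key x j).1, (key x j).2⟩
  · simp only [Sum.elim_inl, Sum.elim_inr, false_or]
    refine ⟨.inr (key y i).1.symm, ?_⟩
    rw [and_comm]
    exact (key y i).2
  · simp only [Sum.elim_inr]
    have hij : i ≠ j := fun e => hne (by rw [e])
    rcases lt_or_gt_of_ne hij with h | h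
    · exact hE i j h
    · obtain ⟨h₁, h₂⟩ := hE j i h
      refine ⟨?_, ?_⟩
      · rcases h₁ with h₁ | h₁
        · exact .inl h₁.symm
        · exact .inr h₁.symm
      · rw [and_comm, h₂, or_comm]

/-- The three vertices all end in the first clique of the tail vertex `A`, which the tail vertex `C`
does not occupy. -/
theorem no_fam1 (M : Model G lo hi) (H : Chain lo hi (k + 1) A C v) {x y z : V}
    (hxy : x ≠ y) (hyz : y ≠ z) (hxz : x ≠ z) (hx : hi x = lo (A (k + 1)))
    (hy : hi y = lo (A (k + 1))) (hz : hi z = lo (A (k + 1))) : False := by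
  have l₁ := M.le x; have l₂ := M.le y; have l₃ := M.le z
  have h₁ := H.lo_lt_hi M le_rfl
  have h₂ := H.lo_lt (k + 1) le_rfl
  have n₁ := M.ne_coord hxy; have n₂ := M.ne_coord hyz; have n₃ := M.ne_coord hxz
  refine M.free.fam1 k (H.attach_contained M ![x, y, z] ?_ ?_ ?_ ?_)
  · intro i; fin_cases i <;> simp <;> omega
  · intro i; fin_cases i <;> simp <;> omega
  · intro i; fin_cases i <;> simp <;> omega
  · intro i j hij
    fin_cases i <;> fin_cases j <;> simp at hij ⊢ <;> omega

/-- All of the path `x`, `y`, `z` meets the tail vertex `A`, only `z` gets as far as `C`, and `hza`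
keeps `z` away from the rest of the chain. -/
theorem no_fam2 (M : Model G lo hi) (H : Chain lo hi (k + 1) A C v) {x y z : V}
    (hx : lo (A (k + 1)) ≤ hi x) (hxy : lo y ≤ hi x) (hxz : hi x < lo z) (hyz : lo z ≤ hi y)
    (hy : hi y < lo (C (k + 1))) (hz : lo (C (k + 1)) ≤ hi z) (hza : hi z < hi (A (k + 1))) :
    False := by
  have l₁ := M.le x; have l₂ := M.le y; have l₃ := M.le z
  have h₁ := H.lo_lt_hi M le_rfl
  have h₂ := H.lo_lt (k + 1) le_rfl
  have h₃ := H.hiC_eq le_rfl (by omega)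
  refine M.free.fam2 k (H.attach_contained M ![x, y, z] ?_ ?_ ?_ ?_)
  · intro i; fin_cases i <;> simp <;> omega
  · intro i; fin_cases i <;> simp <;> omega
  · intro i; fin_cases i <;> simp <;> omega
  · intro i j hij
    fin_cases i <;> fin_cases j <;> simp at hij ⊢ <;> omega

theorem no_fam3 (M : Model G lo hi) (H : Chain lo hi (k + 1) A C v) {x y : V}
    (hx : lo (A (k + 1)) ≤ hi x) (hxy : hi x < lo y)
    (hy : hi y < lo (C (k + 1))) (hya : lo y ≤ hi (A (k + 1))) : False := by
  have l₁ := M.le x; have l₂ := M.le y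
  have h₁ := H.lo_lt_hi M le_rfl
  have h₂ := H.lo_lt (k + 1) le_rfl
  have h₃ := H.hiC_eq le_rfl (by omega)
  have h₄ := M.le (C (k + 1))
  refine M.free.fam3 k (H.attach_contained M ![x, y] ?_ ?_ ?_ ?_)
  · intro i; fin_cases i <;> simp <;> omega
  · intro i; fin_cases i <;> simp <;> omega
  · intro i; fin_cases i <;> simp <;> omega
  · intro i j hij
    fin_cases i <;> fin_cases j <;> simp at hij ⊢ <;> omega

/-- Here `w` meets both tail vertices, `u` and `z`, and `z` meets only the tail vertex `A`. -/
theorem no_fam4 (M : Model G lo hi) (H : Chain lo hi (k + 1) A C v) {w z u : V}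
    (huz : hi u < lo z) (hua : hi u < lo (A (k + 1))) (hwu : lo w ≤ hi u)
    (hza : lo (A (k + 1)) ≤ hi z) (hzc : hi z < lo (C (k + 1)))
    (hwc : lo (C (k + 1)) ≤ hi w) (hwa : hi w < hi (A (k + 1))) : False := by
  have l₁ := M.le w; have l₂ := M.le z; have l₃ := M.le u
  have h₁ := H.lo_lt_hi M le_rfl
  have h₂ := H.lo_lt (k + 1) le_rfl
  have h₃ := H.hiC_eq le_rfl (by omega)
  have h₄ := M.le (C (k + 1))
  refine M.free.fam4 k (H.attach_contained M ![w, z, u] ?_ ?_ ?_ ?_)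
  · intro i; fin_cases i <;> simp <;> omega
  · intro i; fin_cases i <;> simp <;> omega
  · intro i; fin_cases i <;> simp <;> omega
  · intro i j hij
    fin_cases i <;> fin_cases j <;> simp at hij ⊢ <;> omega

end Chain

end Static

section Static

variable {V : Type u} {G : SimpleGraph V} {lo hi : V → ℤ}

namespace Chain

variable {k : ℕ} {A C : ℕ → V} {v : V}

theorem tail_cases (M : Model G lo hi) (H : Chain lo hi (k + 1) A C v) (x : HVertex (k + 1)) :
    x = .a (Fin.last (k + 1)) ∨ x = .c (Fin.last k) ∨
      (x ≠ .a (Fin.last (k + 1)) ∧ x ≠ .c (Fin.last k) ∧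
        hi (A (k + 1)) ≤ lo (vertex (k + 1) A C v x)) := by
  have hlow : ∀ t ≤ k, hi (A (k + 1)) ≤ lo (A t) := fun t ht =>
    (H.hi_le_lo M (by omega) le_rfl).1
  rcases x with t | t | _ | _ <;> simp only [vertex, HVertex.a.injEq, HVertex.c.injEq, Fin.ext_iff,
    reduceCtorEq, false_or, Fin.val_last, ne_eq, not_false_eq_true, true_and]
  · by_cases ht : (t : ℕ) = k + 1
    · exact .inl ht
    · exact .inr ⟨ht, hlow t (by omega)⟩
  · by_cases ht : (t : ℕ) = k
    · exact .inl ht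
    · have h₁ := hlow (t + 1) (by omega)
      have h₂ := H.lo_lt (t + 1) (by omega)
      exact .inr ⟨ht, by omega⟩
  · have h₁ := hlow 0 (by omega)
    have h₂ := H.lo_lt 0 (by omega)
    omega
  · have h₁ := hlow 0 (by omega)
    have h₂ := H.lo_lt_hi M (t := 0) (by omega)
    have h₃ := H.lo_v
    omega

/-- The long tail vertices of the two chains overlap in exactly two cliques; the short one of the
right chain ends in the first of them, the short one of the left chain starts in the second. `h₄`
and `h₅` keep each chain's body away from the opposite tail. -/
theorem no_fam5 (M : Model G lo hi) (H : Chain lo hi (k + 1) A C v) {n : ℕ} {A' C' : ℕ → V}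
    {v' : V} (H' : Chain (fun v => -hi v) (fun v => -lo v) (n + 1) A' C' v')
    (h₁ : hi (A' (n + 1)) = lo (A (k + 1)) + 1) (h₂ : hi (C' (n + 1)) = lo (A (k + 1)))
    (h₃ : lo (C (k + 1)) = lo (A (k + 1)) + 1) (h₄ : hi (A' (n + 1)) < hi (A (k + 1)))
    (h₅ : lo (A' (n + 1)) < lo (A (k + 1))) : False := by
  have l₁ := H.hiC_eq le_rfl (by omega)
  have l₂ := H'.hiC_eq le_rfl (by omega)
  refine M.free.fam5 k n (M.contained_of_rel _
    (Sum.elim (vertex (k + 1) A C v) (vertex (n + 1) A' C' v')) ?_)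
  have key : ∀ (x : HVertex (k + 1)) (y : HVertex (n + 1)),
      lo (vertex (k + 1) A C v x) ≠ lo (vertex (n + 1) A' C' v' y) ∧
      ((lo (vertex (k + 1) A C v x) ≤ hi (vertex (n + 1) A' C' v' y) ∧
        lo (vertex (n + 1) A' C' v' y) ≤ hi (vertex (k + 1) A C v x)) ↔
        (x = .a (Fin.last (k + 1)) ∧ y = .a (Fin.last (n + 1))) ∨
        (x = .c (Fin.last k) ∧ y = .a (Fin.last (n + 1))) ∨
        (x = .a (Fin.last (k + 1)) ∧ y = .c (Fin.last n))) := by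
    intro x y
    have e₁ := M.le (vertex (k + 1) A C v x)
    have e₂ := M.le (vertex (n + 1) A' C' v' y)
    rcases H.tail_cases M x with rfl | rfl | ⟨n₁, n₂, hx⟩ <;>
    rcases H'.tail_cases M.mirror y with rfl | rfl | ⟨n₃, n₄, hy⟩ <;>
    simp only [vertex, Fin.val_last, reduceCtorEq, and_self, and_true, and_false, or_false,
      or_true, iff_true, iff_false, *] at * <;> omega
  rintro (x | x) (y | y) hne
  · exact H.rel_aux M x y (fun e => hne (by rw [e]))
  · simp only [Sum.elim_inl, Sum.elim_inr, or_false]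
    exact ⟨.inl (key x y).1, (key x y).2⟩
  · simp only [Sum.elim_inl, Sum.elim_inr, false_or]
    refine ⟨.inl (key y x).1.symm, ?_⟩
    rw [and_comm]
    exact (key y x).2
  · obtain ⟨h, h'⟩ := H'.rel_aux M.mirror x y (fun e => hne (by rw [e]))
    simp only [Sum.elim_inr]
    refine ⟨?_, ?_⟩
    · rcases h with h | h
      · exact .inr (by omega)
      · exact .inl (by omega)
    · rw [← h']
      constructor <;> rintro ⟨p, q⟩ <;> constructor <;> omega

end Chain

/-! ### Links -/

/-- The pairs of vertices that govern a step towards the left of a sweep: a vertex with a vertex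
nested in it, or the two vertices that peek into a previous pair. -/
inductive LLink (lo hi : V → ℤ) : V → V → Prop
  | base {a b : V} : lo a < lo b → hi b < hi a → LLink lo hi a b
  | step {a x p q : V} : LLink lo hi a x → hi p = lo a → hi q = lo a → lo p < lo q →
      LLink lo hi p q

/-- The mirror image of `LLink`. -/
abbrev RLink (lo hi : V → ℤ) : V → V → Prop := LLink (fun v => -hi v) (fun v => -lo v)

theorem LLink.lo_lt {a x : V} (h : LLink lo hi a x) : lo a < lo x := by
  cases h <;> assumption

theorem LLink.hi_le {a x : V} (h : LLink lo hi a x) : hi x ≤ hi a := by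
  cases h with
  | base _ h => exact h.le
  | step _ h₁ h₂ _ => rw [h₁, h₂]

theorem llink_neg_neg {a x : V} :
    LLink (fun v => - -lo v) (fun v => - -hi v) a x ↔ LLink lo hi a x := by
  simp only [neg_neg]

theorem RLink.lo_le {a x : V} (h : RLink lo hi a x) : lo a ≤ lo x := by
  have := LLink.hi_le h; omega

theorem RLink.base {a b : V} (h₁ : lo a < lo b) (h₂ : hi b < hi a) : RLink lo hi a b :=
  LLink.base (by omega) (by omega)

theorem RLink.step {a x p q : V} (h : RLink lo hi a x) (hp : lo p = hi a) (hq : lo q = hi a)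
    (hpq : hi q < hi p) : RLink lo hi p q :=
  LLink.step h (by omega) (by omega) (by omega)

/-- Unrolling the inductive definition recovers the pairs passed so far. The two vertices produced
by a step end together, so only a chain of length zero has a nested pair at its tail. -/
theorem LLink.exists_chain (M : Model G lo hi) {a x : V} (h : LLink lo hi a x) :
    ∃ k A C v, Chain lo hi k A C v ∧ A k = a ∧ C k = x ∧ (k = 0 ↔ hi x < hi a) := by
  induction h with
  | @base a b h₁ h₂ =>
    obtain ⟨v, hv⟩ := M.exLo (hi a) a a (M.le a) le_rfl
    refine ⟨0, fun _ => a, fun _ => b, v, ⟨?_, h₂, hv, ?_, ?_⟩, rfl, rfl, by simp [h₂]⟩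
    · intro _ _; exact h₁
    · intro t ht; omega
    · intro t ht; omega
  | @step a x p q _ hp hq hpq ih =>
    obtain ⟨k, A, C, v, H, rfl, rfl, -⟩ := ih
    refine ⟨k + 1, fun t => if t = k + 1 then p else A t, fun t => if t = k + 1 then q else C t, v,
      ⟨?_, ?_, ?_, ?_, ?_⟩, by simp, by simp, by simp [hp, hq]⟩
    · intro t ht
      by_cases h : t = k + 1
      · simp [h, hpq]
      · simpa [h] using H.lo_lt t (by omega)
    · simpa using H.hi_lt
    · simpa using H.lo_v
    · intro t ht
      by_cases h : t = k
      · simp [h, hp]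
      · have : t ≠ k + 1 := by omega
        simpa [h, this] using H.hiA t (by omega)
    · intro t ht
      by_cases h : t = k
      · simp [h, hq]
      · have : t ≠ k + 1 := by omega
        simpa [h, this] using H.hiC t (by omega)

theorem LLink.exists_chain_succ (M : Model G lo hi) {a x : V} (h : LLink lo hi a x)
    (hx : hi x = hi a) : ∃ k A C v, Chain lo hi (k + 1) A C v ∧ A (k + 1) = a ∧ C (k + 1) = x := by
  obtain ⟨k, A, C, v, H, h₁, h₂, h₃⟩ := h.exists_chain M
  cases k with
  | zero => have := h₃.1 rfl; omega
  | succ k => exact ⟨k, A, C, v, H, h₁, h₂⟩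

/-- A right block at which a link starts has at most two elements. -/
theorem LLink.block_le_two (M : Model G lo hi) {a x : V} (h : LLink lo hi a x) {p q r : V}
    (hp : hi p = lo a) (hq : hi q = lo a) (hr : hi r = lo a) : p = q ∨ q = r ∨ p = r := by
  -- Vertices with a common last clique form a triangle. Attached to a nested pair it yields
  -- `graphB`, attached to a longer chain the first family.
  by_contra! hne
  rcases h.hi_le.lt_or_eq with hx | hx
  · obtain ⟨v, hv⟩ := M.exLo (hi a) a a (M.le a) le_rfl
    exact M.no_b hne.1 hne.2.1 hne.2.2 hp hq hr le_rfl h.lo_lt (by omega) hv.le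
  · obtain ⟨k, A, C, v, H, rfl, rfl⟩ := h.exists_chain_succ M hx
    exact H.no_fam1 M hne.1 hne.2.1 hne.2.2 hp hq hr

/-! ### Rigidity of nested pairs -/

section Nested

variable {a b : V}

/-- A vertex with a vertex nested in it is dominated by no other vertex. -/
theorem nested_max (M : Model G lo hi) (h₁ : lo a < lo b) (h₂ : hi b < hi a) {v : V}
    (hl : lo v ≤ lo a) (hr : hi a ≤ hi v) : v = a := by
  by_contra hne
  -- A second dominating vertex would share with `a` the three disjoint neighbours `p`, `b`, `q`,
  -- where `p` ends in the first and `q` starts in the last clique of `a`.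
  obtain ⟨p, hp⟩ := M.exHi (lo a) a a le_rfl (M.le a)
  obtain ⟨q, hq⟩ := M.exLo (hi a) a a (M.le a) le_rfl
  exact M.no_k23 (x₁ := p) (x₂ := b) (x₃ := q) hne (by omega) (by omega) (by omega) (by omega)
    (by omega) (by omega)

/-- Otherwise `b` misses the clique after `lo a`. The vertex `y` ending there must start no later
than `lo a`, and the vertex `x` starting there must reach `b`, for else `a` has four disjoint
neighbours. Then `p`, `y`, `x`, `b` is the path and `q` the pendant vertex of `graphA`. -/
theorem nested_lo (M : Model G lo hi) (h₁ : lo a < lo b) (h₂ : hi b < hi a) :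
    lo b = lo a + 1 := by
  by_contra hne
  have hb := M.le b
  obtain ⟨p, hp⟩ := M.exHi (lo a) a a le_rfl (M.le a)
  obtain ⟨q, hq⟩ := M.exLo (hi a) a a (M.le a) le_rfl
  obtain ⟨x, hx⟩ := M.exLo (lo a + 1) a a (by omega) (by omega)
  obtain ⟨y, hy⟩ := M.exHi (lo a + 1) a a (by omega) (by omega)
  have hx' := M.le x
  have hy' : lo y ≤ lo a := by
    by_contra hc
    exact M.no_k14 (c := a) (x₁ := p) (x₂ := y) (x₃ := b) (x₄ := q) (by omega) (by omega)
      (by omega) (by omega) (by omega)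
  have hxb : lo b ≤ hi x := by
    by_contra hc
    exact M.no_k14 (c := a) (x₁ := p) (x₂ := x) (x₃ := b) (x₄ := q) (by omega) (by omega)
      (by omega) (by omega) (by omega)
  -- If `x` reached the last clique of `a`, both would meet the disjoint vertices `y`, `b`, `q`.
  have hxa : hi x < hi a := by
    by_contra hc
    have : x ≠ a := by rintro rfl; omega
    exact M.no_k23 (x₁ := y) (x₂ := b) (x₃ := q) this (by omega) (by omega) (by omega) (by omega)
      (by omega) (by omega)
  exact M.no_a (c := a) (x₁ := p) (x₂ := y) (x₃ := x) (x₄ := b) (q := q) (by omega) (by omega)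
    (by omega) (by omega) (by omega) (by omega) (by omega) (by omega) (by omega)

theorem nested_hi (M : Model G lo hi) (h₁ : lo a < lo b) (h₂ : hi b < hi a) :
    hi b = hi a - 1 := by
  have := nested_lo M.mirror (a := a) (b := b) (by omega) (by omega)
  omega

end Nested

/-- A vertex `v` overlapping `c` on both sides has `c` nested in it, hence ends at `lo a + 1`, where
`x` starts, and so meets both vertices of the link. The hypothesis `hax` is separate because the
lemma is used inside the induction that proves it. -/
theorem LLink.not_covered_aux (M : Model G lo hi) {a x c v : V} (h : LLink lo hi a x)
    (hax : lo x = lo a + 1) (hc : hi c = lo a) (hv : lo v < lo c) (hv' : lo a < hi v) : False := by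
  have e₁ := nested_lo M (a := v) (b := c) hv (by omega)
  have e₂ := nested_hi M (a := v) (b := c) hv (by omega)
  have hcl := M.le c
  have hx := M.le x
  obtain ⟨p, hp⟩ := M.exHi (lo v) v v le_rfl (M.le v)
  rcases h.hi_le.lt_or_eq with hx' | hx'
  · obtain ⟨q, hq⟩ := M.exLo (hi a) a a (M.le a) le_rfl
    exact M.no_k24 (p := p) (x := c) (y := x) (q := q) (u := v) (w := a) (by omega) (by omega)
      (by omega) (by omega) (by omega) (by omega) (by omega) (by omega) (by omega)
  · cases h with
    | base _ h₂ => omega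
    | @step a₁ x₁ _ _ h₀ h₁ h₂ h₃ =>
      -- If `a` is this short, `v` ends together with `a` and `x`, a right block of three. Otherwise
      -- `v` ends before `a`, and the fourth family applies.
      by_cases hj : hi a = lo a + 1
      · have hva : v ≠ a := by rintro rfl; omega
        have hvx : v ≠ x := by rintro rfl; omega
        have hax' : a ≠ x := by rintro rfl; omega
        rcases h₀.block_le_two M (p := v) (q := a) (r := x) (by omega) h₁ h₂ with h | h | h
        · exact hva h
        · exact hax' h
        · exact hvx h
      · have hl : LLink lo hi a x := .step h₀ h₁ h₂ h₃
        obtain ⟨k, A, C, w, H, rfl, rfl⟩ := hl.exists_chain_succ M hx'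
        exact H.no_fam4 M (w := v) (z := c) (u := p) (by omega) (by omega) (by omega) (by omega)
            (by omega) (by omega) (by omega)

/-- Induction along the link. In the step, suppose `q` misses the clique after `lo p`. The vertices
that end and start in that clique, with one ending at `lo p`, attach to the tail either two disjoint
vertices (third family) or a path (second family). -/
theorem LLink.lo_eq (M : Model G lo hi) {a x : V} (h : LLink lo hi a x) : lo x = lo a + 1 := by
  induction h with
  | base h₁ h₂ => exact nested_lo M h₁ h₂
  | @step a x p q h hp hq hpq ih =>
    by_contra hne
    have hl : LLink lo hi p q := .step h hp hq hpq
    have lq := M.le q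
    have la := h.lo_lt
    have lx := M.le x
    have lax := h.hi_le
    obtain ⟨p₁, hp₁⟩ := M.exHi (lo p) p p le_rfl (M.le p)
    obtain ⟨y, hy⟩ := M.exHi (lo p + 1) p p (by omega) (by omega)
    obtain ⟨z, hz⟩ := M.exLo (lo p + 1) p p (by omega) (by omega)
    have lz := M.le z
    have ly := M.le y
    have hzi : hi z ≠ hi p := by
      intro e
      have h₁ : p ≠ q := by rintro rfl; omega
      have h₂ : p ≠ z := by rintro rfl; omega
      have h₃ : q ≠ z := by rintro rfl; omega
      rcases h.block_le_two M hp hq (r := z) (by omega) with h | h | h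
      · exact h₁ h
      · exact h₃ h
      · exact h₂ h
    -- Passing the common last clique of `p` and `q` would make `z` overlap `q` on both sides; the
    -- induction hypothesis is needed to exclude this.
    have hzq : lo q ≤ hi z → hi z < hi p := by
      intro h₁
      by_contra h₂
      exact h.not_covered_aux M ih (c := q) (v := z) hq (by omega) (by omega)
    obtain ⟨k, A, C, w, H, rfl, rfl⟩ := hl.exists_chain_succ M (by omega)
    have hy' : lo y ≤ lo (A (k + 1)) := by
      by_contra hc
      exact H.no_fam3 M (x := p₁) (y := y) (by omega) (by omega) (by omega) (by omega)
    by_cases hzq' : lo (C (k + 1)) ≤ hi z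
    · exact H.no_fam2 M (x := p₁) (y := y) (z := z) (by omega) (by omega) (by omega) (by omega)
        (by omega) (by omega) (by omega)
    · exact H.no_fam3 M (x := p₁) (y := z) (by omega) (by omega) (by omega) (by omega)

theorem RLink.hi_eq (M : Model G lo hi) {a x : V} (h : RLink lo hi a x) : hi x = hi a - 1 := by
  have := LLink.lo_eq M.mirror h
  omega

/-- No element of the right block at which a link starts is overlapped on both sides. -/
theorem LLink.not_covered (M : Model G lo hi) {a x c v : V} (h : LLink lo hi a x)
    (hc : hi c = lo a) (hv : lo v < lo c) (hv' : lo a < hi v) : False :=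
  h.not_covered_aux M (h.lo_eq M) hc hv hv'

/-- The first vertex of a link is dominated by no other vertex. -/
theorem LLink.max (M : Model G lo hi) {a x : V} (h : LLink lo hi a x) {v : V}
    (hl : lo v ≤ lo a) (hr : hi a ≤ hi v) : v = a := by
  cases h with
  | base h₁ h₂ => exact nested_max M h₁ h₂ hl hr
  | @step a₁ x₁ _ _ h₀ h₁ h₂ h₃ =>
    by_contra hva
    -- A dominating vertex either passes the common end of `a` and `x`, and overlaps `x` on both
    -- sides, or is a third vertex of their right block.
    rcases hr.lt_or_eq with hr | hr
    · exact h₀.not_covered M (c := x) (v := v) h₂ (by omega) (by omega)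
    · have hvx : v ≠ x := by rintro rfl; omega
      have hax' : a ≠ x := by rintro rfl; omega
      rcases h₀.block_le_two M (p := v) (q := a) (r := x) (by omega) h₁ h₂ with h | h | h
      · exact hva h
      · exact hax' h
      · exact hvx h

theorem RLink.max (M : Model G lo hi) {a x : V} (h : RLink lo hi a x) {v : V}
    (hl : lo v ≤ lo a) (hr : hi a ≤ hi v) : v = a :=
  LLink.max M.mirror h (by omega) (by omega)

theorem RLink.block_le_two (M : Model G lo hi) {a x : V} (h : RLink lo hi a x) {p q r : V}
    (hp : lo p = hi a) (hq : lo q = hi a) (hr : lo r = hi a) : p = q ∨ q = r ∨ p = r :=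
  LLink.block_le_two M.mirror h (by omega) (by omega) (by omega)

/-- In a link that is not nested, the right block of the first vertex consists of its two
vertices. -/
theorem LLink.block_eq (M : Model G lo hi) {a x : V} (h : LLink lo hi a x) (hx : hi x = hi a)
    {v : V} (hv : hi v = hi a) : v = a ∨ v = x := by
  cases h with
  | base _ h₂ => omega
  | step h₀ h₁ h₂ h₃ =>
    have hax' : a ≠ x := by rintro rfl; omega
    rcases h₀.block_le_two M (p := v) (q := a) (r := x) (by omega) h₁ h₂ with h | h | h
    · exact .inl h
    · exact absurd h hax'
    · exact .inr h

theorem RLink.block_eq (M : Model G lo hi) {a x : V} (h : RLink lo hi a x) (hx : lo x = lo a)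
    {v : V} (hv : lo v = lo a) : v = a ∨ v = x :=
  LLink.block_eq M.mirror h (by omega) (by omega)

/-- Descent along the link: if `p` has just two cliques, `q` is confined to the second one, so `q`
is the second vertex of a right link starting with `a`, and `a` has just two cliques as well. A
nested pair, where the descent ends, needs three cliques. -/
theorem LLink.no_rlink_self (M : Model G lo hi) {a x : V} (h : LLink lo hi a x)
    (hx : hi x = hi a) (ha : hi a = lo a + 1) {y : V} (hr : RLink lo hi a y) : False := by
  induction h generalizing y with
  | base h₁ h₂ => omega
  | @step a x p q h hp hq hpq ih =>
    have h₀ : LLink lo hi p q := .step h hp hq hpq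
    have h₁ := h₀.lo_eq M
    have h₂ := h.lo_eq M
    have h₃ := M.le x
    have h₄ := h.hi_le
    have hr' : RLink lo hi a q := RLink.step hr (by omega) (by omega) (by omega)
    have h₅ := hr'.hi_eq M
    exact ih (by omega) (by omega) hr'

/-- This is the fourth family: `a'` meets both tail vertices, `x'` nested in it meets only `a`, and
`p` meets only `a'`. If `a` has only two cliques, `a'` lies in its right block instead, which
consists of `a` and `x`. -/
theorem LLink.chain_conflict (M : Model G lo hi) {a x a' x' : V} (h : LLink lo hi a x)
    (hx : hi x = hi a) (h' : RLink lo hi a' x') (ha : hi a' = lo a + 1) (hb : lo a' < lo x') :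
    False := by
  have e₁ := h.lo_eq M
  have e₂ := h'.hi_eq M
  have lx := M.le x
  have lx' := M.le x'
  obtain ⟨p, hp⟩ := M.exHi (lo a') a' a' le_rfl (M.le a')
  by_cases hj : hi a = lo a + 1
  · rcases h.block_eq M hx (v := a') (by omega) with rfl | rfl <;> omega
  · obtain ⟨k, A, C, v, H, rfl, rfl⟩ := h.exists_chain_succ M hx
    exact H.no_fam4 M (w := a') (z := x') (u := p) (by omega) (by omega) (by omega) (by omega)
      (by omega) (by omega) (by omega)

/-- A link towards the left and a link towards the right never start at consecutive cliques. -/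
theorem LLink.no_conflict (M : Model G lo hi) {a x a' x' : V} (h : LLink lo hi a x)
    (h' : RLink lo hi a' x') (ha : hi a' = lo a + 1) : False := by
  have e₁ := h.lo_eq M
  have e₂ := h'.hi_eq M
  have lx := M.le x
  have lx' := M.le x'
  -- Two nested pairs give the configuration of `no_k24`, a nested pair against a proper chain gives
  -- `chain_conflict` or its mirror image, and two proper chains give the fifth family once the
  -- degenerate short cases are excluded.
  rcases h.hi_le.lt_or_eq with hx | hx
  · rcases h'.lo_le.lt_or_eq with hx' | hx'
    · obtain ⟨p, hp⟩ := M.exHi (lo a') a' a' le_rfl (M.le a')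
      obtain ⟨q, hq⟩ := M.exLo (hi a) a a (M.le a) le_rfl
      exact M.no_k24 (p := p) (x := x') (y := x) (q := q) (u := a') (w := a) (by omega) (by omega)
        (by omega) (by omega) (by omega) (by omega) (by omega) (by omega) (by omega)
    · exact LLink.chain_conflict M.mirror h' (by omega) (llink_neg_neg.2 h) (by omega) (by omega)
  · rcases h'.lo_le.lt_or_eq with hx' | hx'
    · exact h.chain_conflict M hx h' ha hx'
    · by_cases hj : hi a = lo a + 1
      · rcases h.block_eq M hx (v := a') (by omega) with rfl | rfl
        · exact h.no_rlink_self M hx hj h'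
        · omega
      · by_cases hj' : lo a' = lo a
        · rcases h'.block_eq M hx'.symm (v := a) (by omega) with rfl | rfl <;> omega
        · obtain ⟨k, A, C, v, H, rfl, rfl⟩ := h.exists_chain_succ M hx
          obtain ⟨n, A', C', v', H', rfl, rfl⟩ := LLink.exists_chain_succ M.mirror h' (by omega)
          exact H.no_fam5 M H' ha (by omega) e₁ (by omega) (by omega)

/-! ### Closed neighbourhoods -/

theorem Model.mem_nbhd (M : Model G lo hi) {u v : V} :
    u ∈ closedNbhd G v ↔ lo u ≤ hi v ∧ lo v ≤ hi u := by
  unfold closedNbhd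
  by_cases h : u = v
  · subst h; simp [M.le]
  · simp only [Set.mem_insert_iff, h, SimpleGraph.mem_neighborSet, false_or]
    rw [M.adj v u (Ne.symm h), and_comm]

/-- The vertex whose closed neighbourhood is that of `a` without a set `S` of vertices that start at
the last clique of `a`. -/
theorem Model.trim_right (M : Model G lo hi) {a d : V} {S : Set V} (hS : ∀ x ∈ S, lo x = hi a)
    (hne : S.Nonempty) : closedNbhd G d = closedNbhd G a \ S ↔
      lo d = lo a ∧ hi d = hi a - 1 ∧ ∀ x, lo x = hi a → x ∈ S := by
  have la := M.le a
  have ld := M.le d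
  constructor
  · intro h
    have hm : ∀ u, (lo u ≤ hi d ∧ lo d ≤ hi u) ↔ ((lo u ≤ hi a ∧ lo a ≤ hi u) ∧ u ∉ S) := by
      intro u
      rw [← M.mem_nbhd, ← M.mem_nbhd, h]
      rfl
    obtain ⟨s, hs⟩ := hne
    have hs₁ := hS s hs
    have ls := M.le s
    have h₁ := hm s
    have h₂ := (hm d).1 ⟨ld, ld⟩
    simp only [hs, not_true_eq_false, and_false, iff_false, not_and, not_le] at h₁
    have h₃ : hi d < hi a := by
      by_contra hc
      have := h₁ (by omega)
      omega
    -- Otherwise a vertex starting right after `hi d` would be a neighbour of `a` outside `S` that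
    -- `d` misses.
    have h₄ : hi d = hi a - 1 := by
      by_contra hc
      obtain ⟨x, hx⟩ := M.exLo (hi d + 1) d a (by omega) (by omega)
      have lx := M.le x
      have hx' := hm x
      have : x ∉ S := fun e => by have := hS x e; omega
      have := hx'.2 ⟨⟨by omega, by omega⟩, this⟩
      omega
    refine ⟨?_, h₄, ?_⟩
    · rcases lt_trichotomy (lo d) (lo a) with hlt | heq | hgt
      · obtain ⟨x, hx⟩ := M.exHi (lo a - 1) d a (by omega) (by omega)
        have lx := M.le x
        have := (hm x).1 ⟨by omega, by omega⟩
        omega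
      · exact heq
      · obtain ⟨x, hx⟩ := M.exHi (lo d - 1) a d (by omega) (by omega)
        have lx := M.le x
        have : x ∉ S := fun e => by have := hS x e; omega
        have := (hm x).2 ⟨⟨by omega, by omega⟩, this⟩
        omega
    · intro x hx
      by_contra hxS
      have lx := M.le x
      have := (hm x).2 ⟨⟨by omega, by omega⟩, hxS⟩
      omega
  · rintro ⟨h₁, h₂, h₃⟩
    ext u
    have lu := M.le u
    rw [Set.mem_sdiff, M.mem_nbhd, M.mem_nbhd]
    constructor
    · rintro ⟨h₄, h₅⟩
      refine ⟨⟨by omega, by omega⟩, fun e => ?_⟩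
      have := hS u e
      omega
    · rintro ⟨⟨h₄, h₅⟩, h₆⟩
      have : lo u ≠ hi a := fun e => h₆ (h₃ u e)
      omega

theorem Model.trim_left (M : Model G lo hi) {a c : V} {S : Set V} (hS : ∀ x ∈ S, hi x = lo a)
    (hne : S.Nonempty) : closedNbhd G c = closedNbhd G a \ S ↔
      lo c = lo a + 1 ∧ hi c = hi a ∧ ∀ x, hi x = lo a → x ∈ S := by
  rw [M.mirror.trim_right (a := a) (d := c) (S := S) (fun x hx => by rw [hS x hx]) hne]
  constructor
  · rintro ⟨h₁, h₂, h₃⟩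
    exact ⟨by omega, by omega, fun x hx => h₃ x (by omega)⟩
  · rintro ⟨h₁, h₂, h₃⟩
    exact ⟨by omega, by omega, fun x hx => h₃ x (by omega)⟩

end Static

/-! ## Nondegenerate intervals -/

namespace MInterval

/-- The left endpoint of `I` does not lie beyond the right endpoint of `J`. -/
def Reach (I J : MInterval) : Prop :=
  I.L.pos < J.R.pos ∨ (I.L.pos = J.R.pos ∧ I.L.closed = true ∧ J.R.closed = true)

/-- The left endpoint of `I` does not lie beyond that of `J`. -/
def LeL (I J : MInterval) : Prop :=
  I.L.pos < J.L.pos ∨ (I.L.pos = J.L.pos ∧ (I.L.closed = true ∨ J.L.closed = false))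

/-- The right endpoint of `J` does not lie beyond that of `I`. -/
def LeR (I J : MInterval) : Prop :=
  J.R.pos < I.R.pos ∨ (J.R.pos = I.R.pos ∧ (I.R.closed = true ∨ J.R.closed = false))

theorem mem_toSet {I : MInterval} {x : ℝ} : x ∈ I.toSet ↔
    (I.L.pos < x ∨ (I.L.closed = true ∧ x = I.L.pos)) ∧
       (x < I.R.pos ∨ (I.R.closed = true ∧ x = I.R.pos)) := Iff.rfl

/-- Nondegeneracy decouples the two comparisons: a common point is found strictly between the later
left and the earlier right end, or is a closed endpoint shared by both. -/
theorem meets_iff {I J : MInterval} (hI : I.L.pos < I.R.pos) (hJ : J.L.pos < J.R.pos) :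
    I.Meets J ↔ I.Reach J ∧ J.Reach I := by
  unfold Meets Reach
  constructor
  · rintro ⟨x, ⟨h₁, h₂⟩, h₃, h₄⟩
    constructor
    · rcases h₁ with h₁ | ⟨h₁, rfl⟩ <;> rcases h₄ with h₄ | ⟨h₄, h₅⟩
      · exact .inl (h₁.trans h₄)
      · exact .inl (h₅ ▸ h₁)
      · exact .inl h₄
      · exact .inr ⟨h₅, h₁, h₄⟩
    · rcases h₃ with h₃ | ⟨h₃, rfl⟩ <;> rcases h₂ with h₂ | ⟨h₂, h₅⟩
      · exact .inl (h₃.trans h₂)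
      · exact .inl (h₅ ▸ h₃)
      · exact .inl h₂
      · exact .inr ⟨h₅, h₃, h₂⟩
  · rintro ⟨h₁, h₂⟩
    rcases h₁ with h₁ | ⟨e₁, h₁, h₁'⟩
    · rcases h₂ with h₂ | ⟨e₂, h₂, h₂'⟩
      · obtain ⟨x, hx₁, hx₂⟩ : ∃ x, max I.L.pos J.L.pos < x ∧ x < min I.R.pos J.R.pos :=
          exists_between (max_lt (lt_min hI h₁) (lt_min h₂ hJ))
        rw [max_lt_iff] at hx₁
        rw [lt_min_iff] at hx₂
        exact ⟨x, ⟨.inl hx₁.1, .inl hx₂.1⟩, .inl hx₁.2, .inl hx₂.2⟩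
      · exact ⟨I.R.pos, ⟨.inl hI, .inr ⟨h₂', rfl⟩⟩, .inr ⟨h₂, e₂.symm⟩, .inl (e₂ ▸ hJ)⟩
    · exact ⟨I.L.pos, ⟨.inr ⟨h₁, rfl⟩, .inl hI⟩, .inl (e₁ ▸ hJ), .inr ⟨h₁', e₁⟩⟩

theorem subset_iff {I J : MInterval} (hI : I.L.pos < I.R.pos) :
    I.toSet ⊆ J.toSet ↔ J.LeL I ∧ J.LeR I := by
  unfold LeL LeR
  constructor
  · intro h
    constructor
    · by_contra hc
      push Not at hc
      obtain ⟨h₁, h₂⟩ := hc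
      rcases h₁.lt_or_eq with h₁ | h₁
      · obtain ⟨x, hx₁, hx₂⟩ := exists_between (lt_min h₁ hI)
        rw [lt_min_iff] at hx₂
        have := (h (show x ∈ I.toSet from ⟨.inl hx₁, .inl hx₂.2⟩)).1
        rcases this with this | this <;> linarith
      · obtain ⟨h₃, h₄⟩ := h₂ h₁.symm
        have := (h (show I.L.pos ∈ I.toSet from ⟨.inr ⟨by simpa using h₄, rfl⟩, .inl hI⟩)).1
        rcases this with this | this
        · linarith
        · exact h₃ this.1
    · by_contra hc
      push Not at hc
      obtain ⟨h₁, h₂⟩ := hc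
      rcases h₁.lt_or_eq with h₁ | h₁
      · obtain ⟨x, hx₁, hx₂⟩ := exists_between (max_lt h₁ hI)
        rw [max_lt_iff] at hx₁
        have := (h (show x ∈ I.toSet from ⟨.inl hx₁.2, .inl hx₂⟩)).2
        rcases this with this | this <;> linarith
      · obtain ⟨h₃, h₄⟩ := h₂ h₁.symm
        have := (h (show I.R.pos ∈ I.toSet from ⟨.inl hI, .inr ⟨by simpa using h₄, rfl⟩⟩)).2
        rcases this with this | this
        · linarith
        · exact h₃ this.1
  · rintro ⟨h₁, h₂⟩ x ⟨h₃, h₄⟩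
    constructor
    · rcases h₁ with h₁ | ⟨e₁, h₁⟩
      · left; rcases h₃ with h₃ | ⟨_, rfl⟩ <;> linarith
      · rcases h₃ with h₃ | ⟨h₃, rfl⟩
        · left; linarith
        · rcases h₁ with h₁ | h₁
          · exact .inr ⟨h₁, e₁.symm⟩
          · simp [h₁] at h₃
    · rcases h₂ with h₂ | ⟨e₂, h₂⟩
      · left; rcases h₄ with h₄ | ⟨_, rfl⟩ <;> linarith
      · rcases h₄ with h₄ | ⟨h₄, rfl⟩
        · left; linarith
        · rcases h₂ with h₂ | h₂
          · exact .inr ⟨h₂, e₂⟩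
          · simp [h₂] at h₄

/-- Properness of the inclusion is automatic, since mutual inclusion would force the same endpoints.
-/
theorem strictlyIn_iff {I J : MInterval} (hI : I.L.pos < I.R.pos) (hJ : J.L.pos < J.R.pos) :
    I.StrictlyIn J ↔ J.LeL I ∧ J.LeR I ∧ ¬ I.SameEnds J := by
  unfold StrictlyIn
  constructor
  · rintro ⟨h, h'⟩
    have := (subset_iff hI).1 h.subset
    exact ⟨this.1, this.2, h'⟩
  · rintro ⟨h₁, h₂, h₃⟩
    refine ⟨⟨(subset_iff hI).2 ⟨h₁, h₂⟩, fun h => h₃ ?_⟩, h₃⟩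
    obtain ⟨h₄, h₅⟩ := (subset_iff hJ).1 h
    unfold LeL LeR at *
    constructor
    · rcases h₁ with h₁ | h₁ <;> rcases h₄ with h₄ | h₄ <;> linarith
    · rcases h₂ with h₂ | h₂ <;> rcases h₅ with h₅ | h₅ <;> linarith

theorem meetsTest_iff {I J : MInterval} (hI : I.L.pos < I.R.pos) (hJ : J.L.pos < J.R.pos) :
    I.meetsTest J = true ↔ I.Meets J := by
  rw [meets_iff hI hJ]
  simp only [meetsTest, Reach, Bool.and_eq_true, Bool.or_eq_true, decide_eq_true_eq]
  tauto

theorem strictTest_iff {I J : MInterval} (hI : I.L.pos < I.R.pos) (hJ : J.L.pos < J.R.pos) :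
    I.strictTest J = true ↔ I.StrictlyIn J := by
  rw [strictlyIn_iff hI hJ]
  simp only [strictTest, LeL, LeR, SameEnds, Bool.and_eq_true, Bool.or_eq_true, decide_eq_true_eq,
    Bool.not_eq_true', Bool.and_eq_false_iff, decide_eq_false_iff_not]
  have e : J.R.pos = I.R.pos ↔ I.R.pos = J.R.pos := eq_comm
  tauto

theorem mirror_mirror (I : MInterval) : I.mirror.mirror = I := by
  simp [mirror]

@[simp] theorem mirror_L_pos (I : MInterval) : I.mirror.L.pos = -I.R.pos := rfl
@[simp] theorem mirror_R_pos (I : MInterval) : I.mirror.R.pos = -I.L.pos := rfl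
@[simp] theorem mirror_L_closed (I : MInterval) : I.mirror.L.closed = I.R.closed := rfl
@[simp] theorem mirror_R_closed (I : MInterval) : I.mirror.R.closed = I.L.closed := rfl
@[simp] theorem mirror_L_red (I : MInterval) : I.mirror.L.red = I.R.red := rfl
@[simp] theorem mirror_R_red (I : MInterval) : I.mirror.R.red = I.L.red := rfl

theorem mirror_toSet (I : MInterval) : I.mirror.toSet = (fun x => -x) ⁻¹' I.toSet := by
  ext x
  have e₁ : x = -I.L.pos ↔ -x = I.L.pos := by constructor <;> intro h <;> linarith
  have e₂ : x = -I.R.pos ↔ -x = I.R.pos := by constructor <;> intro h <;> linarith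
  have e₃ : -I.R.pos < x ↔ -x < I.R.pos := neg_lt
  have e₄ : x < -I.L.pos ↔ I.L.pos < -x := lt_neg
  simp only [mem_toSet, Set.mem_preimage, mirror_L_pos, mirror_R_pos, mirror_L_closed,
    mirror_R_closed, e₁, e₂, e₃, e₄]
  tauto

theorem mirror_meets {I J : MInterval} : I.mirror.Meets J.mirror ↔ I.Meets J := by
  unfold Meets
  rw [mirror_toSet, mirror_toSet, ← Set.preimage_inter]
  constructor
  · rintro ⟨x, hx⟩; exact ⟨-x, hx⟩
  · rintro ⟨x, hx⟩; exact ⟨-x, by simpa using hx⟩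

theorem mirror_sameEnds {I J : MInterval} : I.mirror.SameEnds J.mirror ↔ I.SameEnds J := by
  simp only [SameEnds, mirror_L_pos, mirror_R_pos, neg_inj]
  exact and_comm

theorem mirror_strictlyIn {I J : MInterval} : I.mirror.StrictlyIn J.mirror ↔ I.StrictlyIn J := by
  unfold StrictlyIn
  rw [mirror_sameEnds, mirror_toSet, mirror_toSet]
  have h : Function.Surjective fun x : ℝ => -x := neg_surjective
  simp only [ssubset_iff_subset_not_subset, h.preimage_subset_preimage_iff]

end MInterval

namespace MixedRep

variable {V : Type u}

theorem mirror_mirror (σ : MixedRep V) : σ.mirror.mirror = σ :=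
  funext fun v => (σ v).mirror_mirror

theorem mirror_apply (σ : MixedRep V) (v : V) : σ.mirror v = (σ v).mirror := rfl

end MixedRep

theorem peeksLeft_mirror {V : Type u} {σ : MixedRep V} {x a b : V} :
    PeeksLeft σ.mirror x a b ↔ PeeksRight σ x a b := by
  simp only [PeeksLeft, PeeksRight, MixedRep.mirror_apply, MInterval.mirror_meets,
    MInterval.mirror_L_pos, MInterval.mirror_R_pos, neg_le_neg_iff]

/-! ## The discrete model of the input -/

/-- The initial intervals realise the discrete model, and the endpoints that belong to the same
clique are ordered so that there is no nesting. -/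
structure Layout {V : Type u} (lo hi : V → ℤ) (σ₀ : MixedRep V) : Prop where
  reach : ∀ u v, lo u ≤ hi v ↔ (σ₀ u).L.pos ≤ (σ₀ v).R.pos
  ne : ∀ u v, (σ₀ u).L.pos ≠ (σ₀ v).R.pos
  l_lt : ∀ u v, (σ₀ u).L.pos < (σ₀ v).L.pos ↔ lo u < lo v ∨ (lo u = lo v ∧ hi u < hi v)
  r_lt : ∀ u v, (σ₀ u).R.pos < (σ₀ v).R.pos ↔ hi u < hi v ∨ (hi u = hi v ∧ lo u < lo v)
  l_inj : ∀ u v, (σ₀ u).L.pos = (σ₀ v).L.pos → u = v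
  r_inj : ∀ u v, (σ₀ u).R.pos = (σ₀ v).R.pos → u = v
  closed : ∀ v s, ((σ₀ v).pt s).closed = true
  white : ∀ v s, ((σ₀ v).pt s).red = false

theorem Layout.mirror {V : Type u} {lo hi : V → ℤ} {σ₀ : MixedRep V} (h : Layout lo hi σ₀) :
    Layout (fun v => -hi v) (fun v => -lo v) σ₀.mirror where
  reach u v := by
    simp only [MixedRep.mirror_apply, MInterval.mirror_L_pos, MInterval.mirror_R_pos,
      neg_le_neg_iff]
    exact h.reach v u
  ne u v := by
    simp only [MixedRep.mirror_apply, MInterval.mirror_L_pos, MInterval.mirror_R_pos, ne_eq,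
      neg_inj]
    exact (h.ne v u).symm
  l_lt u v := by
    simp only [MixedRep.mirror_apply, MInterval.mirror_L_pos, neg_lt_neg_iff, h.r_lt, neg_inj]
    rw [eq_comm]
  r_lt u v := by
    simp only [MixedRep.mirror_apply, MInterval.mirror_R_pos, neg_lt_neg_iff, h.l_lt, neg_inj]
    rw [eq_comm]
  l_inj u v e := h.r_inj u v (by
    simpa only [MixedRep.mirror_apply, MInterval.mirror_L_pos, neg_inj] using e)
  r_inj u v e := h.l_inj u v (by
    simpa only [MixedRep.mirror_apply, MInterval.mirror_R_pos, neg_inj] using e)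
  closed v s := by
    cases s
    · exact h.closed v .right
    · exact h.closed v .left
  white v s := by
    cases s
    · exact h.white v .right
    · exact h.white v .left

/-! ### Numbering the maximal cliques by counting endpoints -/

section BuildModel

open Classical in
/-- The number of intervals completely to the left of the left endpoint of `v`. -/
noncomputable def numBefore {V : Type u} [Fintype V] (l r : V → ℝ) (v : V) : ℕ :=
  (Finset.univ.filter fun w => r w < l v).card

open Classical in
/-- The number of maximal cliques that start at or before `x`. -/
noncomputable def cliqueIndex {V : Type u} [Fintype V] (l r : V → ℝ) (x : ℝ) : ℕ :=
  ((Finset.univ.filter fun w => l w ≤ x).image (numBefore l r)).card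

variable {V : Type u} [Fintype V] {l r : V → ℝ}

theorem numBefore_mono {u v : V} (h : l u ≤ l v) : numBefore l r u ≤ numBefore l r v := by
  classical
  unfold numBefore
  exact Finset.card_le_card fun w => by
    simp only [Finset.mem_filter, Finset.mem_univ, true_and]
    exact fun h' => h'.trans_le h

theorem cliqueIndex_mono {x y : ℝ} (h : x ≤ y) : cliqueIndex l r x ≤ cliqueIndex l r y := by
  classical
  unfold cliqueIndex
  exact Finset.card_le_card (Finset.image_subset_image fun w => by
    simp only [Finset.mem_filter, Finset.mem_univ, true_and]
    exact fun h' => h'.trans h)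

/-- Since `v` itself is counted, `numBefore` is larger at `u` than at every left endpoint up to `r
v`, so a new value appears. -/
theorem cliqueIndex_lt {u v : V} (h : r v < l u) : cliqueIndex l r (r v) < cliqueIndex l r (l u) := by
  classical
  unfold cliqueIndex
  refine Finset.card_lt_card ⟨Finset.image_subset_image fun w => by
    simp only [Finset.mem_filter, Finset.mem_univ, true_and]
    exact fun h' => h'.trans h.le, fun hsub => ?_⟩
  have hu : numBefore l r u ∈
      (Finset.univ.filter fun w => l w ≤ l u).image (numBefore l r) :=
    Finset.mem_image_of_mem _ (by simp)
  obtain ⟨w, hw, hwu⟩ := Finset.mem_image.1 (hsub hu)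
  simp only [Finset.mem_filter, Finset.mem_univ, true_and] at hw
  have : numBefore l r w < numBefore l r u := by
    unfold numBefore
    refine Finset.card_lt_card ⟨fun x => ?_, fun hs => ?_⟩
    · simp only [Finset.mem_filter, Finset.mem_univ, true_and]
      intro h'; linarith
    · have := hs (x := v) (by simpa using h)
      simp only [Finset.mem_filter, Finset.mem_univ, true_and] at this
      linarith
  omega

theorem cliqueIndex_reach {u v : V} :
    cliqueIndex l r (l u) ≤ cliqueIndex l r (r v) ↔ l u ≤ r v := by
  constructor
  · intro h
    by_contra hc
    have := cliqueIndex_lt (l := l) (r := r) (u := u) (v := v) (by linarith)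
    omega
  · exact cliqueIndex_mono

theorem lt_of_cliqueIndex_lt {x y : ℝ} (h : cliqueIndex l r x < cliqueIndex l r y) : x < y := by
  by_contra hc
  have := cliqueIndex_mono (l := l) (r := r) (not_lt.1 hc)
  omega

theorem exists_le_cliqueIndex {v : V} (hv : l v ≤ r v) :
    ∃ w, cliqueIndex l r (l w) = cliqueIndex l r (r v) := by
  classical
  obtain ⟨w, hw, hmax⟩ := Finset.exists_max_image (Finset.univ.filter fun w => l w ≤ r v) l
    ⟨v, by simpa using hv⟩
  simp only [Finset.mem_filter, Finset.mem_univ, true_and] at hw hmax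
  refine ⟨w, ?_⟩
  unfold cliqueIndex
  congr 2
  ext x
  simp only [Finset.mem_filter, Finset.mem_univ, true_and]
  exact ⟨fun h => h.trans hw, fun h => hmax x h⟩

theorem cliqueIndex_pos (v : V) : 1 ≤ cliqueIndex l r (l v) := by
  classical
  unfold cliqueIndex
  exact Finset.card_pos.2 ⟨_, Finset.mem_image_of_mem _ (a := v) (by simp)⟩

/-- Passing one more left endpoint adds at most one new value of `numBefore`, so the index cannot
skip a number. -/
theorem exists_cliqueIndex_eq {i : ℕ} {u v : V} (hu : cliqueIndex l r (l u) ≤ i)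
    (hv : i ≤ cliqueIndex l r (r v)) (hlr : l v ≤ r v) : ∃ x, cliqueIndex l r (l x) = i := by
  classical
  obtain ⟨w₀, hw₀⟩ := exists_le_cliqueIndex (l := l) (r := r) hlr
  obtain ⟨w, hw, hmin⟩ := Finset.exists_min_image
    (Finset.univ.filter fun w => i ≤ cliqueIndex l r (l w)) l
    ⟨w₀, by simp only [Finset.mem_filter, Finset.mem_univ, true_and]; omega⟩
  simp only [Finset.mem_filter, Finset.mem_univ, true_and] at hw hmin
  refine ⟨w, le_antisymm ?_ hw⟩
  have hlt : ∀ x, l x < l w → cliqueIndex l r (l x) < i := fun x hx => by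
    by_contra hc
    have := hmin x (by omega)
    linarith
  have hbound : ∀ n, (∀ x, l x < l w → numBefore l r x ∈ (n : Finset ℕ)) →
      cliqueIndex l r (l w) ≤ n.card + 1 := by
    intro n hn
    refine (Finset.card_le_card (t := insert (numBefore l r w) n) ?_).trans
      (Finset.card_insert_le _ _)
    intro y hy
    obtain ⟨x, hx, rfl⟩ := Finset.mem_image.1 hy
    simp only [Finset.mem_filter, Finset.mem_univ, true_and] at hx
    rcases hx.lt_or_eq with h | h
    · exact Finset.mem_insert_of_mem (hn x h)
    · simp [numBefore, h]
  by_cases he : ∃ x, l x < l w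
  · obtain ⟨x₀, hx₀⟩ := he
    obtain ⟨x, hx, hmax⟩ := Finset.exists_max_image (Finset.univ.filter fun x => l x < l w) l
      ⟨x₀, by simpa using hx₀⟩
    simp only [Finset.mem_filter, Finset.mem_univ, true_and] at hx hmax
    have h₁ := hlt x hx
    have h₂ := hbound ((Finset.univ.filter fun w => l w ≤ l x).image (numBefore l r))
      (fun y hy => Finset.mem_image_of_mem _ (by simpa using hmax y hy))
    change _ ≤ cliqueIndex l r (l x) + 1 at h₂
    omega
  · have h₁ := hbound ∅ (fun x hx => absurd ⟨x, hx⟩ he)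
    have h₂ := cliqueIndex_pos (l := l) (r := r) u
    simp only [Finset.card_empty, zero_add] at h₁
    omega

/-- If index `i + 1` occurs but no right endpoint has index `i`, nothing ends between the left
endpoints of `w` and `y`, so `numBefore` and hence the index could not have grown. For the last
index the right endpoint of `w` itself serves. -/
theorem exists_cliqueIndex_eq_right {i : ℕ} {u v : V} (hu : cliqueIndex l r (l u) ≤ i)
    (hv : i ≤ cliqueIndex l r (r v)) (hlr : ∀ v, l v ≤ r v) : ∃ x, cliqueIndex l r (r x) = i := by
  classical
  obtain ⟨w, hw⟩ := exists_cliqueIndex_eq hu hv (hlr v)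
  by_cases hy : ∃ y, cliqueIndex l r (l y) = i + 1
  · obtain ⟨y, hy⟩ := hy
    have hwy : l w < l y := lt_of_cliqueIndex_lt (l := l) (r := r) (by omega)
    by_contra! hne
    have hbetween : ∀ x, r x < l y → r x < l w := by
      intro x hx
      by_contra hc
      have h₁ := cliqueIndex_mono (l := l) (r := r) (not_lt.1 hc)
      have h₂ := cliqueIndex_lt hx
      exact hne x (by omega)
    have hle : numBefore l r y ≤ numBefore l r w := by
      unfold numBefore
      refine Finset.card_le_card fun x => ?_
      simp only [Finset.mem_filter, Finset.mem_univ, true_and]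
      exact hbetween x
    have : cliqueIndex l r (l y) ≤ cliqueIndex l r (l w) := by
      unfold cliqueIndex
      refine Finset.card_le_card fun n hn => ?_
      obtain ⟨x, hx, rfl⟩ := Finset.mem_image.1 hn
      simp only [Finset.mem_filter, Finset.mem_univ, true_and] at hx
      by_cases hxw : l x ≤ l w
      · exact Finset.mem_image_of_mem _ (by simpa using hxw)
      · have h₁ := numBefore_mono (r := r) hx
        have h₂ := numBefore_mono (r := r) (not_le.1 hxw).le
        have h₃ : numBefore l r x = numBefore l r w := by omega
        rw [h₃]
        exact Finset.mem_image_of_mem _ (by simp)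
    omega
  · refine ⟨w, ?_⟩
    have h₁ := cliqueIndex_mono (l := l) (r := r) (hlr w)
    by_contra hc
    exact hy (exists_cliqueIndex_eq (u := w) (v := w) (by omega) (by omega) (hlr w))

theorem exists_model {G : SimpleGraph V} {σ₀ : MixedRep V} (h : InitialHyp G σ₀) :
    ∃ lo hi : V → ℤ, Model G lo hi ∧ Layout lo hi σ₀ := by
  set l : V → ℝ := fun v => (σ₀ v).L.pos with hl
  set r : V → ℝ := fun v => (σ₀ v).R.pos with hr
  have hlr : ∀ v, l v ≤ r v := fun v => (h.lt v).le
  have hne : ∀ u v, l u ≠ r v := fun u v e => by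
    have := @h.distinct (u, .left) (v, .right) e
    simp at this
  have l_inj : ∀ u v, l u = l v → u = v := fun u v e => by
    have := @h.distinct (u, .left) (v, .left) e
    simpa using this
  have r_inj : ∀ u v, r u = r v → u = v := fun u v e => by
    have := @h.distinct (u, .right) (v, .right) e
    simpa using this
  have hcl : ∀ v, (σ₀ v).L.closed = true := fun v => h.closed v .left
  have hcr : ∀ v, (σ₀ v).R.closed = true := fun v => h.closed v .right
  have hreach : ∀ u v, (σ₀ u).Reach (σ₀ v) ↔ l u ≤ r v := fun u v => by
    simp only [MInterval.Reach, hcl, hcr, and_true, le_iff_lt_or_eq, hl, hr]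
  have hmeets : ∀ u v, (σ₀ u).Meets (σ₀ v) ↔ l u ≤ r v ∧ l v ≤ r u := fun u v => by
    rw [MInterval.meets_iff (h.lt u) (h.lt v), hreach, hreach]
  let lo : V → ℤ := fun v => (cliqueIndex l r (l v) : ℤ)
  let hi : V → ℤ := fun v => (cliqueIndex l r (r v) : ℤ)
  have reach : ∀ u v, lo u ≤ hi v ↔ l u ≤ r v := fun u v => by
    simp only [lo, hi, Nat.cast_le]; exact cliqueIndex_reach
  have adj : ∀ u v, u ≠ v → (G.Adj u v ↔ lo u ≤ hi v ∧ lo v ≤ hi u) := fun u v huv => by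
    rw [h.represents u v huv, hmeets, reach, reach]
  have inj : ∀ u v, lo u = lo v → hi u = hi v → u = v := by
    intro u v h₁ h₂
    refine h.twinFree u v (Set.ext fun x => ?_)
    have key : ∀ w, x ∈ closedNbhd G w ↔ lo x ≤ hi w ∧ lo w ≤ hi x := fun w => by
      by_cases hxw : x = w
      · subst hxw
        have := (reach x x).2 (hlr x)
        simp [closedNbhd, this]
      · simp only [closedNbhd, Set.mem_insert_iff, hxw, SimpleGraph.mem_neighborSet, false_or]
        rw [adj w x (Ne.symm hxw), and_comm]
    rw [key, key, h₁, h₂]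
  have lo_lt : ∀ u v, lo u < lo v → l u < l v := fun u v huv =>
    lt_of_cliqueIndex_lt (l := l) (r := r) (by simpa [lo] using huv)
  have hi_lt : ∀ u v, hi u < hi v → r u < r v := fun u v huv =>
    lt_of_cliqueIndex_lt (l := l) (r := r) (by simpa [hi] using huv)
  have hss : ∀ u v, l v < l u → r u < r v → (σ₀ u).toSet ⊂ (σ₀ v).toSet := by
    intro u v h₁ h₂
    refine ((MInterval.strictlyIn_iff (h.lt u) (h.lt v)).2 ⟨.inl h₁, .inl h₂, ?_⟩).1
    exact fun e => h₁.ne' e.1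
  -- The inclusion property enters here: if the interval of `v` lay inside that of `u` with both
  -- starting in the same clique, a vertex peeking in from the left would have to reach that clique
  -- and also end before it.
  have l_imp : ∀ u v, lo u = lo v → l u < l v → hi u < hi v := by
    intro u v e hlt
    by_contra hc
    have hne' : u ≠ v := by rintro rfl; exact lt_irrefl _ hlt
    have h₁ : hi v < hi u := lt_of_le_of_ne (not_lt.1 hc) fun e' => hne' (inj u v e e'.symm)
    obtain ⟨⟨x, hx₁, hx₂, hx₃⟩, -⟩ := h.inclusion v u (hss v u hlt (hi_lt v u h₁))
    rw [hmeets] at hx₁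
    have h₂ : ¬ lo v ≤ hi x := fun h' =>
      hne v x (le_antisymm ((reach v x).1 h') hx₃)
    have h₃ := (reach u x).2 hx₁.2
    omega
  have r_imp : ∀ u v, hi u = hi v → r u < r v → lo u < lo v := by
    intro u v e hlt
    by_contra hc
    have hne' : u ≠ v := by rintro rfl; exact lt_irrefl _ hlt
    have h₁ : lo v < lo u := lt_of_le_of_ne (not_lt.1 hc) fun e' => hne' (inj u v e'.symm e)
    obtain ⟨-, ⟨x, hx₁, hx₂, hx₃⟩⟩ := h.inclusion u v (hss u v (lo_lt v u h₁) hlt)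
    rw [hmeets] at hx₁
    have h₂ : ¬ lo x ≤ hi u := fun h' =>
      hne x u (le_antisymm ((reach x u).1 h') hx₃)
    have h₃ := (reach x v).2 hx₁.1
    omega
  refine ⟨lo, hi, ⟨fun v => (reach v v).2 (hlr v), adj, inj, ?_, ?_, h.forbiddenFree⟩,
    ⟨reach, hne, ?_, ?_, l_inj, r_inj, h.closed, h.white⟩⟩
  · intro i u v h₁ h₂
    have hi0 : 0 ≤ i := le_trans (by simp [lo]) h₁
    obtain ⟨n, rfl⟩ := Int.eq_ofNat_of_zero_le hi0
    obtain ⟨x, hx⟩ := exists_cliqueIndex_eq (l := l) (r := r) (i := n) (u := u) (v := v)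
      (by simpa [lo] using h₁) (by simpa [hi] using h₂) (hlr v)
    exact ⟨x, by simp [lo, hx]⟩
  · intro i u v h₁ h₂
    have hi0 : 0 ≤ i := le_trans (by simp [lo]) h₁
    obtain ⟨n, rfl⟩ := Int.eq_ofNat_of_zero_le hi0
    obtain ⟨x, hx⟩ := exists_cliqueIndex_eq_right (l := l) (r := r) (i := n) (u := u) (v := v)
      (by simpa [lo] using h₁) (by simpa [hi] using h₂) hlr
    exact ⟨x, by simp [hi, hx]⟩
  · intro u v
    constructor
    · intro hlt
      rcases lt_trichotomy (lo u) (lo v) with h₁ | h₁ | h₁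
      · exact .inl h₁
      · exact .inr ⟨h₁, l_imp u v h₁ hlt⟩
      · exact absurd (lo_lt v u h₁) hlt.not_gt
    · rintro (h₁ | ⟨h₁, h₂⟩)
      · exact lo_lt u v h₁
      · have hne' : u ≠ v := by rintro rfl; omega
        rcases lt_or_gt_of_ne (fun e => hne' (l_inj u v e)) with h₃ | h₃
        · exact h₃
        · have := l_imp v u h₁.symm h₃
          omega
  · intro u v
    constructor
    · intro hlt
      rcases lt_trichotomy (hi u) (hi v) with h₁ | h₁ | h₁
      · exact .inl h₁
      · exact .inr ⟨h₁, r_imp u v h₁ hlt⟩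
      · exact absurd (hi_lt v u h₁) hlt.not_gt
    · rintro (h₁ | ⟨h₁, h₂⟩)
      · exact hi_lt u v h₁
      · have hne' : u ≠ v := by rintro rfl; omega
        rcases lt_or_gt_of_ne (fun e => hne' (r_inj u v e)) with h₃ | h₃
        · exact h₃
        · have := r_imp v u h₁.symm h₃
          omega

end BuildModel

/-! ## The state of the algorithm -/

section State

variable {V : Type u}

/-- All right endpoints that belong to the clique `z` have been moved to its zone line. -/
def FullR (hi : V → ℤ) (m : ℤ → ℝ) (σ : MixedRep V) (z : ℤ) : Prop :=
  ∀ v, hi v = z → (σ v).R = ⟨m z, true, true⟩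

/-- All left endpoints that belong to the clique `z` have been moved to its zone line. -/
def FullL (lo : V → ℤ) (m : ℤ → ℝ) (σ : MixedRep V) (z : ℤ) : Prop :=
  ∀ v, lo v = z → (σ v).L = ⟨m z, true, true⟩

/-- A red endpoint that stays with its own clique. The slack in `hi a ≤ hi v + 1` allows for
vertices of type d, whose right endpoint is open on the line of the next clique. -/
structure ClosedL (lo hi : V → ℤ) (Z : Set ℤ) (m : ℤ → ℝ) (σ : MixedRep V) (v : V) : Prop where
  mem : lo v ∈ Z
  eq : (σ v).L = ⟨m (lo v), true, true⟩
  same : ∃ a, lo a = lo v ∧ (∀ u, lo u = lo v → hi u ≤ hi a) ∧ hi a ≤ hi v + 1 ∧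
    (σ v).SameEnds (σ a)

structure ClosedR (lo hi : V → ℤ) (Z : Set ℤ) (m : ℤ → ℝ) (σ : MixedRep V) (v : V) : Prop where
  mem : hi v ∈ Z
  eq : (σ v).R = ⟨m (hi v), true, true⟩
  same : ∃ a, hi a = hi v ∧ (∀ u, hi u = hi v → lo a ≤ lo u) ∧ lo v ≤ lo a + 1 ∧
    (σ v).SameEnds (σ a)

/-- A red endpoint pulled to the line of the preceding clique. This keeps the adjacencies only if
all right endpoints of that clique lie on the line too; membership in `PL` defers that demand to the
rest of the current sweep. -/
structure OpenL (lo hi : V → ℤ) (Z : Set ℤ) (m : ℤ → ℝ) (PL : Set ℤ) (σ : MixedRep V) (v : V) :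
    Prop where
  mem : lo v - 1 ∈ Z
  eq : (σ v).L = ⟨m (lo v - 1), false, true⟩
  full : lo v - 1 ∈ PL ∨ FullR hi m σ (lo v - 1)
  same : ∃ a, lo a = lo v - 1 ∧ hi v ≤ hi a ∧ (σ v).SameEnds (σ a)

structure OpenR (lo hi : V → ℤ) (Z : Set ℤ) (m : ℤ → ℝ) (PR : Set ℤ) (σ : MixedRep V) (v : V) :
    Prop where
  mem : hi v + 1 ∈ Z
  eq : (σ v).R = ⟨m (hi v + 1), false, true⟩
  full : hi v + 1 ∈ PR ∨ FullL lo m σ (hi v + 1)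
  same : ∃ a, hi a = hi v + 1 ∧ lo a ≤ lo v ∧ (σ v).SameEnds (σ a)

/-- The invariant of the algorithm. The cliques in `Z` have been collapsed, `m` gives the positions
of their zone lines; the right endpoints that belong to the cliques in `PL` and the left endpoints
that belong to the cliques in `PR` are still to be moved by the current sweep. -/
structure SweepInv (lo hi : V → ℤ) (σ₀ : MixedRep V) (Z : Set ℤ) (m : ℤ → ℝ) (PL PR : Set ℤ)
    (σ : MixedRep V) : Prop where
  left : ∀ v, (σ v).L.red = true → ClosedL lo hi Z m σ v ∨ OpenL lo hi Z m PL σ v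
  right : ∀ v, (σ v).R.red = true → ClosedR lo hi Z m σ v ∨ OpenR lo hi Z m PR σ v
  whiteL : ∀ v, (σ v).L.red = false → (σ v).L = (σ₀ v).L
  whiteR : ∀ v, (σ v).R.red = false → (σ v).R = (σ₀ v).R
  exL : ∀ z ∈ Z, ∃ v, lo v = z
  exR : ∀ z ∈ Z, ∃ v, hi v = z
  -- The line of `z` lies at or after the initial left endpoints of the cliques up to `z` and at or
  -- before the initial right endpoints of the cliques from `z` on; `neL` and `neR` keep white
  -- endpoints off it.
  posL : ∀ z ∈ Z, ∀ v, lo v ≤ z ↔ (σ₀ v).L.pos ≤ m z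
  posR : ∀ z ∈ Z, ∀ v, z ≤ hi v ↔ m z ≤ (σ₀ v).R.pos
  neL : ∀ z ∈ Z, ∀ v, (σ v).L.red = false → (σ₀ v).L.pos ≠ m z
  neR : ∀ z ∈ Z, ∀ v, (σ v).R.red = false → (σ₀ v).R.pos ≠ m z
  -- The next four fields record what is finished at a collapsed clique where a link starts: the
  -- whole opposite block, and the endpoint of the first vertex of the link.
  fullR : ∀ a x, LLink lo hi a x → lo a ∈ Z → lo a ∉ PL → FullR hi m σ (lo a)
  fullL : ∀ a x, RLink lo hi a x → hi a ∈ Z → hi a ∉ PR → FullL lo m σ (hi a)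
  linkL : ∀ a x, LLink lo hi a x → lo a ∈ Z → lo a ∉ PR → (σ a).L = ⟨m (lo a), true, true⟩
  linkR : ∀ a x, RLink lo hi a x → hi a ∈ Z → hi a ∉ PL → (σ a).R = ⟨m (hi a), true, true⟩
  nested : ∀ a b, lo a < lo b → hi b < hi a →
    ((σ a).L.red = false ∧ (σ a).R.red = false ∧ (σ b).L.red = false ∧ (σ b).R.red = false) ∨
    (lo a ∈ Z ∧ hi a ∈ Z ∧ σ a = redInterval true (m (lo a)) (m (hi a)) true ∧
      σ b = redInterval false (m (lo a)) (m (hi a)) false)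
  -- The second vertex of a left link can become red on the left only with an open endpoint.
  partL : ∀ a x, LLink lo hi a x → (σ x).L.closed = true → (σ x).L.red = false
  partR : ∀ a x, RLink lo hi a x → (σ x).R.closed = true → (σ x).R.red = false
  lt : ∀ v, (σ v).L.pos < (σ v).R.pos

/-- The reflection of a set of cliques. -/
def negSet (Z : Set ℤ) : Set ℤ := {z | -z ∈ Z}

/-- The reflection of the positions of zone lines. -/
def negPos (m : ℤ → ℝ) : ℤ → ℝ := fun z => -m (-z)

@[simp] theorem mem_negSet {Z : Set ℤ} {z : ℤ} : z ∈ negSet Z ↔ -z ∈ Z := Iff.rfl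

@[simp] theorem negSet_negSet (Z : Set ℤ) : negSet (negSet Z) = Z := by
  ext z; simp

@[simp] theorem negPos_negPos (m : ℤ → ℝ) : negPos (negPos m) = m := by
  funext z; simp [negPos]

@[simp] theorem negSet_empty : negSet ∅ = ∅ := by
  ext z; simp

@[simp] theorem negSet_singleton (z : ℤ) : negSet {z} = {-z} := by
  ext x; simp only [mem_negSet, Set.mem_singleton_iff]; omega

theorem Endpoint.neg_eq {e : Endpoint} {x : ℝ} {b c : Bool} :
    (⟨-e.pos, e.closed, e.red⟩ : Endpoint) = ⟨-x, b, c⟩ ↔ e = ⟨x, b, c⟩ := by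
  cases e; simp

theorem MInterval.mirror_L (I : MInterval) : I.mirror.L = ⟨-I.R.pos, I.R.closed, I.R.red⟩ := rfl
theorem MInterval.mirror_R (I : MInterval) : I.mirror.R = ⟨-I.L.pos, I.L.closed, I.L.red⟩ := rfl

variable {lo hi : V → ℤ} {σ₀ : MixedRep V} {Z : Set ℤ} {m : ℤ → ℝ} {PL PR : Set ℤ}
  {σ : MixedRep V}

theorem fullL_mirror {z : ℤ} :
    FullL (fun v => -hi v) (negPos m) σ.mirror (-z) ↔ FullR hi m σ z := by
  simp only [FullL, FullR, negPos, neg_inj, MixedRep.mirror_apply, MInterval.mirror_L, neg_neg,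
    Endpoint.neg_eq]

theorem fullR_mirror {z : ℤ} :
    FullR (fun v => -lo v) (negPos m) σ.mirror (-z) ↔ FullL lo m σ z := by
  simp only [FullL, FullR, negPos, neg_inj, MixedRep.mirror_apply, MInterval.mirror_R, neg_neg,
    Endpoint.neg_eq]

theorem closedL_mirror {v : V} : ClosedL (fun v => -hi v) (fun v => -lo v) (negSet Z) (negPos m)
    σ.mirror v ↔ ClosedR lo hi Z m σ v := by
  constructor
  · rintro ⟨h₁, h₂, a, h₃, h₄, h₅, h₆⟩
    refine ⟨by simpa using h₁, ?_, a, by omega, fun u hu => ?_, by omega, ?_⟩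
    · simpa only [negPos, MixedRep.mirror_apply, MInterval.mirror_L, neg_neg,
        Endpoint.neg_eq] using h₂
    · have := h₄ u (by omega); omega
    · simpa only [MixedRep.mirror_apply, MInterval.mirror_sameEnds] using h₆
  · rintro ⟨h₁, h₂, a, h₃, h₄, h₅, h₆⟩
    refine ⟨by simpa using h₁, ?_, a, by omega, fun u hu => ?_, by omega, ?_⟩
    · simpa only [negPos, MixedRep.mirror_apply, MInterval.mirror_L, neg_neg,
        Endpoint.neg_eq] using h₂
    · have := h₄ u (by omega); omega
    · simpa only [MixedRep.mirror_apply, MInterval.mirror_sameEnds] using h₆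

theorem closedR_mirror {v : V} : ClosedR (fun v => -hi v) (fun v => -lo v) (negSet Z) (negPos m)
    σ.mirror v ↔ ClosedL lo hi Z m σ v := by
  rw [← closedL_mirror]
  simp only [neg_neg, negSet_negSet, negPos_negPos, MixedRep.mirror_mirror]

theorem openL_mirror {v : V} : OpenL (fun v => -hi v) (fun v => -lo v) (negSet Z) (negPos m)
    (negSet PR) σ.mirror v ↔ OpenR lo hi Z m PR σ v := by
  have e : -hi v - 1 = -(hi v + 1) := by ring
  constructor
  · rintro ⟨h₁, h₂, h₃, a, h₄, h₅, h₆⟩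
    rw [e] at h₁ h₂ h₃
    refine ⟨by simpa using h₁, ?_, ?_, a, by omega, by omega, ?_⟩
    · simpa only [negPos, MixedRep.mirror_apply, MInterval.mirror_L, neg_neg,
        Endpoint.neg_eq] using h₂
    · simpa only [mem_negSet, neg_neg, fullR_mirror] using h₃
    · simpa only [MixedRep.mirror_apply, MInterval.mirror_sameEnds] using h₆
  · rintro ⟨h₁, h₂, h₃, a, h₄, h₅, h₆⟩
    refine ⟨by rw [e]; simpa using h₁, ?_, ?_, a, by omega, by omega, ?_⟩
    · rw [e]
      simpa only [negPos, MixedRep.mirror_apply, MInterval.mirror_L, neg_neg,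
        Endpoint.neg_eq] using h₂
    · rw [e]
      simpa only [mem_negSet, neg_neg, fullR_mirror] using h₃
    · simpa only [MixedRep.mirror_apply, MInterval.mirror_sameEnds] using h₆

theorem openR_mirror {v : V} : OpenR (fun v => -hi v) (fun v => -lo v) (negSet Z) (negPos m)
    (negSet PL) σ.mirror v ↔ OpenL lo hi Z m PL σ v := by
  rw [← openL_mirror]
  simp only [neg_neg, negSet_negSet, negPos_negPos, MixedRep.mirror_mirror]

theorem redInterval_mirror (a b : Bool) (x y : ℝ) :
    (redInterval a x y b).mirror = redInterval b (-y) (-x) a := rfl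

theorem MInterval.mirror_inj {I J : MInterval} : I.mirror = J.mirror ↔ I = J :=
  ⟨fun h => by rw [← I.mirror_mirror, h, J.mirror_mirror], fun h => by rw [h]⟩

namespace SweepInv

theorem mirror (h : SweepInv lo hi σ₀ Z m PL PR σ) :
    SweepInv (fun v => -hi v) (fun v => -lo v) σ₀.mirror (negSet Z) (negPos m) (negSet PR) (negSet PL)
      σ.mirror where
  left v hv := by
    rw [closedL_mirror, openL_mirror]; exact h.right v hv
  right v hv := by
    rw [closedR_mirror, openR_mirror]; exact h.left v hv
  whiteL v hv := by
    simp only [MixedRep.mirror_apply, MInterval.mirror_L]; rw [h.whiteR v hv]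
  whiteR v hv := by
    simp only [MixedRep.mirror_apply, MInterval.mirror_R]; rw [h.whiteL v hv]
  exL z hz := by
    obtain ⟨v, hv⟩ := h.exR _ hz; exact ⟨v, by omega⟩
  exR z hz := by
    obtain ⟨v, hv⟩ := h.exL _ hz; exact ⟨v, by omega⟩
  posL z hz v := by
    have := h.posR _ hz v
    simp only [MixedRep.mirror_apply, MInterval.mirror_L_pos, negPos, neg_le_neg_iff, ← this]
    constructor <;> intro <;> omega
  posR z hz v := by
    have := h.posL _ hz v
    simp only [MixedRep.mirror_apply, MInterval.mirror_R_pos, negPos, neg_le_neg_iff, ← this]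
    constructor <;> intro <;> omega
  neL z hz v hv := by
    simpa only [MixedRep.mirror_apply, MInterval.mirror_L_pos, negPos, ne_eq, neg_inj]
      using h.neR _ hz v hv
  neR z hz v hv := by
    simpa only [MixedRep.mirror_apply, MInterval.mirror_R_pos, negPos, ne_eq, neg_inj]
      using h.neL _ hz v hv
  fullR a x hl hz hp := by
    rw [fullR_mirror]
    exact h.fullL a x hl (by simpa using hz) (by simpa using hp)
  fullL a x hl hz hp := by
    rw [fullL_mirror]
    exact h.fullR a x (llink_neg_neg.1 hl) (by simpa using hz) (by simpa using hp)
  linkL a x hl hz hp := by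
    have := h.linkR a x hl (by simpa using hz) (by simpa using hp)
    simpa only [negPos, MixedRep.mirror_apply, MInterval.mirror_L, neg_neg,
        Endpoint.neg_eq] using this
  linkR a x hl hz hp := by
    have := h.linkL a x (llink_neg_neg.1 hl) (by simpa using hz) (by simpa using hp)
    simpa only [negPos, MixedRep.mirror_apply, MInterval.mirror_R, neg_neg,
        Endpoint.neg_eq] using this
  nested a b h₁ h₂ := by
    rcases h.nested a b (by omega) (by omega) with h' | h'
    · left
      simp only [MixedRep.mirror_apply, MInterval.mirror_L_red, MInterval.mirror_R_red]
      tauto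
    · right
      obtain ⟨h₃, h₄, h₅, h₆⟩ := h'
      refine ⟨by simpa using h₄, by simpa using h₃, ?_, ?_⟩
      · rw [MixedRep.mirror_apply, h₅, redInterval_mirror]; simp [negPos]
      · rw [MixedRep.mirror_apply, h₆, redInterval_mirror]; simp [negPos]
  partL a x hl := h.partR a x hl
  partR a x hl := h.partL a x (llink_neg_neg.1 hl)
  lt v := by
    simpa only [MixedRep.mirror_apply, MInterval.mirror_L_pos, MInterval.mirror_R_pos,
      neg_lt_neg_iff] using h.lt v

/-- The initial left endpoint of a vertex starting in clique `z'` separates the two lines. -/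
theorem pos_lt (h : SweepInv lo hi σ₀ Z m PL PR σ) {z z' : ℤ} (hz : z ∈ Z) (hz' : z' ∈ Z)
    (hlt : z < z') : m z < m z' := by
  obtain ⟨w, hw⟩ := h.exL z' hz'
  have h₁ := (h.posL z' hz' w).1 hw.le
  have h₂ := (not_congr (h.posL z hz w)).1 (by omega)
  linarith

theorem pos_le_iff (h : SweepInv lo hi σ₀ Z m PL PR σ) {z z' : ℤ} (hz : z ∈ Z) (hz' : z' ∈ Z) :
    m z ≤ m z' ↔ z ≤ z' := by
  constructor
  · intro h'
    by_contra hc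
    have := h.pos_lt hz' hz (by omega)
    linarith
  · intro h'
    rcases h'.lt_or_eq with h' | rfl
    · exact (h.pos_lt hz hz' h').le
    · exact le_rfl

theorem pos_lt_iff (h : SweepInv lo hi σ₀ Z m PL PR σ) {z z' : ℤ} (hz : z ∈ Z) (hz' : z' ∈ Z) :
    m z < m z' ↔ z < z' := by
  rw [← not_le, h.pos_le_iff hz' hz, not_le]

theorem pos_inj (h : SweepInv lo hi σ₀ Z m PL PR σ) {z z' : ℤ} (hz : z ∈ Z) (hz' : z' ∈ Z)
    (e : m z = m z') : z = z' :=
  le_antisymm ((h.pos_le_iff hz hz').1 e.le) ((h.pos_le_iff hz' hz).1 e.ge)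

theorem redL_pos (h : SweepInv lo hi σ₀ Z m PL PR σ) {v : V} (hv : (σ v).L.red = true) :
    ∃ z ∈ Z, (σ v).L.pos = m z := by
  rcases h.left v hv with h' | h'
  · exact ⟨_, h'.mem, by rw [h'.eq]⟩
  · exact ⟨_, h'.mem, by rw [h'.eq]⟩

theorem redR_pos (h : SweepInv lo hi σ₀ Z m PL PR σ) {v : V} (hv : (σ v).R.red = true) :
    ∃ z ∈ Z, (σ v).R.pos = m z := by
  rcases h.right v hv with h' | h'
  · exact ⟨_, h'.mem, by rw [h'.eq]⟩
  · exact ⟨_, h'.mem, by rw [h'.eq]⟩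

theorem redL_of_pos (h : SweepInv lo hi σ₀ Z m PL PR σ) {v : V} {z : ℤ} (hz : z ∈ Z)
    (hv : (σ v).L.pos = m z) : (σ v).L.red = true := by
  by_contra hc
  have hc := Bool.eq_false_iff.2 hc
  exact h.neL z hz v hc (by rw [← h.whiteL v hc, hv])

theorem redR_of_pos (h : SweepInv lo hi σ₀ Z m PL PR σ) {v : V} {z : ℤ} (hz : z ∈ Z)
    (hv : (σ v).R.pos = m z) : (σ v).R.red = true := by
  by_contra hc
  have hc := Bool.eq_false_iff.2 hc
  exact h.neR z hz v hc (by rw [← h.whiteR v hc, hv])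

/-- Initial positions are distinct, so of two coinciding endpoints at least one is red. It lies on a
zone line, and white endpoints avoid zone lines. -/
theorem red_of_sameEnds (Λ : Layout lo hi σ₀) (h : SweepInv lo hi σ₀ Z m PL PR σ) {u v : V}
    (huv : u ≠ v) (hs : (σ u).SameEnds (σ v)) : (σ u).L.red = true ∧ (σ v).L.red = true ∧
      (σ u).R.red = true ∧ (σ v).R.red = true := by
  have hL : (σ u).L.red = true ∨ (σ v).L.red = true := by
    by_contra! hc
    have h₁ := h.whiteL u (Bool.eq_false_iff.2 hc.1)
    have h₂ := h.whiteL v (Bool.eq_false_iff.2 hc.2)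
    exact huv (Λ.l_inj u v (by rw [← h₁, ← h₂, hs.1]))
  have hR : (σ u).R.red = true ∨ (σ v).R.red = true := by
    by_contra! hc
    have h₁ := h.whiteR u (Bool.eq_false_iff.2 hc.1)
    have h₂ := h.whiteR v (Bool.eq_false_iff.2 hc.2)
    exact huv (Λ.r_inj u v (by rw [← h₁, ← h₂, hs.2]))
  have hL' : ∃ z ∈ Z, (σ u).L.pos = m z ∧ (σ v).L.pos = m z := by
    rcases hL with hL | hL
    · obtain ⟨z, hz, e⟩ := h.redL_pos hL
      exact ⟨z, hz, e, by rw [← hs.1, e]⟩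
    · obtain ⟨z, hz, e⟩ := h.redL_pos hL
      exact ⟨z, hz, by rw [hs.1, e], e⟩
  have hR' : ∃ z ∈ Z, (σ u).R.pos = m z ∧ (σ v).R.pos = m z := by
    rcases hR with hR | hR
    · obtain ⟨z, hz, e⟩ := h.redR_pos hR
      exact ⟨z, hz, e, by rw [← hs.2, e]⟩
    · obtain ⟨z, hz, e⟩ := h.redR_pos hR
      exact ⟨z, hz, by rw [hs.2, e], e⟩
  obtain ⟨z, hz, e₁, e₂⟩ := hL'
  obtain ⟨z', hz', e₃, e₄⟩ := hR'
  exact ⟨h.redL_of_pos hz e₁, h.redL_of_pos hz e₂, h.redR_of_pos hz' e₃, h.redR_of_pos hz' e₄⟩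

/-- An open left endpoint comes with another vertex having the same two ends, which makes the right
endpoint red as well. -/
theorem not_openL_of_white (Λ : Layout lo hi σ₀) (h : SweepInv lo hi σ₀ Z m PL PR σ) {v : V}
    (hv : (σ v).R.red = false) : ¬ OpenL lo hi Z m PL σ v := by
  rintro ⟨-, -, -, a, h₁, -, h₂⟩
  have hne : v ≠ a := by rintro rfl; omega
  have := (h.red_of_sameEnds Λ hne h₂).2.2.1
  rw [hv] at this
  cases this

theorem not_openR_of_white (Λ : Layout lo hi σ₀) (h : SweepInv lo hi σ₀ Z m PL PR σ) {v : V}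
    (hv : (σ v).L.red = false) : ¬ OpenR lo hi Z m PR σ v := fun h' =>
  h.mirror.not_openL_of_white Λ.mirror (v := v) hv (openL_mirror.2 h')

/-! ### Adjacency, peeking and containment read off from the invariant -/

section Consequences

variable (Λ : Layout lo hi σ₀) (h : SweepInv lo hi σ₀ Z m ∅ ∅ σ)

include Λ h

/-- Collapsing respects the order of the cliques, so positions compare like indices. The only
doubtful comparison is between an open endpoint on the line of an adjacent clique and the opposite
endpoints of that clique; as nothing is pending, all of these lie on the line itself and are not
reached. -/
theorem reach_iff {u v : V} : (σ u).Reach (σ v) ↔ lo u ≤ hi v := by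
  have hwL : ∀ w, (σ w).L.red = false → (σ w).L = ⟨(σ₀ w).L.pos, true, false⟩ := by
    intro w hw
    have h₁ : (σ₀ w).L.closed = true := Λ.closed w .left
    have h₂ : (σ₀ w).L.red = false := Λ.white w .left
    rw [h.whiteL w hw, ← h₁, ← h₂]
  have hwR : ∀ w, (σ w).R.red = false → (σ w).R = ⟨(σ₀ w).R.pos, true, false⟩ := by
    intro w hw
    have h₁ : (σ₀ w).R.closed = true := Λ.closed w .right
    have h₂ : (σ₀ w).R.red = false := Λ.white w .right
    rw [h.whiteR w hw, ← h₁, ← h₂]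
  unfold MInterval.Reach
  rcases hu : (σ u).L.red with _ | _ <;> rcases hv : (σ v).R.red with _ | _
  · rw [hwL u hu, hwR v hv, Λ.reach u v, le_iff_lt_or_eq]
    simp
  · rcases h.right v hv with hR | hR
    · rw [hwL u hu, hR.eq, h.posL _ hR.mem u, le_iff_lt_or_eq]
      simp
    · have hne := h.neL _ hR.mem u hu
      have h₁ := h.posL _ hR.mem u
      have h₂ : lo u ≠ hi v + 1 := fun e => by
        rcases hR.full with hf | hf
        · exact hf.elim
        · rw [hf u e] at hu; cases hu
      rw [hwL u hu, hR.eq]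
      simp only [Bool.false_eq_true, and_false, or_false]
      rw [lt_iff_le_and_ne, ← h₁]
      constructor
      · rintro ⟨h₃, -⟩; omega
      · intro h₃; exact ⟨by omega, hne⟩
  · rcases h.left u hu with hL | hL
    · rw [hwR v hv, hL.eq, h.posR _ hL.mem v, le_iff_lt_or_eq]
      simp
    · have hne := h.neR _ hL.mem v hv
      have h₁ := h.posR _ hL.mem v
      have h₂ : hi v ≠ lo u - 1 := fun e => by
        rcases hL.full with hf | hf
        · exact hf.elim
        · rw [hf v e] at hv; cases hv
      rw [hwR v hv, hL.eq]
      simp only [Bool.false_eq_true, false_and, and_false, or_false]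
      rw [lt_iff_le_and_ne, ← h₁]
      constructor
      · rintro ⟨h₃, -⟩; omega
      · intro h₃; exact ⟨by omega, hne.symm⟩
  · rcases h.left u hu with hL | hL <;> rcases h.right v hv with hR | hR
    · rw [hL.eq, hR.eq, ← h.pos_le_iff hL.mem hR.mem, le_iff_lt_or_eq]
      simp
    · rw [hL.eq, hR.eq]
      simp only [Bool.false_eq_true, and_false, or_false]
      rw [h.pos_lt_iff hL.mem hR.mem]
      omega
    · rw [hL.eq, hR.eq]
      simp only [Bool.false_eq_true, false_and, and_false, or_false]
      rw [h.pos_lt_iff hL.mem hR.mem]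
      omega
    -- Open endpoints of two consecutive cliques, each on the other's line, would make the intervals
    -- overlap wrongly; fullness forces the right one to be closed instead.
    · have h₂ : hi v ≠ lo u - 1 := fun e => by
        rcases hL.full with hf | hf
        · exact hf.elim
        · have := hf v e; rw [hR.eq] at this; simp at this
      rw [hL.eq, hR.eq]
      simp only [Bool.false_eq_true, and_false, or_false]
      rw [h.pos_lt_iff hL.mem hR.mem]
      omega

theorem meets_iff {u v : V} : (σ u).Meets (σ v) ↔ lo u ≤ hi v ∧ lo v ≤ hi u := by
  rw [MInterval.meets_iff (h.lt u) (h.lt v), h.reach_iff Λ, h.reach_iff Λ]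

theorem represents {G : SimpleGraph V} (M : Model G lo hi) : Represents σ G := fun u v huv => by
  rw [h.meets_iff Λ, M.adj u v huv]

theorem peeksLeft_iff {x a b : V} :
    PeeksLeft σ x a b ↔ lo x ≤ hi a ∧ lo a ≤ hi x ∧ hi x < lo b := by
  have hx := h.lt x
  have hb := h.lt b
  unfold PeeksLeft
  rw [h.meets_iff Λ, h.meets_iff Λ]
  have h₁ := not_congr (h.reach_iff Λ (u := x) (v := b))
  have h₂ := not_congr (h.reach_iff Λ (u := b) (v := x))
  constructor
  · rintro ⟨⟨h₃, h₄⟩, h₅, h₆⟩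
    refine ⟨h₃, h₄, ?_⟩
    by_contra hc
    have h₇ := h₁.2 (by omega)
    simp only [MInterval.Reach, not_or] at h₇
    linarith
  · rintro ⟨h₃, h₄, h₅⟩
    refine ⟨⟨h₃, h₄⟩, by omega, ?_⟩
    have h₇ := h₂.2 (by omega)
    simp only [MInterval.Reach, not_or] at h₇
    linarith

theorem peeksRight_iff {x a b : V} :
    PeeksRight σ x a b ↔ lo x ≤ hi a ∧ lo a ≤ hi x ∧ hi b < lo x := by
  have h' := h.mirror
  rw [negSet_empty] at h'
  rw [← peeksLeft_mirror, h'.peeksLeft_iff Λ.mirror]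
  constructor
  · rintro ⟨h₁, h₂, h₃⟩; exact ⟨by omega, by omega, by omega⟩
  · rintro ⟨h₁, h₂, h₃⟩; exact ⟨by omega, by omega, by omega⟩

/-- Testing against a vertex that ends in `lo u` and one that starts in `hi u` gives weak inclusion
of cliques. If `u` and `v` started together, `u` would initially start to the left of `v`; each way
of reversing this order is contradictory or gives both intervals the same ends. -/
theorem lo_lt_of_strictlyIn {G : SimpleGraph V} (M : Model G lo hi) {u v : V}
    (hs : (σ u).StrictlyIn (σ v)) : lo v < lo u := by
  rw [MInterval.strictlyIn_iff (h.lt u) (h.lt v)] at hs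
  obtain ⟨h₁, h₂, h₃⟩ := hs
  have huv : u ≠ v := by rintro rfl; exact h₃ ⟨rfl, rfl⟩
  have hlo : lo v ≤ lo u := by
    obtain ⟨x, hx⟩ := M.exHi (lo u) u u le_rfl (M.le u)
    have h₄ := (h.reach_iff Λ (u := u) (v := x)).2 hx.ge
    have : (σ v).Reach (σ x) := by
      unfold MInterval.Reach at *
      unfold MInterval.LeL at h₁
      rcases h₁ with h₁ | ⟨h₁, h₁'⟩ <;> rcases h₄ with h₄ | ⟨h₄, h₄', h₄''⟩
      · left; linarith
      · left; linarith
      · left; linarith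
      · rcases h₁' with h₁' | h₁'
        · right; exact ⟨by linarith, h₁', h₄''⟩
        · rw [h₁'] at h₄'; cases h₄'
    have := (h.reach_iff Λ).1 this
    omega
  have hhi : hi u ≤ hi v := by
    obtain ⟨x, hx⟩ := M.exLo (hi u) u u (M.le u) le_rfl
    have h₄ := (h.reach_iff Λ (u := x) (v := u)).2 hx.le
    have : (σ x).Reach (σ v) := by
      unfold MInterval.Reach at *
      unfold MInterval.LeR at h₂
      rcases h₂ with h₁ | ⟨h₁, h₁'⟩ <;> rcases h₄ with h₄ | ⟨h₄, h₄', h₄''⟩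
      · left; linarith
      · left; linarith
      · left; linarith
      · rcases h₁' with h₁' | h₁'
        · right; exact ⟨by linarith, h₄', h₁'⟩
        · rw [h₁'] at h₄''; cases h₄''
    have := (h.reach_iff Λ).1 this
    omega
  by_contra hc
  have e : lo u = lo v := by omega
  have hhi' : hi u < hi v := lt_of_le_of_ne hhi fun e' => huv (M.inj u v e e')
  have hl := (Λ.l_lt u v).2 (.inr ⟨e, hhi'⟩)
  have hle : (σ v).L.pos ≤ (σ u).L.pos := by
    rcases h₁ with h₁ | h₁ <;> linarith
  rcases hv : (σ v).L.red with _ | _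
  · have ev := congrArg Endpoint.pos (h.whiteL v hv)
    rcases hu : (σ u).L.red with _ | _
    · have eu := congrArg Endpoint.pos (h.whiteL u hu)
      linarith
    · rcases h.left u hu with hL | hL
      · obtain ⟨a, ha₁, ha₂, ha₃, ha₄⟩ := hL.same
        have hva : v = a := by
          have := ha₂ v e.symm
          exact M.inj v a (by omega) (by omega)
        subst hva
        exact h₃ ha₄
      · have eu := congrArg Endpoint.pos hL.eq
        have := (not_congr (h.posL _ hL.mem v)).1 (by omega)
        simp only at eu
        linarith
  · rcases h.left v hv with hV | hV
    · have ev := congrArg Endpoint.pos hV.eq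
      have hvm := (h.posL _ hV.mem v).1 le_rfl
      simp only at ev
      rcases hu : (σ u).L.red with _ | _
      · have eu := congrArg Endpoint.pos (h.whiteL u hu)
        linarith
      · rcases h.left u hu with hL | hL
        · obtain ⟨a, ha₁, ha₂, ha₃, ha₄⟩ := hL.same
          have hva : v = a := by
            have := ha₂ v e.symm
            exact M.inj v a (by omega) (by omega)
          subst hva
          exact h₃ ha₄
        · have eu := congrArg Endpoint.pos hL.eq
          have := h.pos_lt hL.mem hV.mem (by omega)
          simp only at eu
          linarith
    -- Here `u` is nested in `a`, which has the ends of `v`. The invariant for nested pairs gives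
    -- `u` the ends of `a` as well.
    · obtain ⟨a, ha₁, ha₂, ha₃⟩ := hV.same
      rcases h.nested a u (by omega) (by omega) with hn | ⟨-, -, hn₁, hn₂⟩
      · have hva : v ≠ a := by rintro rfl; omega
        have := (h.red_of_sameEnds Λ hva ha₃).2.1
        rw [hn.1] at this
        cases this
      · refine h₃ ⟨?_, ?_⟩
        · rw [ha₃.1, hn₁, hn₂]; rfl
        · rw [ha₃.2, hn₁, hn₂]; rfl

/-- A nested pair is either entirely white or already collapsed to the same two ends, and only the
first kind counts as strict containment. -/
theorem strictlyIn_iff {G : SimpleGraph V} (M : Model G lo hi) {u v : V} :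
    (σ u).StrictlyIn (σ v) ↔ lo v < lo u ∧ hi u < hi v ∧ (σ v).L.red = false ∧
      (σ v).R.red = false ∧ (σ u).L.red = false ∧ (σ u).R.red = false := by
  constructor
  · intro hs
    have h₁ := h.lo_lt_of_strictlyIn Λ M hs
    have h' := h.mirror
    rw [negSet_empty] at h'
    have h₂ := h'.lo_lt_of_strictlyIn Λ.mirror M.mirror (u := u) (v := v)
      (MInterval.mirror_strictlyIn.2 hs)
    have h₃ : hi u < hi v := by omega
    rcases h.nested v u h₁ h₃ with hn | ⟨-, -, hn₁, hn₂⟩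
    · exact ⟨h₁, h₃, hn⟩
    · exact absurd ⟨by rw [hn₁, hn₂]; rfl, by rw [hn₁, hn₂]; rfl⟩ hs.2
  · rintro ⟨h₁, h₂, h₃, h₄, h₅, h₆⟩
    have e₁ := congrArg Endpoint.pos (h.whiteL v h₃)
    have e₂ := congrArg Endpoint.pos (h.whiteL u h₅)
    have e₃ := congrArg Endpoint.pos (h.whiteR v h₄)
    have e₄ := congrArg Endpoint.pos (h.whiteR u h₆)
    have e₅ := (Λ.l_lt v u).2 (.inl h₁)
    have e₆ := (Λ.r_lt u v).2 (.inl h₂)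
    refine (MInterval.strictlyIn_iff (h.lt u) (h.lt v)).2 ⟨.inl (by linarith), .inl (by linarith),
      fun e => ?_⟩
    have := e.1
    linarith

end Consequences

end SweepInv

end State

section Identification

variable {V : Type u} {G : SimpleGraph V} {lo hi : V → ℤ} {σ₀ : MixedRep V} {Z : Set ℤ}
  {m : ℤ → ℝ} {PL PR : Set ℤ} {σ : MixedRep V}

/-! ### Extending the state -/

/-- `σ'` arises from `σ` by moving white endpoints and colouring them red. -/
structure Extends (Z : Set ℤ) (m : ℤ → ℝ) (σ : MixedRep V) (Z' : Set ℤ) (m' : ℤ → ℝ)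
    (σ' : MixedRep V) : Prop where
  sub : Z ⊆ Z'
  pos : ∀ z ∈ Z, m' z = m z
  keepL : ∀ v, (σ v).L.red = true → (σ' v).L = (σ v).L
  keepR : ∀ v, (σ v).R.red = true → (σ' v).R = (σ v).R
  whiteL : ∀ v, (σ' v).L.red = false → (σ' v).L = (σ v).L
  whiteR : ∀ v, (σ' v).R.red = false → (σ' v).R = (σ v).R

namespace Extends

variable {Z' : Set ℤ} {m' : ℤ → ℝ} {σ' : MixedRep V}

theorem trans {Z'' : Set ℤ} {m'' : ℤ → ℝ} {σ'' : MixedRep V} (E : Extends Z m σ Z' m' σ')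
    (E' : Extends Z' m' σ' Z'' m'' σ'') : Extends Z m σ Z'' m'' σ'' where
  sub := E.sub.trans E'.sub
  pos z hz := by rw [E'.pos z (E.sub hz), E.pos z hz]
  keepL v hv := by
    have h := E.keepL v hv
    rw [E'.keepL v (by rw [h, hv]), h]
  keepR v hv := by
    have h := E.keepR v hv
    rw [E'.keepR v (by rw [h, hv]), h]
  whiteL v hv := by
    have h := E'.whiteL v hv
    rw [h, E.whiteL v (by rw [← h, hv])]
  whiteR v hv := by
    have h := E'.whiteR v hv
    rw [h, E.whiteR v (by rw [← h, hv])]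

theorem mirror (E : Extends Z m σ Z' m' σ') :
    Extends (negSet Z) (negPos m) σ.mirror (negSet Z') (negPos m') σ'.mirror where
  sub z hz := E.sub hz
  pos z hz := by simp only [negPos]; rw [E.pos _ hz]
  keepL v hv := by simp only [MixedRep.mirror_apply, MInterval.mirror_L]; rw [E.keepR v hv]
  keepR v hv := by simp only [MixedRep.mirror_apply, MInterval.mirror_R]; rw [E.keepL v hv]
  whiteL v hv := by simp only [MixedRep.mirror_apply, MInterval.mirror_L]; rw [E.whiteR v hv]
  whiteR v hv := by simp only [MixedRep.mirror_apply, MInterval.mirror_R]; rw [E.whiteL v hv]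

theorem redL (E : Extends Z m σ Z' m' σ') {v : V} (hv : (σ v).L.red = true) :
    (σ' v).L.red = true := by rw [E.keepL v hv, hv]

theorem redR (E : Extends Z m σ Z' m' σ') {v : V} (hv : (σ v).R.red = true) :
    (σ' v).R.red = true := by rw [E.keepR v hv, hv]

theorem fullR (E : Extends Z m σ Z' m' σ') {z : ℤ} (hz : z ∈ Z) (hf : FullR hi m σ z) :
    FullR hi m' σ' z := fun v hv => by
  have h := hf v hv
  rw [E.keepR v (by rw [h]), h, E.pos z hz]

theorem fullL (E : Extends Z m σ Z' m' σ') {z : ℤ} (hz : z ∈ Z) (hf : FullL lo m σ z) :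
    FullL lo m' σ' z := fun v hv => by
  have h := hf v hv
  rw [E.keepL v (by rw [h]), h, E.pos z hz]

theorem sameEnds (E : Extends Z m σ Z' m' σ') (Λ : Layout lo hi σ₀)
    (h : SweepInv lo hi σ₀ Z m PL PR σ) {u v : V} (hs : (σ u).SameEnds (σ v)) :
    (σ' u).SameEnds (σ' v) := by
  by_cases huv : u = v
  · subst huv; exact ⟨rfl, rfl⟩
  · obtain ⟨h₁, h₂, h₃, h₄⟩ := h.red_of_sameEnds Λ huv hs
    exact ⟨by rw [E.keepL u h₁, E.keepL v h₂, hs.1], by rw [E.keepR u h₃, E.keepR v h₄, hs.2]⟩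

end Extends

/-- Red endpoints and old lines are frozen. Hence only endpoints that turn red, new lines, cliques
that cease to be pending and nested pairs that were white need attention. -/
theorem SweepInv.extend (Λ : Layout lo hi σ₀) (h : SweepInv lo hi σ₀ Z m PL PR σ) {Z' : Set ℤ}
    {m' : ℤ → ℝ} {σ' : MixedRep V} {PL' PR' : Set ℤ} (E : Extends Z m σ Z' m' σ')
    (left : ∀ v, (σ v).L.red = false → (σ' v).L.red = true →
      ClosedL lo hi Z' m' σ' v ∨ OpenL lo hi Z' m' PL' σ' v)
    (right : ∀ v, (σ v).R.red = false → (σ' v).R.red = true →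
      ClosedR lo hi Z' m' σ' v ∨ OpenR lo hi Z' m' PR' σ' v)
    (pendL : ∀ z ∈ PL, z ∈ PL' ∨ FullR hi m' σ' z)
    (pendR : ∀ z ∈ PR, z ∈ PR' ∨ FullL lo m' σ' z)
    (new : ∀ z ∈ Z', z ∉ Z → (∃ v, lo v = z) ∧ (∃ v, hi v = z) ∧ ∀ v,
      (lo v ≤ z ↔ (σ₀ v).L.pos ≤ m' z) ∧ (z ≤ hi v ↔ m' z ≤ (σ₀ v).R.pos) ∧
      ((σ' v).L.red = false → (σ₀ v).L.pos ≠ m' z) ∧ ((σ' v).R.red = false → (σ₀ v).R.pos ≠ m' z))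
    (fullR : ∀ a x, LLink lo hi a x → lo a ∈ Z' → lo a ∉ PL' → (lo a ∉ Z ∨ lo a ∈ PL) →
      FullR hi m' σ' (lo a))
    (fullL : ∀ a x, RLink lo hi a x → hi a ∈ Z' → hi a ∉ PR' → (hi a ∉ Z ∨ hi a ∈ PR) →
      FullL lo m' σ' (hi a))
    (linkL : ∀ a x, LLink lo hi a x → lo a ∈ Z' → lo a ∉ PR' → (lo a ∉ Z ∨ lo a ∈ PR) →
      (σ' a).L = ⟨m' (lo a), true, true⟩)
    (linkR : ∀ a x, RLink lo hi a x → hi a ∈ Z' → hi a ∉ PL' → (hi a ∉ Z ∨ hi a ∈ PL) →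
      (σ' a).R = ⟨m' (hi a), true, true⟩)
    (nested : ∀ a b, lo a < lo b → hi b < hi a → (σ a).L.red = false → (σ a).R.red = false →
      (σ b).L.red = false → (σ b).R.red = false →
      ((σ' a).L.red = false ∧ (σ' a).R.red = false ∧ (σ' b).L.red = false ∧
        (σ' b).R.red = false) ∨
      (lo a ∈ Z' ∧ hi a ∈ Z' ∧ σ' a = redInterval true (m' (lo a)) (m' (hi a)) true ∧
        σ' b = redInterval false (m' (lo a)) (m' (hi a)) false))
    (partL : ∀ a x, LLink lo hi a x → (σ x).L.red = false → (σ' x).L.closed = true →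
      (σ' x).L.red = false)
    (partR : ∀ a x, RLink lo hi a x → (σ x).R.red = false → (σ' x).R.closed = true →
      (σ' x).R.red = false)
    (lt : ∀ v, (σ' v).L.pos < (σ' v).R.pos) : SweepInv lo hi σ₀ Z' m' PL' PR' σ' where
  left v hv := by
    rcases hw : (σ v).L.red with _ | _
    · exact left v hw hv
    · rcases h.left v hw with hc | hc
      · obtain ⟨a, h₁, h₂, h₃, h₄⟩ := hc.same
        exact .inl ⟨E.sub hc.mem, by rw [E.keepL v hw, hc.eq, E.pos _ hc.mem],
          a, h₁, h₂, h₃, E.sameEnds Λ h h₄⟩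
      · obtain ⟨a, h₁, h₂, h₃⟩ := hc.same
        refine .inr ⟨E.sub hc.mem, by rw [E.keepL v hw, hc.eq, E.pos _ hc.mem], ?_,
          a, h₁, h₂, E.sameEnds Λ h h₃⟩
        rcases hc.full with hf | hf
        · exact pendL _ hf
        · exact .inr (E.fullR hc.mem hf)
  right v hv := by
    rcases hw : (σ v).R.red with _ | _
    · exact right v hw hv
    · rcases h.right v hw with hc | hc
      · obtain ⟨a, h₁, h₂, h₃, h₄⟩ := hc.same
        exact .inl ⟨E.sub hc.mem, by rw [E.keepR v hw, hc.eq, E.pos _ hc.mem],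
          a, h₁, h₂, h₃, E.sameEnds Λ h h₄⟩
      · obtain ⟨a, h₁, h₂, h₃⟩ := hc.same
        refine .inr ⟨E.sub hc.mem, by rw [E.keepR v hw, hc.eq, E.pos _ hc.mem], ?_,
          a, h₁, h₂, E.sameEnds Λ h h₃⟩
        rcases hc.full with hf | hf
        · exact pendR _ hf
        · exact .inr (E.fullL hc.mem hf)
  whiteL v hv := by
    have e := E.whiteL v hv
    rw [e, h.whiteL v (by rw [← e, hv])]
  whiteR v hv := by
    have e := E.whiteR v hv
    rw [e, h.whiteR v (by rw [← e, hv])]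
  exL z hz := by
    by_cases hz' : z ∈ Z
    · exact h.exL z hz'
    · exact (new z hz hz').1
  exR z hz := by
    by_cases hz' : z ∈ Z
    · exact h.exR z hz'
    · exact (new z hz hz').2.1
  posL z hz v := by
    by_cases hz' : z ∈ Z
    · rw [E.pos z hz']; exact h.posL z hz' v
    · exact ((new z hz hz').2.2 v).1
  posR z hz v := by
    by_cases hz' : z ∈ Z
    · rw [E.pos z hz']; exact h.posR z hz' v
    · exact ((new z hz hz').2.2 v).2.1
  neL z hz v hv := by
    by_cases hz' : z ∈ Z
    · rw [E.pos z hz']; exact h.neL z hz' v (by rw [← E.whiteL v hv, hv])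
    · exact ((new z hz hz').2.2 v).2.2.1 hv
  neR z hz v hv := by
    by_cases hz' : z ∈ Z
    · rw [E.pos z hz']; exact h.neR z hz' v (by rw [← E.whiteR v hv, hv])
    · exact ((new z hz hz').2.2 v).2.2.2 hv
  fullR a x hl hz hp := by
    by_cases hz' : lo a ∈ Z
    · by_cases hp' : lo a ∈ PL
      · exact fullR a x hl hz hp (.inr hp')
      · exact E.fullR hz' (h.fullR a x hl hz' hp')
    · exact fullR a x hl hz hp (.inl hz')
  fullL a x hl hz hp := by
    by_cases hz' : hi a ∈ Z
    · by_cases hp' : hi a ∈ PR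
      · exact fullL a x hl hz hp (.inr hp')
      · exact E.fullL hz' (h.fullL a x hl hz' hp')
    · exact fullL a x hl hz hp (.inl hz')
  linkL a x hl hz hp := by
    by_cases hz' : lo a ∈ Z
    · by_cases hp' : lo a ∈ PR
      · exact linkL a x hl hz hp (.inr hp')
      · have e := h.linkL a x hl hz' hp'
        rw [E.keepL a (by rw [e]), e, E.pos _ hz']
    · exact linkL a x hl hz hp (.inl hz')
  linkR a x hl hz hp := by
    by_cases hz' : hi a ∈ Z
    · by_cases hp' : hi a ∈ PL
      · exact linkR a x hl hz hp (.inr hp')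
      · have e := h.linkR a x hl hz' hp'
        rw [E.keepR a (by rw [e]), e, E.pos _ hz']
    · exact linkR a x hl hz hp (.inl hz')
  nested a b h₁ h₂ := by
    rcases h.nested a b h₁ h₂ with ⟨w₁, w₂, w₃, w₄⟩ | ⟨z₁, z₂, e₁, e₂⟩
    · exact nested a b h₁ h₂ w₁ w₂ w₃ w₄
    · right
      refine ⟨E.sub z₁, E.sub z₂, ?_, ?_⟩
      · rw [E.pos _ z₁, E.pos _ z₂, ← e₁]
        have k₁ := E.keepL a (by rw [e₁]; rfl)
        have k₂ := E.keepR a (by rw [e₁]; rfl)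
        cases hσ : σ' a; cases hσ' : σ a
        simp_all
      · rw [E.pos _ z₁, E.pos _ z₂, ← e₂]
        have k₁ := E.keepL b (by rw [e₂]; rfl)
        have k₂ := E.keepR b (by rw [e₂]; rfl)
        cases hσ : σ' b; cases hσ' : σ b
        simp_all
  partL a x hl hc := by
    rcases hw : (σ x).L.red with _ | _
    · exact partL a x hl hw hc
    · rw [E.keepL x hw] at hc ⊢
      exact h.partL a x hl hc
  partR a x hl hc := by
    rcases hw : (σ x).R.red with _ | _
    · exact partR a x hl hw hc
    · rw [E.keepR x hw] at hc ⊢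
      exact h.partR a x hl hc
  lt := lt

/-! ### The vertices that a sweep identifies -/

/-- `a` properly dominates `x`, while the first vertex of a link is dominated by no other vertex. -/
theorem LLink.not_llink (M : Model G lo hi) {a x y : V} (h : LLink lo hi a x) :
    ¬ LLink lo hi x y := fun h' => by
  have h₁ := h.lo_lt
  have h₂ := h'.max M (v := a) h₁.le h.hi_le
  rw [h₂] at h₁
  exact lt_irrefl _ h₁

/-- The position of the vertices of a step, relative to the vertex of type a. -/
structure StepOK (lo hi : V → ℤ) (s : Step V) : Prop where
  link : ∃ x, LLink lo hi s.a x ∧ (s.b = some x ∨ s.c = some x)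
  b : ∀ b, s.b = some b → lo b = lo s.a + 1 ∧ hi b = hi s.a - 1
  c : ∀ c, s.c = some c → lo c = lo s.a + 1 ∧ hi c = hi s.a
  -- The last clause permits a closed red left endpoint for `d` without violating `partL`. The field
  -- `part` guarantees that the whole left block at `lo s.a` can be moved when a right link leads
  -- there.
  d : ∀ d, s.d = some d → lo d = lo s.a ∧ hi d = hi s.a - 1 ∧ lo s.a < hi d ∧
    ∀ a, ¬ LLink lo hi a d
  part : ∀ y, RLink lo hi s.a y → lo y = lo s.a → s.d = some y

theorem StepOK.lo_lt_hi (M : Model G lo hi) {s : Step V} (hs : StepOK lo hi s) :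
    lo s.a < hi s.a := by
  obtain ⟨x, hx, -⟩ := hs.link
  have := hx.lo_lt
  have := hx.hi_le
  have := M.le x
  omega

/-- Both `b` and `c` start one clique after `a`, so to peek means to end exactly in the first clique
of `a`. -/
theorem peekers_eq (M : Model G lo hi) (Λ : Layout lo hi σ₀) (h : SweepInv lo hi σ₀ Z m ∅ ∅ σ)
    {s : Step V} (hs : StepOK lo hi s) : peekers σ s = {x | hi x = lo s.a} := by
  have hlt := hs.lo_lt_hi M
  ext x
  have hx := M.le x
  simp only [peekers, Set.mem_ofPred_eq, h.peeksLeft_iff Λ]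
  constructor
  · rintro (⟨b, hb, h₁, h₂, h₃⟩ | ⟨c, hc, h₁, h₂, h₃⟩)
    · have := hs.b b hb; omega
    · have := hs.c c hc; omega
  · intro hx'
    obtain ⟨y, hy, hy'⟩ := hs.link
    have := hy.lo_lt
    rcases hy' with hy' | hy'
    · exact .inl ⟨y, hy', by omega, by omega, by omega⟩
    · exact .inr ⟨y, hy', by omega, by omega, by omega⟩

/-- The facts about the step `t` that follows the step `s`. -/
structure NextOK (lo hi : V → ℤ) (σ : MixedRep V) (s t : Step V) : Prop where
  hi_a : hi t.a = lo s.a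
  block : ∀ v, hi v = lo s.a → v = t.a ∨ t.c = some v
  min : ∀ v, hi v = lo s.a → lo t.a ≤ lo v
  c : ∀ c, t.c = some c → lo c = lo t.a + 1 ∧ hi c = hi t.a ∧ LLink lo hi t.a c ∧
    (σ c).L.red = false ∧ (σ c).R.red = false
  b : ∀ b, t.b = some b → lo b = lo t.a + 1 ∧ hi b = hi t.a - 1 ∧ (σ t.a).L.red = false ∧
    (σ b).L.red = false ∧ (σ b).R.red = false
  nested : ∀ b, lo t.a < lo b → hi b < hi t.a → (σ t.a).L.red = false → t.b = some b
  whiteR : (σ t.a).R.red = false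

/-- A red right endpoint in this block would be closed on the line of `lo a`, and then `linkL` makes
`a` red on the left; or open on the next line, where fullness gives `x` a closed red left endpoint,
against `partL`. -/
theorem SweepInv.block_white (h : SweepInv lo hi σ₀ Z m ∅ ∅ σ) (M : Model G lo hi) {a x v : V}
    (hl : LLink lo hi a x) (ha : (σ a).L.red = false) (hv : hi v = lo a) :
    (σ v).R.red = false := by
  by_contra hc
  rcases h.right v (by simpa using hc) with hR | hR
  · have := h.linkL a x hl (hv ▸ hR.mem) (by simp)
    rw [this] at ha
    cases ha
  · rcases hR.full with hf | hf
    · exact hf.elim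
    · have e := hf x (by rw [hl.lo_eq M, hv])
      have := h.partL a x hl (by rw [e])
      rw [e] at this
      cases this

theorem NextStep.nextOK (M : Model G lo hi) (Λ : Layout lo hi σ₀)
    (h : SweepInv lo hi σ₀ Z m ∅ ∅ σ) {s t : Step V} (hs : StepOK lo hi s)
    (hw : (σ s.a).L.red = false) (hn : NextStep G σ s t) : NextOK lo hi σ s t := by
  obtain ⟨hac, hb, -⟩ := hn
  rw [peekers_eq M Λ h hs] at hac
  obtain ⟨x, hx, -⟩ := hs.link
  have hmem : ∀ v, v = t.a ∨ t.c = some v ↔ hi v = lo s.a := by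
    intro v
    rcases hac with ⟨h₁, h₂⟩ | ⟨c, h₁, h₂, -⟩
    · have := Set.ext_iff.1 h₂ v
      simp only [Set.mem_ofPred_eq, Set.mem_singleton_iff] at this
      simp [h₁, this]
    · have := Set.ext_iff.1 h₂ v
      simp only [Set.mem_ofPred_eq, Set.mem_singleton_iff, Set.mem_insert_iff] at this
      simp [h₁, this, eq_comm]
  have hia := (hmem t.a).1 (.inl rfl)
  have hwh : ∀ v, hi v = lo s.a → (σ v).R.red = false := fun v hv => h.block_white M hx hw hv
  have hc : ∀ c, t.c = some c → lo t.a < lo c := by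
    intro c hc
    rcases hac with ⟨h₁, -⟩ | ⟨c', h₁, -, h₃⟩
    · rw [h₁] at hc; cases hc
    · obtain rfl : c' = c := by rw [h₁] at hc; exact Option.some.inj hc
      have hc' := (hmem c').1 (.inr h₁)
      -- White right endpoints are in their initial order, and within a clique that order is the
      -- order of `lo`.
      rw [h.whiteR _ (hwh _ hia), h.whiteR _ (hwh _ hc'), Λ.r_lt] at h₃
      omega
  have hst : ∀ b, (σ b).StrictlyIn (σ t.a) → lo t.a < lo b ∧ hi b < hi t.a := fun b hb => by
    have := (h.strictlyIn_iff Λ M).1 hb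
    exact ⟨this.1, this.2.1⟩
  refine ⟨hia, fun v hv => (hmem v).2 hv, ?_, ?_, ?_, ?_, hwh _ hia⟩
  · intro v hv
    rcases (hmem v).2 hv with rfl | hv'
    · exact le_rfl
    · exact (hc v hv').le
  · intro c hc'
    have h₁ := (hmem c).1 (.inr hc')
    have hl : LLink lo hi t.a c := .step hx hia h₁ (hc c hc')
    refine ⟨hl.lo_eq M, by omega, hl, ?_, hwh _ h₁⟩
    by_contra hr
    have hr' : (σ c).L.red = true := by simpa using hr
    rcases h.left c hr' with h₂ | h₂
    · exact hr (h.partL _ _ hl (by rw [h₂.eq]))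
    · exact h.not_openL_of_white Λ (hwh _ h₁) h₂
  · intro b hb'
    rw [hb'] at hb
    have := (h.strictlyIn_iff Λ M).1 hb
    exact ⟨nested_lo M this.1 this.2.1, nested_hi M this.1 this.2.1, this.2.2.1, this.2.2.2.2.1,
      this.2.2.2.2.2⟩
  · intro b h₁ h₂ h₃
    have h₄ : (σ b).StrictlyIn (σ t.a) := by
      rw [h.strictlyIn_iff Λ M]
      rcases h.nested t.a b h₁ h₂ with h' | ⟨-, -, e, -⟩
      · exact ⟨h₁, h₂, h'⟩
      · rw [e] at h₃; cases h₃
    cases hb' : t.b with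
    | none => rw [hb'] at hb; exact absurd h₄ (hb b)
    | some b' =>
      rw [hb'] at hb
      have h₅ := hst b' hb
      rw [M.inj b' b (by rw [nested_lo M h₁ h₂, nested_lo M h₅.1 h₅.2])
        (by rw [nested_hi M h₁ h₂, nested_hi M h₅.1 h₅.2])]

theorem NextOK.white_of_cont {s t : Step V} (ht : NextOK lo hi σ s t)
    (hn : ¬ (t.Terminal ∨ t.Merging σ)) : (σ t.a).L.red = false := by
  cases hc : t.c with
  | some c =>
    by_contra hr
    exact hn (.inr ⟨⟨c, hc⟩, by simpa using hr⟩)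
  | none =>
    cases hb : t.b with
    | none => exact absurd (.inl ⟨hb, hc⟩) hn
    | some b => exact (ht.b b hb).2.2.1

theorem NextOK.link_of_cont {s t : Step V} (ht : NextOK lo hi σ s t)
    (hn : ¬ (t.Terminal ∨ t.Merging σ)) :
    ∃ x, LLink lo hi t.a x ∧ (t.b = some x ∨ t.c = some x) := by
  cases hc : t.c with
  | some c => exact ⟨c, (ht.c c hc).2.2.1, .inr rfl⟩
  | none =>
    cases hb : t.b with
    | none => exact absurd (.inl ⟨hb, hc⟩) hn
    | some b =>
      have := ht.b b hb
      exact ⟨b, .base (by omega) (by omega), .inl rfl⟩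

theorem StepOK.trim_iff (M : Model G lo hi) {s t : Step V} (hs : StepOK lo hi s)
    (hia : hi t.a = lo s.a) (v : V) :
    closedNbhd G v = closedNbhd G t.a \ {x | x = s.a ∨ s.d = some x} ↔
      lo v = lo t.a ∧ hi v = hi t.a - 1 ∧ ∀ x, lo x = hi t.a → x = s.a ∨ s.d = some x := by
  refine M.trim_right (S := {x | x = s.a ∨ s.d = some x}) ?_ ⟨s.a, .inl rfl⟩
  rintro x (rfl | hx)
  · exact hia.symm
  · rw [(hs.d x hx).1, hia]

theorem StepOK.next (M : Model G lo hi) {s t : Step V} (hs : StepOK lo hi s)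
    (ht : NextOK lo hi σ s t) (hlink : ∃ x, LLink lo hi t.a x ∧ (t.b = some x ∨ t.c = some x))
    (hd : Picks (fun v => closedNbhd G v = closedNbhd G t.a \ {x | x = s.a ∨ s.d = some x}) t.d) :
    StepOK lo hi t := by
  have hia := ht.hi_a
  obtain ⟨y, hy, -⟩ := hs.link
  obtain ⟨x, hx, hx'⟩ := hlink
  refine ⟨⟨x, hx, hx'⟩, fun b hb => ⟨(ht.b b hb).1, (ht.b b hb).2.1⟩,
    fun c hc => ⟨(ht.c c hc).1, (ht.c c hc).2.1⟩, ?_, ?_⟩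
  · intro d hd'
    rw [hd'] at hd
    obtain ⟨h₁, h₂, h₃⟩ := (hs.trim_iff M hia d).1 hd
    have hx₁ := hx.lo_eq M
    have hx₂ := hx.hi_le
    have hx₃ := M.le x
    refine ⟨h₁, h₂, ?_, ?_⟩
    · by_contra hc
      rcases h₃ x (by omega) with rfl | h₄
      · exact hx.not_llink M hy
      · exact (hs.d x h₄).2.2.2 _ hx
    · intro a hl
      have hl' := hl.lo_eq M
      cases hl with
      | base h₄ h₅ =>
        have := hx.max M (v := a) (by omega) (by omega)
        rw [this] at hl'
        omega
      | @step a₁ x₁ _ _ h₄ h₅ h₆ h₇ =>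
        have := h₄.lo_eq M
        rcases h₃ x₁ (by omega) with rfl | h₈
        · exact h₄.not_llink M hy
        · exact (hs.d x₁ h₈).2.2.2 _ h₄
  · intro y' hr hlo
    have h₁ := hr.hi_eq M
    -- A vertex other than `s.a` starting in the clique `hi t.a` continues the right link by one
    -- step, so by `part` it is `s.d`. Hence `y'` passes the neighbourhood test for type d.
    have h₂ := (hs.trim_iff M hia y').2 ⟨hlo, h₁, fun w hw => by
      by_contra! hne
      have h₃ : hi w < hi s.a := by
        by_contra hc
        exact hne.1 (hy.max M (v := w) (by omega) (by omega))
      exact hne.2 (hs.part w (hr.step (by omega) hw h₃) (by omega))⟩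
    cases hd' : t.d with
    | none => rw [hd'] at hd; exact absurd h₂ (hd y')
    | some d =>
      rw [hd'] at hd
      obtain ⟨h₃, h₄, -⟩ := (hs.trim_iff M hia d).1 hd
      rw [M.inj d y' (by omega) (by omega)]

theorem IsBase.white (M : Model G lo hi) (Λ : Layout lo hi σ₀)
    (h : SweepInv lo hi σ₀ Z m ∅ ∅ σ) {s : Step V} (hb : IsBase G σ s) :
    ∃ b, s.b = some b ∧ lo s.a < lo b ∧ hi b < hi s.a ∧ (σ s.a).L.red = false ∧
      (σ s.a).R.red = false ∧ (σ b).L.red = false ∧ (σ b).R.red = false := by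
  obtain ⟨b, h₁, h₂, -⟩ := hb
  exact ⟨b, h₁, (h.strictlyIn_iff Λ M).1 h₂⟩

theorem IsBase.mirror {s : Step V} (hb : IsBase G σ s) : IsBase G σ.mirror s.swap := by
  obtain ⟨b, h₁, h₂, h₃, h₄⟩ := hb
  refine ⟨b, h₁, MInterval.mirror_strictlyIn.2 h₂, ?_, ?_⟩
  · simpa only [Step.swap, peeksLeft_mirror] using h₄
  · have e : ∀ x, PeeksRight σ.mirror x s.a b ↔ PeeksLeft σ x s.a b := fun x => by
      rw [← peeksLeft_mirror, MixedRep.mirror_mirror]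
    simpa only [Step.swap, e] using h₃

theorem IsBase.stepOK (M : Model G lo hi) (Λ : Layout lo hi σ₀)
    (h : SweepInv lo hi σ₀ Z m ∅ ∅ σ) {s : Step V} (hb : IsBase G σ s) : StepOK lo hi s := by
  obtain ⟨b, hb₁, hb₂, hc, hd⟩ := hb
  obtain ⟨h₁, h₂, -⟩ := (h.strictlyIn_iff Λ M).1 hb₂
  have e₁ := nested_lo M h₁ h₂
  have e₂ := nested_hi M h₁ h₂
  have lb := M.le b
  have pl : {x | PeeksLeft σ x s.a b} = {x | hi x = lo s.a} := by
    ext x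
    have := M.le x
    simp only [Set.mem_ofPred_eq, h.peeksLeft_iff Λ]
    omega
  have pr : {x | PeeksRight σ x s.a b} = {x | lo x = hi s.a} := by
    ext x
    have := M.le x
    simp only [Set.mem_ofPred_eq, h.peeksRight_iff Λ]
    omega
  rw [pl] at hc
  rw [pr] at hd
  have tl := fun v => M.trim_left (a := s.a) (c := v) (S := {x | hi x = lo s.a})
    (fun _ hx => hx) (M.exHi (lo s.a) s.a s.a le_rfl (M.le _))
  have tr := fun v => M.trim_right (a := s.a) (d := v) (S := {x | lo x = hi s.a})
    (fun _ hx => hx) (M.exLo (hi s.a) s.a s.a (M.le _) le_rfl)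
  refine ⟨⟨b, .base h₁ h₂, .inl hb₁⟩, ?_, ?_, ?_, ?_⟩
  · intro b' hb'
    obtain rfl : b = b' := by rw [hb₁] at hb'; exact Option.some.inj hb'
    exact ⟨e₁, e₂⟩
  · intro c hc'
    rw [hc'] at hc
    have := (tl c).1 hc
    exact ⟨this.1, this.2.1⟩
  · intro d hd'
    rw [hd'] at hd
    have h₃ := (tr d).1 hd
    refine ⟨h₃.1, h₃.2.1, by omega, ?_⟩
    intro a hl
    have hl' := hl.lo_eq M
    cases hl with
    | base h₄ h₅ =>
      have := nested_max M h₁ h₂ (v := a) (by omega) (by omega)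
      rw [this] at hl'
      omega
    | step h₄ h₅ h₆ h₇ =>
      rcases h₄.block_le_two M h₅ h₆ (r := b) (by omega) with h' | h' | h'
      · rw [h'] at h₇; omega
      · rw [← h'] at e₁; omega
      · rw [← h'] at e₁; omega
  · intro y hr hlo
    have h₃ := (tr y).2 ⟨hlo, hr.hi_eq M, fun _ hx => hx⟩
    cases hd' : s.d with
    | none => rw [hd'] at hd; exact absurd h₃ (hd y)
    | some d =>
      rw [hd'] at hd
      have h₄ := (tr d).1 hd
      have := hr.hi_eq M
      rw [M.inj d y (by omega) (by omega)]

/-! ### Existence and uniqueness -/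

theorem exists_picks (P : V → Prop) : ∃ o, Picks P o := by
  by_cases h : ∃ v, P v
  · obtain ⟨v, hv⟩ := h; exact ⟨some v, hv⟩
  · exact ⟨none, fun v hv => h ⟨v, hv⟩⟩

theorem picks_unique {P : V → Prop} (hP : ∀ u v, P u → P v → u = v) {o o' : Option V}
    (h : Picks P o) (h' : Picks P o') : o = o' := by
  cases o <;> cases o'
  · rfl
  · exact absurd h' (h _)
  · exact absurd h (h' _)
  · rw [hP _ _ h h']

theorem exists_nextStep (M : Model G lo hi) (Λ : Layout lo hi σ₀)
    (h : SweepInv lo hi σ₀ Z m ∅ ∅ σ) {s : Step V} (hs : StepOK lo hi s)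
    (hw : (σ s.a).L.red = false) : ∃ t, NextStep G σ s t := by
  obtain ⟨x, hx, -⟩ := hs.link
  obtain ⟨p, hp⟩ := M.exHi (lo s.a) s.a s.a le_rfl (M.le _)
  have hac : ∃ a : V, ∃ c : Option V, (c = none ∧ peekers σ s = {a}) ∨
      (∃ c', c = some c' ∧ peekers σ s = {a, c'} ∧ (σ a).R.pos < (σ c').R.pos) := by
    rw [peekers_eq M Λ h hs]
    by_cases hq : ∃ q, hi q = lo s.a ∧ q ≠ p
    · obtain ⟨q, hq, hqp⟩ := hq
      have hset : {x | hi x = lo s.a} = {p, q} := by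
        ext y
        simp only [Set.mem_ofPred_eq, Set.mem_insert_iff, Set.mem_singleton_iff]
        constructor
        · intro hy
          rcases hx.block_le_two M hp hq hy with h' | h' | h'
          · exact absurd h'.symm hqp
          · exact .inr h'.symm
          · exact .inl h'.symm
        · rintro (rfl | rfl) <;> assumption
      have e₁ := congrArg Endpoint.pos (h.whiteR _ (h.block_white M hx hw hp))
      have e₂ := congrArg Endpoint.pos (h.whiteR _ (h.block_white M hx hw hq))
      rcases lt_or_gt_of_ne (fun e => hqp (Λ.r_inj p q e).symm) with hlt | hlt
      · exact ⟨p, some q, .inr ⟨q, rfl, hset, by rwa [e₁, e₂]⟩⟩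
      · exact ⟨q, some p, .inr ⟨p, rfl, by rw [hset, Set.pair_comm], by rwa [e₁, e₂]⟩⟩
    · push Not at hq
      refine ⟨p, none, .inl ⟨rfl, ?_⟩⟩
      ext y
      simp only [Set.mem_ofPred_eq, Set.mem_singleton_iff]
      exact ⟨hq y, fun e => e ▸ hp⟩
  obtain ⟨a, c, hac⟩ := hac
  obtain ⟨b, hb⟩ := exists_picks fun v => (σ v).StrictlyIn (σ a)
  obtain ⟨d, hd⟩ := exists_picks fun v =>
    closedNbhd G v = closedNbhd G a \ {x | x = s.a ∨ s.d = some x}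
  exact ⟨⟨a, b, c, d⟩, hac, hb, hd⟩

theorem NextStep.unique (M : Model G lo hi) (Λ : Layout lo hi σ₀)
    (h : SweepInv lo hi σ₀ Z m ∅ ∅ σ) {s t t' : Step V} (hs : StepOK lo hi s)
    (hw : (σ s.a).L.red = false) (ht : NextStep G σ s t) (ht' : NextStep G σ s t') : t = t' := by
  have o := ht.nextOK M Λ h hs hw
  have o' := ht'.nextOK M Λ h hs hw
  have ea : t.a = t'.a := M.inj _ _
    (le_antisymm (o.min _ o'.hi_a) (o'.min _ o.hi_a)) (by rw [o.hi_a, o'.hi_a])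
  have ec : ∀ {t t' : Step V}, NextOK lo hi σ s t → NextOK lo hi σ s t' → t.a = t'.a →
      ∀ c, t.c = some c → t'.c = some c := by
    intro t t' o o' ea c hc
    have h₁ := o.c c hc
    rcases o'.block c (by rw [h₁.2.1, o.hi_a]) with h₂ | h₂
    · rw [← ea] at h₂; rw [h₂] at h₁; omega
    · exact h₂
  have eb := picks_unique (fun u v hu hv => by
    have hu' := (h.strictlyIn_iff Λ M).1 hu
    have hv' := (h.strictlyIn_iff Λ M).1 hv
    exact M.inj u v (by rw [nested_lo M hu'.1 hu'.2.1, nested_lo M hv'.1 hv'.2.1])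
      (by rw [nested_hi M hu'.1 hu'.2.1, nested_hi M hv'.1 hv'.2.1])) ht.2.1 (ea ▸ ht'.2.1)
  have ed := picks_unique (fun u v hu hv => by
    have hu' := (hs.trim_iff M o.hi_a u).1 hu
    have hv' := (hs.trim_iff M o.hi_a v).1 hv
    exact M.inj u v (by omega) (by omega)) ht.2.2 (ea ▸ ht'.2.2)
  have ec' : t.c = t'.c := by
    cases hc : t.c with
    | some c => exact (ec o o' ea c hc).symm
    | none =>
      cases hc' : t'.c with
      | none => rfl
      | some c => rw [ec o' o ea.symm c hc'] at hc; cases hc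
  cases t; cases t'
  simp only at ea eb ec' ed
  subst ea eb ec' ed
  rfl

/-- Each step starts farther left, so the number of vertices starting to the left of `s.a`
decreases. -/
theorem exists_leftSteps [Fintype V] (M : Model G lo hi) (Λ : Layout lo hi σ₀)
    (h : SweepInv lo hi σ₀ Z m ∅ ∅ σ) {s : Step V} (hs : StepOK lo hi s)
    (hw : (σ s.a).L.red = false) : ∃ l, LeftSteps G σ s l := by
  classical
  induction hn : (Finset.univ.filter fun v => lo v < lo s.a).card using Nat.strong_induction_on
    generalizing s with
  | _ n ih =>
    obtain ⟨t, ht⟩ := exists_nextStep M Λ h hs hw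
    by_cases hend : t.Terminal ∨ t.Merging σ
    · exact ⟨_, .finish ht hend⟩
    · have o := ht.nextOK M Λ h hs hw
      have hs' := hs.next M o (o.link_of_cont hend) ht.2.2
      have hlt := hs'.lo_lt_hi M
      rw [o.hi_a] at hlt
      obtain ⟨l, hl⟩ := ih _ (by
        rw [← hn]
        refine Finset.card_lt_card ⟨fun v => ?_, fun hsub => ?_⟩
        · simp only [Finset.mem_filter, Finset.mem_univ, true_and]; omega
        · have := hsub (x := t.a) (by simpa using hlt)
          simp at this) hs' (o.white_of_cont hend) rfl
      exact ⟨_, .cont ht hend hl⟩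

theorem LeftSteps.unique (M : Model G lo hi) (Λ : Layout lo hi σ₀)
    (h : SweepInv lo hi σ₀ Z m ∅ ∅ σ) {s : Step V} {l l' : List (Step V)} (hs : StepOK lo hi s)
    (hw : (σ s.a).L.red = false) (hl : LeftSteps G σ s l) (hl' : LeftSteps G σ s l') : l = l' := by
  induction hl generalizing l' with
  | @finish s t ht hend =>
    cases hl' with
    | finish ht' _ => rw [ht.unique M Λ h hs hw ht']
    | cont ht' hend' _ =>
      rw [ht.unique M Λ h hs hw ht'] at hend
      exact absurd hend hend'
  | @cont s t l ht hend _ ih =>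
    cases hl' with
    | finish ht' hend' =>
      rw [← ht.unique M Λ h hs hw ht'] at hend'
      exact absurd hend' hend
    | cont ht' _ hl' =>
      obtain rfl := ht.unique M Λ h hs hw ht'
      have o := ht.nextOK M Λ h hs hw
      rw [ih (hs.next M o (o.link_of_cont hend) ht.2.2) (o.white_of_cont hend) hl']

end Identification

section Operations

variable {V : Type u} {G : SimpleGraph V} {lo hi : V → ℤ} {σ₀ : MixedRep V} {Z : Set ℤ}
  {m : ℤ → ℝ} {PL PR : Set ℤ} {σ σ' : MixedRep V}

/-! ### Collapsing the vertices of a step -/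

theorem MInterval.isWhite_iff {I : MInterval} :
    I.isWhite = true ↔ I.L.red = false ∧ I.R.red = false := by
  simp [MInterval.isWhite]

/-- The vertices of the step `s` have been moved to the zone lines `x` and `y`; the vertex of type d
only under the condition `D`. -/
structure Wrote (σ : MixedRep V) (s : Step V) (x y : ℝ) (D : Prop) (σ' : MixedRep V) : Prop where
  a : σ' s.a = redInterval true x y true
  b : ∀ b, s.b = some b → σ' b = redInterval false x y false
  c : ∀ c, s.c = some c → (σ c).isWhite = true → σ' c = redInterval false x y true
  d : ∀ d, s.d = some d → (σ d).isWhite = true → D → σ' d = redInterval true x y false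
  other : ∀ v, v ≠ s.a → s.b ≠ some v → (s.c = some v → ¬ (σ v).isWhite = true) →
    (s.d = some v → ¬ ((σ v).isWhite = true ∧ D)) → σ' v = σ v

namespace Wrote

variable {s : Step V} {x y : ℝ} {D : Prop}

theorem cases (W : Wrote σ s x y D σ') (v : V) :
    (v = s.a ∧ σ' v = redInterval true x y true) ∨
    (s.b = some v ∧ σ' v = redInterval false x y false) ∨
    (s.c = some v ∧ (σ v).isWhite = true ∧ σ' v = redInterval false x y true) ∨
    (s.d = some v ∧ (σ v).isWhite = true ∧ D ∧ σ' v = redInterval true x y false) ∨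
    σ' v = σ v := by
  by_cases h₁ : v = s.a
  · exact .inl ⟨h₁, h₁ ▸ W.a⟩
  by_cases h₂ : s.b = some v
  · exact .inr (.inl ⟨h₂, W.b v h₂⟩)
  by_cases h₃ : s.c = some v ∧ (σ v).isWhite = true
  · exact .inr (.inr (.inl ⟨h₃.1, h₃.2, W.c v h₃.1 h₃.2⟩))
  by_cases h₄ : s.d = some v ∧ (σ v).isWhite = true ∧ D
  · exact .inr (.inr (.inr (.inl ⟨h₄.1, h₄.2.1, h₄.2.2, W.d v h₄.1 h₄.2.1 h₄.2.2⟩)))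
  · exact .inr (.inr (.inr (.inr (W.other v h₁ h₂ (fun e e' => h₃ ⟨e, e'⟩)
      fun e e' => h₄ ⟨e, e'⟩))))

theorem mirror (W : Wrote σ s x y True σ') : Wrote σ.mirror s.swap (-y) (-x) True σ'.mirror where
  a := by simp only [MixedRep.mirror_apply, Step.swap, W.a, redInterval_mirror]
  b b hb := by
    simp only [Step.swap] at hb
    simp only [MixedRep.mirror_apply, W.b b hb, redInterval_mirror]
  c c hc hw := by
    simp only [Step.swap] at hc
    have : (σ c).isWhite = true := by
      rw [MInterval.isWhite_iff] at hw ⊢; exact ⟨hw.2, hw.1⟩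
    simp only [MixedRep.mirror_apply, W.d c hc this trivial, redInterval_mirror]
  d d hd hw _ := by
    simp only [Step.swap] at hd
    have : (σ d).isWhite = true := by
      rw [MInterval.isWhite_iff] at hw ⊢; exact ⟨hw.2, hw.1⟩
    simp only [MixedRep.mirror_apply, W.c d hd this, redInterval_mirror]
  other v h₁ h₂ h₃ h₄ := by
    have : (σ.mirror v).isWhite = (σ v).isWhite := by
      exact Bool.and_comm _ _
    rw [this] at h₃ h₄
    simp only [MixedRep.mirror_apply]
    rw [W.other v h₁ h₂ (fun e e' => h₄ e ⟨e', trivial⟩) fun e e' => h₃ e e'.1]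

theorem extension (W : Wrote σ s x y D σ') {Z' : Set ℤ} {m' : ℤ → ℝ} (hZ : Z ⊆ Z')
    (hm : ∀ z ∈ Z, m' z = m z) (ha : (σ s.a).L.red = false ∧ (σ s.a).R.red = false)
    (hb : ∀ b, s.b = some b → (σ b).L.red = false ∧ (σ b).R.red = false) :
    Extends Z m σ Z' m' σ' := by
  have key : ∀ v, σ' v = σ v ∨ ((σ v).L.red = false ∧ (σ v).R.red = false ∧
      (σ' v).L.red = true ∧ (σ' v).R.red = true) := by
    intro v
    rcases W.cases v with ⟨rfl, e⟩ | ⟨h, e⟩ | ⟨-, h, e⟩ | ⟨-, h, -, e⟩ | e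
    · exact .inr ⟨ha.1, ha.2, by rw [e]; rfl, by rw [e]; rfl⟩
    · exact .inr ⟨(hb v h).1, (hb v h).2, by rw [e]; rfl, by rw [e]; rfl⟩
    · rw [MInterval.isWhite_iff] at h
      exact .inr ⟨h.1, h.2, by rw [e]; rfl, by rw [e]; rfl⟩
    · rw [MInterval.isWhite_iff] at h
      exact .inr ⟨h.1, h.2, by rw [e]; rfl, by rw [e]; rfl⟩
    · exact .inl e
  refine ⟨hZ, hm, ?_, ?_, ?_, ?_⟩
  all_goals
    intro v hv
    rcases key v with e | ⟨h₁, h₂, h₃, h₄⟩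
    · rw [e]
    · simp_all

theorem lt (W : Wrote σ s x y D σ') (hσ : ∀ v, (σ v).L.pos < (σ v).R.pos) (hxy : x < y) (v : V) :
    (σ' v).L.pos < (σ' v).R.pos := by
  rcases W.cases v with ⟨-, e⟩ | ⟨-, e⟩ | ⟨-, -, e⟩ | ⟨-, -, -, e⟩ | e
  all_goals rw [e]
  · exact hxy
  · exact hxy
  · exact hxy
  · exact hxy
  · exact hσ v

/-- A step touches no nested pair but its own: `A` is dominated by no other vertex, unlike `b`, `c`,
`d`; and since `B` is exactly one clique shorter on each side, `A` would dominate `s.a` if `B` were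
touched. -/
theorem nested (M : Model G lo hi) (W : Wrote σ s x y D σ') (hs : StepOK lo hi s)
    (hsb : ∀ b, lo s.a < lo b → hi b < hi s.a → s.b = some b) {A B : V} (h₁ : lo A < lo B)
    (h₂ : hi B < hi A) :
    (σ' A = σ A ∧ σ' B = σ B) ∨
      (A = s.a ∧ σ' A = redInterval true x y true ∧ σ' B = redInterval false x y false) := by
  obtain ⟨z, hz, -⟩ := hs.link
  by_cases hA : A = s.a
  · subst hA
    exact .inr ⟨rfl, W.a, W.b B (hsb B h₁ h₂)⟩
  left
  have hmax : ∀ v, lo v ≤ lo A → hi A ≤ hi v → v = A := fun v => nested_max M h₁ h₂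
  have e₁ := nested_lo M h₁ h₂
  have e₂ := nested_hi M h₁ h₂
  constructor
  · rcases W.cases A with ⟨e, -⟩ | ⟨h, -⟩ | ⟨h, -⟩ | ⟨h, -⟩ | e
    · exact absurd e hA
    · have := hs.b A h
      exact absurd (hmax s.a (by omega) (by omega)).symm hA
    · have := hs.c A h
      exact absurd (hmax s.a (by omega) (by omega)).symm hA
    · have := hs.d A h
      exact absurd (hmax s.a (by omega) (by omega)).symm hA
    · exact e
  · rcases W.cases B with ⟨e, -⟩ | ⟨h, -⟩ | ⟨h, -⟩ | ⟨h, -⟩ | e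
    · subst e
      exact absurd (hz.max M (v := A) (by omega) (by omega)) hA
    · have := hs.b B h
      exact absurd (hz.max M (v := A) (by omega) (by omega)) hA
    · have := hs.c B h
      exact absurd (hz.max M (v := A) (by omega) (by omega)) hA
    · have := hs.d B h
      exact absurd (hz.max M (v := A) (by omega) (by omega)) hA
    · exact e

end Wrote

/-- A red left endpoint of `y` would be open on the line before `lo a`; that line being full, `X`
would have a closed red right endpoint, against `partR`. A red right endpoint is excluded by `partR`
if closed, and by the white left endpoint if open. -/
theorem SweepInv.white_of_rlink (M : Model G lo hi) (Λ : Layout lo hi σ₀)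
    (h : SweepInv lo hi σ₀ Z m PL PR σ) {w a X y : V} (hw : RLink lo hi w X) (hwa : hi w = lo a)
    (hZ : lo a ∉ Z) (hP : lo a - 1 ∉ PL) (hy : RLink lo hi a y) (hlo : lo y = lo a) :
    (σ y).L.red = false ∧ (σ y).R.red = false := by
  have hL : (σ y).L.red = false := by
    by_contra hc
    rcases h.left y (by simpa using hc) with h' | h'
    · exact hZ (hlo ▸ h'.mem)
    · rcases h'.full with hf | hf
      · exact hP (hlo ▸ hf)
      · have e := hf X (by rw [hw.hi_eq M]; omega)
        have := h.partR w X hw (by rw [e])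
        rw [e] at this
        cases this
  refine ⟨hL, ?_⟩
  by_contra hc
  rcases h.right y (by simpa using hc) with h' | h'
  · exact hc (h.partR a y hy (by rw [h'.eq]))
  · exact h.not_openR_of_white Λ hL h'

/-- What happens at the new zone line at the left ends of the vertices of a step. -/
structure LeftMoved (lo hi : V → ℤ) (σ₀ : MixedRep V) (σ : MixedRep V) (Z : Set ℤ) (m : ℤ → ℝ)
    (PL : Set ℤ) (σ' : MixedRep V) (i : ℤ) : Prop where
  left : ∀ v, (σ v).L.red = false → (σ' v).L.red = true →
    ClosedL lo hi Z m σ' v ∨ OpenL lo hi Z m PL σ' v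
  fullL : ∀ a x, RLink lo hi a x → hi a = i → FullL lo m σ' (hi a)
  linkL : ∀ a x, LLink lo hi a x → lo a = i → (σ' a).L = ⟨m (lo a), true, true⟩
  partL : ∀ a x, LLink lo hi a x → (σ x).L.red = false → (σ' x).L.closed = true →
    (σ' x).L.red = false
  new : (∃ v, lo v = i) ∧ (∃ v, hi v = i) ∧ ∀ v,
    (lo v ≤ i ↔ (σ₀ v).L.pos ≤ m i) ∧ (i ≤ hi v ↔ m i ≤ (σ₀ v).R.pos) ∧
    ((σ' v).L.red = false → (σ₀ v).L.pos ≠ m i) ∧ ((σ' v).R.red = false → (σ₀ v).R.pos ≠ m i)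

/-- The crucial part is `fullL`, the purpose of type d. If a right link leads to this clique, every
vertex starting here except `s.a` is the second vertex of a right link from `s.a`; so it is the
identified `d`, it is white, and it is moved as well. -/
theorem Wrote.leftMoved (M : Model G lo hi) (Λ : Layout lo hi σ₀)
    (h : SweepInv lo hi σ₀ Z m PL PR σ) {s : Step V} {x y : ℝ} {D : Prop}
    (W : Wrote σ s x y D σ') (hs : StepOK lo hi s) (hZ : lo s.a ∉ Z) (hP : lo s.a - 1 ∉ PL)
    (hD : ∀ v, RLink lo hi s.a v → D) (hx : x = (σ₀ s.a).L.pos) {Z' : Set ℤ} {m' : ℤ → ℝ}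
    {PL' : Set ℤ} (hZ' : lo s.a ∈ Z') (hm' : m' (lo s.a) = x) (hPL' : lo s.a ∈ PL') :
    LeftMoved lo hi σ₀ σ Z' m' PL' σ' (lo s.a) where
  left v hv hv' := by
    obtain ⟨z, hz, -⟩ := hs.link
    have hmax : ∀ u, lo u = lo s.a → hi u ≤ hi s.a := fun u hu => by
      by_contra hc
      rw [hz.max M (v := u) (by omega) (by omega)] at hc
      exact hc le_rfl
    rcases W.cases v with ⟨rfl, e⟩ | ⟨h', e⟩ | ⟨h', -, e⟩ | ⟨h', -, -, e⟩ | e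
    · exact .inl ⟨hZ', by rw [e, hm']; rfl, s.a, rfl, hmax, by omega, rfl, rfl⟩
    · have hb := hs.b v h'
      have e' : lo v - 1 = lo s.a := by omega
      exact .inr ⟨by rwa [e'], by rw [e, e', hm']; rfl, .inl (by rwa [e']), s.a, by omega,
        by omega, by rw [e, W.a]; exact ⟨rfl, rfl⟩⟩
    · have hb := hs.c v h'
      have e' : lo v - 1 = lo s.a := by omega
      exact .inr ⟨by rwa [e'], by rw [e, e', hm']; rfl, .inl (by rwa [e']), s.a, by omega,
        by omega, by rw [e, W.a]; exact ⟨rfl, rfl⟩⟩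
    · have hb := hs.d v h'
      exact .inl ⟨by rwa [hb.1], by rw [e, hb.1, hm']; rfl, s.a, hb.1.symm,
        fun u hu => hmax u (by omega), by omega, by rw [e, W.a]; exact ⟨rfl, rfl⟩⟩
    · rw [e, hv] at hv'; cases hv'
  fullL w X hw hwi := by
    obtain ⟨z, hz, -⟩ := hs.link
    intro v hv
    rw [hwi] at hv ⊢
    rw [hm']
    by_cases hva : v = s.a
    · rw [hva, W.a]; rfl
    · have hlt : hi v < hi s.a := by
        by_contra hc
        exact hva (hz.max M (v := v) (by omega) (by omega))
      have hr : RLink lo hi s.a v := RLink.step hw hwi.symm (by omega) hlt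
      obtain ⟨w₁, w₂⟩ := h.white_of_rlink M Λ hw hwi hZ hP hr hv
      rw [W.d v (hs.part v hr hv) (MInterval.isWhite_iff.2 ⟨w₁, w₂⟩) (hD v hr)]
      rfl
  linkL w X hw hwi := by
    obtain ⟨z, hz, -⟩ := hs.link
    have : w = s.a := by
      rcases le_total (hi w) (hi s.a) with hle | hle
      · exact (hw.max M hwi.ge hle).symm
      · exact hz.max M hwi.le hle
    rw [this, W.a, hm']
    rfl
  partL w X hw hX hX' := by
    obtain ⟨z, hz, -⟩ := hs.link
    rcases W.cases X with ⟨rfl, e⟩ | ⟨h', e⟩ | ⟨h', -, e⟩ | ⟨h', -, -, e⟩ | e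
    · exact absurd hz (hw.not_llink M)
    · rw [e] at hX'; cases hX'
    · rw [e] at hX'; cases hX'
    · exact absurd hw ((hs.d X h').2.2.2 w)
    · rw [e, hX]
  new := by
    obtain ⟨z, hz, -⟩ := hs.link
    refine ⟨⟨s.a, rfl⟩, M.exHi _ s.a s.a le_rfl (M.le _), fun v => ?_⟩
    rw [hm', hx]
    refine ⟨?_, Λ.reach s.a v, fun hv e => ?_, fun _ e => Λ.ne s.a v e.symm⟩
    · rw [← not_iff_not, not_le, not_le, Λ.l_lt]
      constructor
      · exact .inl
      · rintro (h' | ⟨h₁, h₂⟩)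
        · exact h'
        · rw [hz.max M (v := v) h₁.ge h₂.le] at h₂
          exact absurd h₂ (lt_irrefl _)
    · rw [Λ.l_inj _ _ e, W.a] at hv
      cases hv

theorem SweepInv.lo_notMem (h : SweepInv lo hi σ₀ Z m PL PR σ) {a x : V} (hl : LLink lo hi a x)
    (ha : (σ a).L.red = false) (hP : lo a ∉ PR) : lo a ∉ Z := fun hz => by
  rw [h.linkL a x hl hz hP] at ha
  cases ha

/-- Both sides are instances of `Wrote.leftMoved`, the right one after reflection. The opposite
blocks of the two new lines stay pending; clearing them is the task of the left and of the right
part. -/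
theorem Wrote.base_inv (M : Model G lo hi) (Λ : Layout lo hi σ₀)
    (h : SweepInv lo hi σ₀ Z m ∅ ∅ σ) {s : Step V} (hs : StepOK lo hi s)
    (hs' : StepOK (fun v => -hi v) (fun v => -lo v) s.swap) {b : V} (hb : s.b = some b)
    (hw : (σ s.a).L.red = false ∧ (σ s.a).R.red = false ∧ (σ b).L.red = false ∧
      (σ b).R.red = false)
    (W : Wrote σ s (σ s.a).L.pos (σ s.a).R.pos True σ') :
    ∃ m', SweepInv lo hi σ₀ (insert (lo s.a) (insert (hi s.a) Z)) m' {lo s.a} {hi s.a} σ' ∧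
      Extends Z m σ (insert (lo s.a) (insert (hi s.a) Z)) m' σ' ∧
      lo s.a ∉ Z ∧ hi s.a ∉ Z ∧ m' (lo s.a) = (σ s.a).L.pos ∧ m' (hi s.a) = (σ s.a).R.pos := by
  have hlt := hs.lo_lt_hi M
  have hbc := hs.b b hb
  have lb := M.le b
  obtain ⟨w₁, w₂, w₃, w₄⟩ := hw
  have hll : LLink lo hi s.a b := .base (by omega) (by omega)
  have hrl : RLink lo hi s.a b := RLink.base (by omega) (by omega)
  have hi₀ : lo s.a ∉ Z := h.lo_notMem hll w₁ (by simp)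
  have hj₀ : hi s.a ∉ Z := by
    have := h.mirror.lo_notMem hrl w₂ (by simp)
    simpa using this
  have ex : (σ s.a).L.pos = (σ₀ s.a).L.pos := by rw [h.whiteL _ w₁]
  have ey : (σ s.a).R.pos = (σ₀ s.a).R.pos := by rw [h.whiteR _ w₂]
  set x := (σ s.a).L.pos
  set y := (σ s.a).R.pos
  have hxy : x < y := h.lt s.a
  set Z' : Set ℤ := insert (lo s.a) (insert (hi s.a) Z) with hZ'
  let m' : ℤ → ℝ := fun z => if z = lo s.a then x else if z = hi s.a then y else m z
  have m₁ : m' (lo s.a) = x := if_pos rfl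
  have m₂ : m' (hi s.a) = y := by simp [m', hlt.ne']
  have m₃ : ∀ z ∈ Z, m' z = m z := fun z hz => by
    have h₁ : z ≠ lo s.a := by rintro rfl; exact hi₀ hz
    have h₂ : z ≠ hi s.a := by rintro rfl; exact hj₀ hz
    simp [m', h₁, h₂]
  have hsb : ∀ b', lo s.a < lo b' → hi b' < hi s.a → s.b = some b' := fun b' h₁ h₂ => by
    rw [M.inj b' b (by rw [nested_lo M h₁ h₂, hbc.1]) (by rw [nested_hi M h₁ h₂, hbc.2])]
    exact hb
  have E : Extends Z m σ Z' m' σ' := W.extension (fun z hz => .inr (.inr hz)) m₃ ⟨w₁, w₂⟩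
    fun b' hb' => by rw [hb] at hb'; cases hb'; exact ⟨w₃, w₄⟩
  have A := W.leftMoved M Λ h hs hi₀ (by simp) (fun _ _ => trivial) ex (Z' := Z') (m' := m')
    (PL' := {lo s.a}) (.inl rfl) m₁ rfl
  have B := W.mirror.leftMoved M.mirror Λ.mirror h.mirror hs' (by simpa [Step.swap] using hj₀)
    (by simp) (fun _ _ => trivial) (by simp [ey, Step.swap, MixedRep.mirror_apply]) (Z' := negSet Z')
    (m' := negPos m') (PL' := negSet {hi s.a}) (by simp [Step.swap, hZ'])
    (by simp [negPos, Step.swap, m₂]) (by simp [Step.swap])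
  refine ⟨m', h.extend Λ E A.left ?_ (by simp) (by simp) ?_ ?_ ?_ ?_ ?_ ?_ A.partL ?_
    (W.lt h.lt hxy), E, hi₀, hj₀, m₁, m₂⟩
  · intro v hv hv'
    have := B.left v hv hv'
    rwa [closedL_mirror, openL_mirror] at this
  · rintro z (rfl | rfl | hz) hz'
    · exact A.new
    · obtain ⟨⟨u, hu⟩, ⟨v, hv⟩, hn⟩ := B.new
      simp only [Step.swap] at hu hv hn
      refine ⟨⟨v, by omega⟩, ⟨u, by omega⟩, fun v => ?_⟩
      obtain ⟨n₁, n₂, n₃, n₄⟩ := hn v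
      simp only [MixedRep.mirror_apply, MInterval.mirror_L_pos, MInterval.mirror_R_pos, negPos,
        neg_neg, neg_le_neg_iff, MInterval.mirror_L_red, MInterval.mirror_R_red, ne_eq,
        neg_inj] at n₁ n₂ n₃ n₄
      exact ⟨n₂, n₁, n₄, n₃⟩
    · exact absurd hz hz'
  · intro a z hl hz hp hz'
    simp only [Set.mem_empty_iff_false, or_false] at hz'
    rcases hz with hz | hz | hz
    · exact absurd hz hp
    · have := B.fullL a z (llink_neg_neg.2 hl) (by simp [Step.swap, hz])
      rwa [fullL_mirror] at this
    · exact absurd hz hz'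
  · intro a z hl hz hp hz'
    simp only [Set.mem_empty_iff_false, or_false] at hz'
    rcases hz with hz | hz | hz
    · rw [hz]
      have := A.fullL a z hl hz
      rwa [hz] at this
    · exact absurd hz hp
    · exact absurd hz hz'
  · intro a z hl hz hp hz'
    simp only [Set.mem_empty_iff_false, or_false] at hz'
    rcases hz with hz | hz | hz
    · exact A.linkL a z hl hz
    · exact absurd hz hp
    · exact absurd hz hz'
  · intro a z hl hz hp hz'
    simp only [Set.mem_empty_iff_false, or_false] at hz'
    rcases hz with hz | hz | hz
    · exact absurd hz hp
    · have := B.linkL a z hl (by simp [Step.swap, hz])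
      simpa only [negPos, MixedRep.mirror_apply, MInterval.mirror_L, neg_neg,
        Endpoint.neg_eq] using this
    · exact absurd hz hz'
  · intro a b h₁ h₂ v₁ v₂ v₃ v₄
    rcases W.nested M hs hsb h₁ h₂ with ⟨e₁, e₂⟩ | ⟨rfl, e₁, e₂⟩
    · left; rw [e₁, e₂]; exact ⟨v₁, v₂, v₃, v₄⟩
    · right
      refine ⟨.inl rfl, .inr (.inl rfl), ?_, ?_⟩
      · rw [m₁, m₂, e₁]
      · rw [m₁, m₂, e₂]
  · intro a z hl hz hz'
    exact B.partL a z hl hz hz'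

/-- The pending clique moves from `lo s.a` to `lo t.a`: the right block of the old one consists of
`t.a` and `t.c`, which are both put on its line. -/
theorem Wrote.step_inv (M : Model G lo hi) (Λ : Layout lo hi σ₀) {s t : Step V}
    (h : SweepInv lo hi σ₀ Z m {lo s.a} PR σ) (hj : lo s.a ∈ Z) (hj₂ : hi s.a ∈ Z)
    (hPR : ∀ z ∈ PR, lo s.a < z) (hsa : σ s.a = redInterval true (m (lo s.a)) (m (hi s.a)) true)
    (hs : StepOK lo hi s) (hn : NextOK lo hi σ s t) (ht : StepOK lo hi t)
    (hw : (σ t.a).L.red = false)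
    (hd : Picks (fun v => closedNbhd G v = closedNbhd G t.a \ {x | x = s.a ∨ s.d = some x}) t.d)
    (W : Wrote σ t (σ t.a).L.pos (m (lo s.a))
      (s.d.all (fun w => (σ w).isClosedOpen (m (lo s.a)) (m (hi s.a))) = true) σ') :
    ∃ m', SweepInv lo hi σ₀ (insert (lo t.a) Z) m' {lo t.a} PR σ' ∧
      Extends Z m σ (insert (lo t.a) Z) m' σ' ∧ lo t.a ∉ Z ∧ m' (lo t.a) = (σ t.a).L.pos := by
  have hia := hn.hi_a
  have hlt := ht.lo_lt_hi M
  obtain ⟨X, hX, -⟩ := hs.link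
  obtain ⟨Y, hY, -⟩ := ht.link
  have hjPR : lo s.a ∉ PR := fun h' => lt_irrefl _ (hPR _ h')
  have hiPR : lo t.a ∉ PR := fun h' => by have := hPR _ h'; omega
  have hi₀ : lo t.a ∉ Z := h.lo_notMem hY hw hiPR
  have ex : (σ t.a).L.pos = (σ₀ t.a).L.pos := by rw [h.whiteL _ hw]
  set x := (σ t.a).L.pos
  set y := m (lo s.a) with hy
  have hxy : x < y := by
    have h₃ := (h.posL _ hj t.a).1 (by omega)
    have h₄ := h.neL _ hj t.a hw
    rw [ex]
    exact lt_of_le_of_ne h₃ h₄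
  let m' : ℤ → ℝ := Function.update m (lo t.a) x
  have m₁ : m' (lo t.a) = x := by simp [m']
  have m₃ : ∀ z ∈ Z, m' z = m z := fun z hz => by
    have h₁ : z ≠ lo t.a := by rintro rfl; exact hi₀ hz
    simp [m', h₁]
  have mj : m' (lo s.a) = y := m₃ _ hj
  have hwb : ∀ b, t.b = some b → (σ b).L.red = false ∧ (σ b).R.red = false := fun b hb =>
    ⟨(hn.b b hb).2.2.2.1, (hn.b b hb).2.2.2.2⟩
  have E : Extends Z m σ (insert (lo t.a) Z) m' σ' :=
    W.extension (fun z hz => .inr hz) m₃ ⟨hw, hn.whiteR⟩ hwb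
  have hfull : ∀ v, RLink lo hi t.a v → FullL lo m σ (lo s.a) := fun v hr => by
    have := h.fullL t.a v hr (by rwa [hia]) (by rwa [hia])
    rwa [hia] at this
  -- If a right link starts with `t.a`, the previous line is full on the left. So `s.d` has the ends
  -- of `s.a`, and it is open on the right because it ends one clique earlier; this is the side
  -- condition on `d_{k-1}`.
  have hD : ∀ v, RLink lo hi t.a v →
      (s.d.all (fun w => (σ w).isClosedOpen (m (lo s.a)) (m (hi s.a))) = true) := by
    intro v hr
    have hf := hfull v hr
    cases hsd : s.d with
    | none => rfl
    | some d =>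
      obtain ⟨d₁, d₂, -, -⟩ := hs.d d hsd
      have eL := hf d d₁
      rcases h.left d (by rw [eL]) with h' | h'
      · obtain ⟨a', a₁, a₂, a₃, a₄⟩ := h'.same
        have : a' = s.a := hX.max M (by omega) (a₂ s.a d₁.symm)
        subst this
        have eR : (σ d).R.pos = m (hi s.a) := by rw [a₄.2, hsa]; rfl
        have eC : (σ d).R.closed = false := by
          rcases h.right d (h.redR_of_pos hj₂ eR) with h'' | h''
          · have := h.pos_inj h''.mem hj₂ (by rw [← eR, h''.eq])
            omega
          · rw [h''.eq]
        simp [MInterval.isClosedOpen, eL, eR, eC]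
      · rw [h'.eq] at eL; simp at eL
  have A := W.leftMoved M Λ h ht hi₀ (by simp; omega) hD ex (Z' := insert (lo t.a) Z) (m' := m')
    (PL' := {lo t.a}) (.inl rfl) m₁ rfl
  have hfR : FullR hi m' σ' (lo s.a) := fun v hv => by
    rcases hn.block v hv with rfl | hc
    · rw [W.a, mj]; rfl
    · rw [W.c v hc (MInterval.isWhite_iff.2 (hn.c v hc).2.2.2), mj]; rfl
  refine ⟨m', h.extend Λ E A.left ?_ ?_ (fun z hz => .inl hz) ?_ ?_ ?_ ?_ ?_ ?_ A.partL ?_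
    (W.lt h.lt hxy), E, hi₀, m₁⟩
  · intro v hv hv'
    rcases W.cases v with ⟨rfl, e⟩ | ⟨h', e⟩ | ⟨h', -, e⟩ | ⟨h', -, hd', e⟩ | e
    · exact .inl ⟨by rw [hia]; exact .inr hj, by rw [e, hia, mj]; rfl, t.a, rfl,
        fun u hu => hn.min u (by omega), by omega, rfl, rfl⟩
    -- With `b` nested in it, `t.a` starts a right link; thus the line on which `b` becomes open is
    -- full.
    · have hb := ht.b v h'
      have lv := M.le v
      have e' : hi v + 1 = lo s.a := by omega
      refine .inr ⟨by rw [e']; exact .inr hj, by rw [e, e', mj]; rfl, .inr ?_, t.a, by omega,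
        by omega, by rw [e, W.a]; exact ⟨rfl, rfl⟩⟩
      rw [e']
      exact E.fullL hj (hfull v (RLink.base (by omega) (by omega)))
    · have hc := ht.c v h'
      exact .inl ⟨by rw [hc.2, hia]; exact .inr hj, by rw [e, hc.2, hia, mj]; rfl, t.a, hc.2.symm,
        fun u hu => hn.min u (by omega), by omega, by rw [e, W.a]; exact ⟨rfl, rfl⟩⟩
    · have hdv := ht.d v h'
      have e' : hi v + 1 = lo s.a := by omega
      refine .inr ⟨by rw [e']; exact .inr hj, by rw [e, e', mj]; rfl, .inr ?_, t.a, by omega,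
        by omega, by rw [e, W.a]; exact ⟨rfl, rfl⟩⟩
      rw [e']
      -- By the neighbourhood test only `s.a` and `s.d` start in this clique, and the side condition
      -- says that `s.d` is on the line. This is why the condition is imposed.
      refine E.fullL hj fun w hw' => ?_
      rw [h'] at hd
      rcases ((hs.trim_iff M hia v).1 hd).2.2 w (by omega) with rfl | hwd
      · rw [hsa]; rfl
      · rw [hwd] at hd'
        simp only [Option.all_some, MInterval.isClosedOpen, Bool.and_eq_true,
          decide_eq_true_eq] at hd'
        obtain ⟨⟨⟨d₁, d₂⟩, d₃⟩, d₄⟩ := hd'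
        have d₅ := h.redL_of_pos hj d₁
        cases hσ : (σ w).L
        rw [hσ] at d₁ d₃ d₅
        simp_all
    · rw [e, hv] at hv'; cases hv'
  · rintro z rfl
    exact .inr hfR
  · rintro z (rfl | hz) hz'
    · exact A.new
    · exact absurd hz hz'
  · intro a z hl hz hp hz'
    rcases hz with hz | hz
    · exact absurd hz hp
    · rcases hz' with hz' | hz'
      · exact absurd hz hz'
      · rw [Set.mem_singleton_iff] at hz'
        rw [hz']
        exact hfR
  · intro a z hl hz hp hz'
    rcases hz with hz | hz
    · exact A.fullL a z hl hz
    · rcases hz' with hz' | hz'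
      · exact absurd hz hz'
      · exact absurd hz' hp
  · intro a z hl hz hp hz'
    rcases hz with hz | hz
    · exact A.linkL a z hl hz
    · rcases hz' with hz' | hz'
      · exact absurd hz hz'
      · exact absurd hz' hp
  · intro a z hl hz hp hz'
    rcases hz with hz | hz
    · exact absurd hz hp
    · rcases hz' with hz' | hz'
      · exact absurd hz hz'
      · rw [Set.mem_singleton_iff] at hz'
        have : t.a = a := hl.max M (hn.min a hz') (by omega)
        subst this
        rw [W.a, hz', mj]
        rfl
  · intro a b h₁ h₂ v₁ v₂ v₃ v₄
    rcases W.nested M ht (fun b' k₁ k₂ => hn.nested b' k₁ k₂ hw) h₁ h₂ with ⟨e₁, e₂⟩ | ⟨rfl, e₁, e₂⟩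
    · left; rw [e₁, e₂]; exact ⟨v₁, v₂, v₃, v₄⟩
    · right
      refine ⟨.inl rfl, by rw [hia]; exact .inr hj, ?_, ?_⟩
      · rw [m₁, hia, mj, e₁]
      · rw [m₁, hia, mj, e₂]
  · intro a z hl hz hz'
    have hhi := hl.hi_eq M
    rcases W.cases z with ⟨rfl, e⟩ | ⟨h', e⟩ | ⟨h', -, e⟩ | ⟨h', -, -, e⟩ | e
    -- The first vertex of such a right link would end in the clique `lo s.a + 1`, colliding with
    -- the left link from `s.a`.
    · exact (hX.no_conflict M hl (by omega)).elim
    · rw [e] at hz'; cases hz'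
    · have := ht.c z h'
      exact (hX.no_conflict M hl (by omega)).elim
    · rw [e] at hz'; cases hz'
    · rw [e, hz]

/-- The operations of the last step of the left part. -/
structure WroteLast (σ : MixedRep V) (t : Step V) (y : ℝ) (σ' : MixedRep V) : Prop where
  a : σ' t.a = ⟨⟨(σ t.a).L.pos, true, (σ t.a).L.red⟩, ⟨y, true, true⟩⟩
  c : ∀ c, t.c = some c → σ' c = redInterval false (σ t.a).L.pos y true
  other : ∀ v, v ≠ t.a → t.c ≠ some v → σ' v = σ v

theorem WroteLast.cases {t : Step V} {y : ℝ} (W : WroteLast σ t y σ') (v : V) :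
    (v = t.a ∧ σ' v = ⟨⟨(σ v).L.pos, true, (σ v).L.red⟩, ⟨y, true, true⟩⟩) ∨
    (t.c = some v ∧ σ' v = redInterval false (σ t.a).L.pos y true) ∨ σ' v = σ v := by
  by_cases h₁ : v = t.a
  · exact .inl ⟨h₁, h₁ ▸ W.a⟩
  by_cases h₂ : t.c = some v
  · exact .inr (.inl ⟨h₂, W.c v h₂⟩)
  · exact .inr (.inr (W.other v h₁ h₂))

/-- No line is added and the pending clique is cleared. The vertex `c` of a merging step becomes
open on an old line; that line is full, since `t.a` and `c` form a left link there and it is not the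
pending one. -/
theorem WroteLast.last_inv (M : Model G lo hi) (Λ : Layout lo hi σ₀) {s t : Step V} {PL : Set ℤ}
    (h : SweepInv lo hi σ₀ Z m PL PR σ) (hPL : PL = {lo s.a}) (hj : lo s.a ∈ Z)
    (hs : StepOK lo hi s) (hn : NextOK lo hi σ s t) (hend : t.Terminal ∨ t.Merging σ) (W : WroteLast σ t (m (lo s.a)) σ') :
    SweepInv lo hi σ₀ Z m ∅ PR σ' ∧ Extends Z m σ Z m σ' ∧
      (t.Merging σ → lo t.a ∈ Z ∧ (σ t.a).L.pos = m (lo t.a)) := by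
  have hia := hn.hi_a
  have hslt := hs.lo_lt_hi M
  have lta := M.le t.a
  obtain ⟨X, hX, -⟩ := hs.link
  set y := m (lo s.a) with hy
  have hcl : (σ t.a).L.closed = true ∧ ((σ t.a).L.red = true → lo t.a ∈ Z ∧
      (σ t.a).L.pos = m (lo t.a) ∧ lo t.a < lo s.a) := by
    rcases hr : (σ t.a).L.red with _ | _
    · refine ⟨?_, by simp⟩
      rw [h.whiteL _ hr]
      exact Λ.closed t.a .left
    · rcases h.left _ hr with h' | h'
      · refine ⟨by rw [h'.eq], fun _ => ⟨h'.mem, by rw [h'.eq], ?_⟩⟩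
        -- If `t.a` occupied only the clique `lo s.a`, its red left endpoint would give it the ends
        -- of `s.a`, and its right endpoint would be red too.
        by_contra hc
        obtain ⟨a', a₁, a₂, a₃, a₄⟩ := h'.same
        have : a' = s.a := hX.max M (by omega) (a₂ s.a (by omega))
        subst this
        have := (h.red_of_sameEnds Λ (by rintro e; rw [e] at hia; omega) a₄).2.2.1
        rw [hn.whiteR] at this
        cases this
      · exact absurd h' (h.not_openL_of_white Λ hn.whiteR)
  have hxy : (σ t.a).L.pos < y := by
    rcases hr : (σ t.a).L.red with _ | _
    · have h₃ := (h.posL _ hj t.a).1 (by omega)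
      have h₄ := h.neL _ hj t.a hr
      rw [h.whiteL _ hr]
      exact lt_of_le_of_ne h₃ h₄
    · obtain ⟨h₁, h₂, h₃⟩ := hcl.2 hr
      rw [h₂]
      exact h.pos_lt h₁ hj h₃
  have hmerge : ∀ c, t.c = some c → (σ t.a).L.red = true := fun c hc => by
    rcases hend with hend | hend
    · rw [hend.2] at hc; cases hc
    · exact hend.2
  have hcases : ∀ v, (v = t.a ∧ σ' v = ⟨(σ v).L, ⟨y, true, true⟩⟩) ∨
      (t.c = some v ∧ σ' v = redInterval false (σ t.a).L.pos y true) ∨ σ' v = σ v := by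
    intro v
    rcases W.cases v with ⟨rfl, e⟩ | h' | h'
    · refine .inl ⟨rfl, ?_⟩
      rw [e, ← hcl.1]
    · exact .inr (.inl h')
    · exact .inr (.inr h')
  have key : ∀ v, ((σ' v).L = (σ v).L ∨ ((σ v).L.red = false ∧ (σ' v).L.red = true)) ∧
      ((σ' v).R = (σ v).R ∨ ((σ v).R.red = false ∧ (σ' v).R.red = true)) := by
    intro v
    rcases hcases v with ⟨rfl, e⟩ | ⟨h', e⟩ | e
    · exact ⟨.inl (by rw [e]), .inr ⟨hn.whiteR, by rw [e]⟩⟩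
    · have := (hn.c v h').2.2.2
      exact ⟨.inr ⟨this.1, by rw [e]; rfl⟩, .inr ⟨this.2, by rw [e]; rfl⟩⟩
    · exact ⟨.inl (by rw [e]), .inl (by rw [e])⟩
  have E : Extends Z m σ Z m σ' := by
    refine ⟨subset_rfl, fun _ _ => rfl, ?_, ?_, ?_, ?_⟩
    all_goals
      intro v hv
      obtain ⟨k₁, k₂⟩ := key v
      first
      | (rcases k₁ with k | ⟨k, k'⟩
         · exact k
         · simp_all)
      | (rcases k₂ with k | ⟨k, k'⟩
         · exact k
         · simp_all)
  have hfR : FullR hi m σ' (lo s.a) := fun v hv => by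
    rcases hn.block v hv with rfl | hc
    · rw [W.a]
    · rw [W.c v hc]; rfl
  have hsame : ∀ c, t.c = some c → (σ' c).SameEnds (σ' t.a) := fun c hc => by
    rw [W.c c hc, W.a]; exact ⟨rfl, rfl⟩
  refine ⟨h.extend Λ E ?_ ?_ ?_ (fun z hz => .inl hz) (fun z hz hz' => absurd hz hz')
    ?_ (fun a z hl hz hp hz' => ?_) (fun a z hl hz hp hz' => ?_) ?_ ?_ ?_ ?_ ?_, E,
    fun hm => ⟨(hcl.2 hm.2).1, (hcl.2 hm.2).2.1⟩⟩
  · intro v hv hv'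
    rcases hcases v with ⟨rfl, e⟩ | ⟨h', e⟩ | e
    · rw [e] at hv'; simp only at hv'; rw [hv] at hv'; cases hv'
    · obtain ⟨c₁, c₂, c₃, -⟩ := hn.c v h'
      obtain ⟨k₁, k₂, k₃⟩ := hcl.2 (hmerge v h')
      have e' : lo v - 1 = lo t.a := by omega
      refine .inr ⟨by rwa [e'], by rw [e, e', ← k₂]; rfl, .inr ?_, t.a, by omega, by omega,
        hsame v h'⟩
      rw [e']
      refine E.fullR k₁ (h.fullR t.a v c₃ k₁ ?_)
      rw [hPL, Set.mem_singleton_iff]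
      omega
    · rw [e, hv] at hv'; cases hv'
  · intro v hv hv'
    rcases hcases v with ⟨rfl, e⟩ | ⟨h', e⟩ | e
    · exact .inl ⟨by rwa [hia], by rw [e, hia], t.a, rfl,
        fun u hu => hn.min u (by omega), by omega, rfl, rfl⟩
    · have hc := hn.c v h'
      exact .inl ⟨by rwa [hc.2.1, hia], by rw [e, hc.2.1, hia]; rfl, t.a, hc.2.1.symm,
        fun u hu => hn.min u (by omega), by omega, hsame v h'⟩
    · rw [e, hv] at hv'; cases hv'
  · intro z hz
    rw [hPL, Set.mem_singleton_iff] at hz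
    exact .inr (hz ▸ hfR)
  · intro a z hl hz hp hz'
    rcases hz' with hz' | hz'
    · exact absurd hz hz'
    · rw [hPL, Set.mem_singleton_iff] at hz'
      rw [hz']
      exact hfR
  · rcases hz' with hz' | hz'
    · exact absurd hz hz'
    · exact absurd hz' hp
  · rcases hz' with hz' | hz'
    · exact absurd hz hz'
    · exact absurd hz' hp
  · intro a z hl hz hp hz'
    rcases hz' with hz' | hz'
    · exact absurd hz hz'
    · rw [hPL, Set.mem_singleton_iff] at hz'
      have : t.a = a := hl.max M (hn.min a hz') (by omega)
      subst this
      rw [W.a, hz']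
  -- No white nested pair is touched: a terminal `a` has no nested vertex, a merging one is red on
  -- the left, `c` is dominated by `a`, and `not_covered` forbids nesting a vertex of this right
  -- block in another vertex.
  · intro A B h₁ h₂ v₁ v₂ v₃ v₄
    left
    have eA : σ' A = σ A := by
      rcases hcases A with ⟨rfl, e⟩ | ⟨h', e⟩ | e
      · rcases hend with hend | hend
        · have := hn.nested B h₁ h₂ v₁
          rw [hend.1] at this
          cases this
        · have := hend.2
          rw [v₁] at this
          cases this
      · obtain ⟨c₁, c₂, c₃, -⟩ := hn.c A h'
        rw [← nested_max M h₁ h₂ (v := t.a) (by omega) (by omega)] at c₁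
        omega
      · exact e
    have eB : σ' B = σ B := by
      rcases hcases B with ⟨rfl, e⟩ | ⟨h', e⟩ | e
      · exact (hX.not_covered M hia h₁ (by omega)).elim
      · have := (hn.c B h').2.1
        exact (hX.not_covered M (c := B) (by omega) h₁ (by omega)).elim
      · exact e
    rw [eA, eB]
    exact ⟨v₁, v₂, v₃, v₄⟩
  · intro a z hl hz hz'
    rcases hcases z with ⟨rfl, e⟩ | ⟨h', e⟩ | e
    · rw [e, ← hz]
    · rw [e] at hz'; cases hz'
    · rw [e, hz]
  · intro a z hl hz hz'
    have hhi := hl.hi_eq M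
    rcases hcases z with ⟨rfl, e⟩ | ⟨h', e⟩ | e
    · exact (hX.no_conflict M hl (by omega)).elim
    · have := hn.c z h'
      exact (hX.no_conflict M hl (by omega)).elim
    · rw [e, hz]
  · intro v
    rcases hcases v with ⟨rfl, e⟩ | ⟨h', e⟩ | e
    · rw [e]; exact hxy
    · rw [e]; exact hxy
    · rw [e]; exact h.lt v

end Operations

section Execution

variable {V : Type u} {G : SimpleGraph V} {lo hi : V → ℤ} {σ₀ : MixedRep V} {Z : Set ℤ}
  {m : ℤ → ℝ} {PL PR : Set ℤ} {σ σ' : MixedRep V}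

/-! ### Carrying out one part of a sweep -/

section Roles

theorem mem_roles {s : Step V} {v : V} :
    v ∈ s.roles ↔ v = s.a ∨ s.b = some v ∨ s.c = some v ∨ s.d = some v := by
  simp [Step.roles]

theorem roles_nodup {s : Step V} (hb : ∀ b, s.b = some b → lo b = lo s.a + 1 ∧ hi b = hi s.a - 1)
    (hc : ∀ c, s.c = some c → lo c = lo s.a + 1 ∧ hi c = hi s.a)
    (hd : ∀ d, s.d = some d → lo d = lo s.a ∧ hi d = hi s.a - 1) : s.roles.Nodup := by
  have hbc : ∀ v, s.b = some v → s.c = some v → False := fun v h₁ h₂ => by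
    have := hb v h₁; have := hc v h₂; omega
  have hbd : ∀ v, s.b = some v → s.d = some v → False := fun v h₁ h₂ => by
    have := hb v h₁; have := hd v h₂; omega
  have hcd : ∀ v, s.c = some v → s.d = some v → False := fun v h₁ h₂ => by
    have := hc v h₁; have := hd v h₂; omega
  have hab : s.b ≠ some s.a := fun h => by have := hb _ h; omega
  have hac : s.c ≠ some s.a := fun h => by have := hc _ h; omega
  have had : s.d ≠ some s.a := fun h => by have := hd _ h; omega
  have ht : ∀ o : Option V, o.toList.Nodup := fun o => by cases o <;> simp
  rw [Step.roles, List.nodup_cons, List.nodup_append, List.nodup_append]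
  refine ⟨by simp [hab, hac, had], ⟨ht _, ht _, ?_⟩, ht _, ?_⟩
  · intro v hv w hw e
    simp only [Option.mem_toList] at hv hw
    exact hbc v hv (e ▸ hw)
  · intro v hv w hw e
    simp only [List.mem_append, Option.mem_toList] at hv hw
    rcases hv with hv | hv
    · exact hbd v hv (e ▸ hw)
    · exact hcd v hv (e ▸ hw)

theorem StepOK.roles_nodup {s : Step V} (hs : StepOK lo hi s) : s.roles.Nodup :=
  _root_.roles_nodup hs.b hs.c fun d hd => ⟨(hs.d d hd).1, (hs.d d hd).2.1⟩

theorem StepOK.lt_hi (M : Model G lo hi) {s : Step V} (hs : StepOK lo hi s) {v : V}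
    (hv : v ∈ s.roles) : lo s.a < hi v ∧ hi v ≤ hi s.a := by
  have hlt := hs.lo_lt_hi M
  have lv := M.le v
  rcases mem_roles.1 hv with rfl | h | h | h
  · exact ⟨hlt, le_rfl⟩
  · have := hs.b v h; omega
  · have := hs.c v h; omega
  · have := hs.d v h; omega

theorem NextOK.congr {s t : Step V} (h : NextOK lo hi σ s t)
    (hσ : ∀ v, hi v ≤ lo s.a → σ' v = σ v) : NextOK lo hi σ' s t := by
  have hia := h.hi_a
  have ea := hσ t.a hia.le
  refine ⟨hia, h.block, h.min, fun c hc => ?_, fun b hb => ?_, ?_, by rw [ea]; exact h.whiteR⟩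
  · have := h.c c hc
    rw [hσ c (by omega)]
    exact this
  · have := h.b b hb
    rw [hσ b (by omega), ea]
    exact this
  · rw [ea]; exact h.nested

theorem NextOK.last_roles_le {s t : Step V} (h : NextOK lo hi σ s t) {v : V}
    (hv : v ∈ Step.roles { t with d := none }) : hi v ≤ lo s.a := by
  have hia := h.hi_a
  rcases mem_roles.1 hv with rfl | h' | h' | h'
  · exact hia.le
  · have := h.b v h'; omega
  · have := h.c v h'; omega
  · cases h'

end Roles

theorem LeftSteps.ne_nil {s : Step V} {l : List (Step V)} (h : LeftSteps G σ s l) : l ≠ [] := by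
  cases h <;> simp

section Static

variable (M : Model G lo hi) (Λ : Layout lo hi σ₀) (h : SweepInv lo hi σ₀ Z m ∅ ∅ σ)

include M Λ h

theorem LeftSteps.roles_le {s : Step V} {l : List (Step V)} (hl : LeftSteps G σ s l)
    (hs : StepOK lo hi s) (hw : (σ s.a).L.red = false) :
    ∀ t ∈ l, ∀ v ∈ t.roles, hi v ≤ lo s.a := by
  induction hl with
  | @finish s t ht hend =>
    have o := ht.nextOK M Λ h hs hw
    intro t' ht' v hv
    rw [List.mem_singleton] at ht'
    subst ht'
    exact o.last_roles_le hv
  | @cont s t l ht hend hl ih =>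
    have o := ht.nextOK M Λ h hs hw
    have hs' := hs.next M o (o.link_of_cont hend) ht.2.2
    have hlt := hs'.lo_lt_hi M
    have hia := o.hi_a
    intro t' ht' v hv
    rcases List.mem_cons.1 ht' with rfl | ht'
    · have := hs'.lt_hi M hv; omega
    · have := ih hs' (o.white_of_cont hend) t' ht' v hv; omega

/-- The vertices of one step end after the first clique of its type-a vertex, those of all later
steps in or before it. -/
theorem LeftSteps.nodup {s : Step V} {l : List (Step V)} (hl : LeftSteps G σ s l)
    (hs : StepOK lo hi s) (hw : (σ s.a).L.red = false) : (l.flatMap Step.roles).Nodup := by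
  induction hl with
  | @finish s t ht hend =>
    have o := ht.nextOK M Λ h hs hw
    rw [List.flatMap_singleton]
    exact roles_nodup (fun b hb => ⟨(o.b b hb).1, (o.b b hb).2.1⟩)
      (fun c hc => ⟨(o.c c hc).1, (o.c c hc).2.1⟩) (fun d hd => by cases hd)
  | @cont s t l ht hend hl ih =>
    have o := ht.nextOK M Λ h hs hw
    have hs' := hs.next M o (o.link_of_cont hend) ht.2.2
    have hw' := o.white_of_cont hend
    rw [List.flatMap_cons, List.nodup_append]
    refine ⟨hs'.roles_nodup, ih hs' hw', fun v hv w hw e => ?_⟩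
    subst e
    obtain ⟨t', ht', hv'⟩ := List.mem_flatMap.1 hw
    have := hl.roles_le M Λ h hs' hw' t' ht' v hv'
    have := hs'.lt_hi M hv
    omega

theorem LeftSteps.lt {s : Step V} {l : List (Step V)} (hl : LeftSteps G σ s l)
    (hs : StepOK lo hi s) (hw : (σ s.a).L.red = false) :
    ∀ t ∈ l, ∀ c, t.c = some c → (σ t.a).L.pos < (σ c).L.pos := by
  have key : ∀ {s t : Step V}, NextOK lo hi σ s t → ∀ c, t.c = some c →
      (σ t.a).L.pos < (σ c).L.pos := by
    intro s t o c hc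
    obtain ⟨c₁, c₂, c₃, c₄, -⟩ := o.c c hc
    rw [h.whiteL c c₄]
    rcases hr : (σ t.a).L.red with _ | _
    · rw [h.whiteL _ hr, Λ.l_lt]
      exact .inl (by omega)
    · rcases h.left _ hr with h' | h'
      · rw [h'.eq]
        have := (not_congr (h.posL _ h'.mem c)).1 (by omega)
        exact not_le.1 this
      · exact absurd h' (h.not_openL_of_white Λ o.whiteR)
  induction hl with
  | @finish s t ht hend =>
    have o := ht.nextOK M Λ h hs hw
    intro t' ht' c hc
    rw [List.mem_singleton] at ht'
    subst ht'
    exact key o c hc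
  | @cont s t l ht hend hl ih =>
    have o := ht.nextOK M Λ h hs hw
    have hs' := hs.next M o (o.link_of_cont hend) ht.2.2
    intro t' ht' c hc
    rcases List.mem_cons.1 ht' with rfl | ht'
    · exact key o c hc
    · exact ih hs' (o.white_of_cont hend) t' ht' c hc

end Static

/-! ### The executed operations write the intended intervals -/

section Exec

variable [DecidableEq V]

theorem setIv_apply (o : Option V) (I : MInterval) (v : V) :
    setIv σ o I v = if o = some v then I else σ v := by
  cases o with
  | none => simp [setIv]
  | some w => simp [setIv, Function.update_apply, eq_comm]

theorem setIfWhite_apply (o : Option V) (I : MInterval) (v : V) :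
    setIfWhite σ o I v = if o = some v ∧ (σ v).isWhite = true then I else σ v := by
  cases o with
  | none => simp [setIfWhite]
  | some w =>
    simp only [setIfWhite, Option.some.injEq]
    by_cases hvw : w = v
    · subst hvw
      by_cases hw : (σ w).isWhite = true <;> simp [hw]
    · by_cases hw : (σ w).isWhite = true <;> simp [hw, hvw, Ne.symm hvw]

theorem execBase_wrote {s : Step V} (hs : StepOK lo hi s) (hL : (σ s.a).L.closed = true)
    (hR : (σ s.a).R.closed = true) :
    Wrote σ s (σ s.a).L.pos (σ s.a).R.pos True (execBase σ s) := by
  have hab : s.b ≠ some s.a := fun h => by have := hs.b _ h; omega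
  have hac : s.c ≠ some s.a := fun h => by have := hs.c _ h; omega
  have had : s.d ≠ some s.a := fun h => by have := hs.d _ h; omega
  have hbc : ∀ v, s.b = some v → s.c ≠ some v := fun v h₁ h₂ => by
    have := hs.b v h₁; have := hs.c v h₂; omega
  have hbd : ∀ v, s.b = some v → s.d ≠ some v := fun v h₁ h₂ => by
    have := hs.b v h₁; have := hs.d v h₂; omega
  have hcd : ∀ v, s.c = some v → s.d ≠ some v := fun v h₁ h₂ => by
    have := hs.c v h₁; have := hs.d v h₂; omega
  refine ⟨?_, ?_, ?_, ?_, ?_⟩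
  · simp [execBase, setIv_apply, setIfWhite_apply, hab, hac, had, redInterval, hL, hR]
  · intro b hb
    have h₁ := hbc b hb
    have h₂ := hbd b hb
    have h₃ : b ≠ s.a := by rintro rfl; exact hab hb
    simp [execBase, setIv_apply, setIfWhite_apply, h₁, h₂, h₃, hb]
  · intro c hc hw
    have h₁ : s.b ≠ some c := fun h => hbc c h hc
    have h₂ := hcd c hc
    have h₃ : c ≠ s.a := by rintro rfl; exact hac hc
    simp [execBase, setIv_apply, setIfWhite_apply, h₁, h₂, h₃, hc, hw]
  · intro d hd hw _
    have h₁ : s.b ≠ some d := fun h => hbd d h hd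
    have h₂ : s.c ≠ some d := fun h => hcd d h hd
    have h₃ : d ≠ s.a := by rintro rfl; exact had hd
    simp [execBase, setIv_apply, setIfWhite_apply, h₁, h₂, h₃, hd, hw]
  · intro v h₁ h₂ h₃ h₄
    by_cases hc : s.c = some v <;> by_cases hd : s.d = some v
    · exact absurd hd (hcd v hc)
    · simp [execBase, setIv_apply, setIfWhite_apply, h₁, h₂, hd, h₃ hc]
    · have : ¬ (σ v).isWhite = true := fun h => h₄ hd ⟨h, trivial⟩
      simp [execBase, setIv_apply, setIfWhite_apply, h₁, h₂, hc, this]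
    · simp [execBase, setIv_apply, setIfWhite_apply, h₁, h₂, hc, hd]

/-- The operations of a step of the left part that is not the last one. -/
noncomputable def execStep (σ : MixedRep V) (m₂ m₁ : ℝ) (e : Option V) (t : Step V) : MixedRep V :=
  let m := (σ t.a).L.pos
  let σ₃ := setIv (setIv (Function.update σ t.a (redInterval true m m₁ true)) t.b
    (redInterval false m m₁ false)) t.c (redInterval false m m₁ true)
  if e.all (fun w => (σ₃ w).isClosedOpen m₁ m₂) then
    setIfWhite σ₃ t.d (redInterval true m m₁ false) else σ₃

theorem execLeft_cons (m₂ m₁ : ℝ) (e : Option V) (t t' : Step V) (l : List (Step V)) :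
    execLeft σ m₂ m₁ e (t :: t' :: l) =
      ((execLeft (execStep σ m₂ m₁ e t) m₁ (σ t.a).L.pos t.d (t' :: l)).1,
        (σ t.a).L.pos :: (execLeft (execStep σ m₂ m₁ e t) m₁ (σ t.a).L.pos t.d (t' :: l)).2) := rfl

/-- The test on `d_{k-1}` is evaluated after `a`, `b`, `c` have been written. As `d_{k-1}` has no
role in the present step, the result is the same as before the step. -/
theorem execStep_wrote {t : Step V} (ht : StepOK lo hi t) {m₂ m₁ : ℝ} {e : Option V}
    (he : ∀ w, e = some w → w ∉ t.roles)
    (hcw : ∀ c, t.c = some c → (σ c).isWhite = true) :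
    Wrote σ t (σ t.a).L.pos m₁ (e.all (fun w => (σ w).isClosedOpen m₁ m₂) = true)
      (execStep σ m₂ m₁ e t) := by
  have hab : t.b ≠ some t.a := fun h => by have := ht.b _ h; omega
  have hac : t.c ≠ some t.a := fun h => by have := ht.c _ h; omega
  have had : t.d ≠ some t.a := fun h => by have := ht.d _ h; omega
  have hbc : ∀ v, t.b = some v → t.c ≠ some v := fun v h₁ h₂ => by
    have := ht.b v h₁; have := ht.c v h₂; omega
  have hbd : ∀ v, t.b = some v → t.d ≠ some v := fun v h₁ h₂ => by
    have := ht.b v h₁; have := ht.d v h₂; omega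
  have hcd : ∀ v, t.c = some v → t.d ≠ some v := fun v h₁ h₂ => by
    have := ht.c v h₁; have := ht.d v h₂; omega
  set σ₃ := setIv (setIv (Function.update σ t.a (redInterval true (σ t.a).L.pos m₁ true)) t.b
    (redInterval false (σ t.a).L.pos m₁ false)) t.c (redInterval false (σ t.a).L.pos m₁ true)
    with hσ₃
  have e₀ : ∀ v, v ≠ t.a → t.b ≠ some v → t.c ≠ some v → σ₃ v = σ v := fun v h₁ h₂ h₃ => by
    simp [hσ₃, setIv_apply, h₁, h₂, h₃]
  have hD : e.all (fun w => (σ₃ w).isClosedOpen m₁ m₂) =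
      e.all (fun w => (σ w).isClosedOpen m₁ m₂) := by
    cases e with
    | none => rfl
    | some w =>
      have := he w rfl
      rw [mem_roles] at this
      push Not at this
      simp only [Option.all_some]
      rw [e₀ w this.1 this.2.1 this.2.2.1]
  have hex : ∀ v, execStep σ m₂ m₁ e t v =
      if e.all (fun w => (σ w).isClosedOpen m₁ m₂) = true ∧ t.d = some v ∧ (σ v).isWhite = true then
        redInterval true (σ t.a).L.pos m₁ false else σ₃ v := by
    intro v
    have h₁ : execStep σ m₂ m₁ e t = if e.all (fun w => (σ₃ w).isClosedOpen m₁ m₂) = true then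
      setIfWhite σ₃ t.d (redInterval true (σ t.a).L.pos m₁ false) else σ₃ := rfl
    rw [h₁, hD]
    by_cases hd : t.d = some v
    · rw [← e₀ v (by rintro rfl; exact had hd) (fun h => hbd v h hd) (fun h => hcd v h hd)]
      split_ifs with k₁ k₂ k₂
      · rw [setIfWhite_apply, if_pos k₂.2]
      · rw [setIfWhite_apply, if_neg fun k => k₂ ⟨k₁, k⟩]
      · exact absurd k₂.1 k₁
      · rfl
    · split_ifs with k₁ k₂ k₂
      · exact absurd k₂.2.1 hd
      · rw [setIfWhite_apply, if_neg fun k => hd k.1]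
      · exact absurd k₂.1 k₁
      · rfl
  refine ⟨?_, ?_, ?_, ?_, ?_⟩
  · rw [hex, if_neg fun k => had k.2.1]
    simp [hσ₃, setIv_apply, hab, hac]
  · intro b hb
    rw [hex, if_neg fun k => hbd b hb k.2.1]
    simp [hσ₃, setIv_apply, hb, hbc b hb]
  · intro c hc hw
    rw [hex, if_neg fun k => hcd c hc k.2.1]
    simp [hσ₃, setIv_apply, hc]
  · intro d hd hw hD'
    rw [hex, if_pos ⟨hD', hd, hw⟩]
  · intro v h₁ h₂ h₃ h₄
    have h₃' : t.c ≠ some v := fun h => h₃ h (hcw v h)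
    rw [hex, if_neg fun k => h₄ k.2.1 ⟨k.2.2, k.1⟩, e₀ v h₁ h₂ h₃']

theorem execLast_wrote {t : Step V} (hac : t.c ≠ some t.a) (m₂ m₁ : ℝ) (e : Option V) :
    WroteLast σ t m₁ (execLeft σ m₂ m₁ e [{ t with d := none }]).1 := by
  have hex : ∀ v, (execLeft σ m₂ m₁ e [{ t with d := none }]).1 v =
      if t.c = some v then redInterval false (σ t.a).L.pos m₁ true else
      if v = t.a then ⟨⟨(σ t.a).L.pos, true, (σ t.a).L.red⟩, ⟨m₁, true, true⟩⟩ else σ v := by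
    intro v
    rw [execLeft]
    simp only [setIv_apply, Function.update_apply]
  refine ⟨?_, ?_, ?_⟩
  · rw [hex, if_neg hac, if_pos rfl]
  · intro c hc
    rw [hex, if_pos hc]
  · intro v h₁ h₂
    rw [hex, if_neg h₂, if_neg h₁]

end Exec

end Execution

/-! ### Summary of a complete left part -/

section LeftPart

variable {V : Type u} {G : SimpleGraph V} {lo hi : V → ℤ} {σ₀ : MixedRep V}
  {Z : Set ℤ} {m : ℤ → ℝ} {PL PR : Set ℤ} {σ σ' : MixedRep V}

/-- The effect of the left part of a sweep that begins with `σs`: the steps `l` that follow `s` lead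
from `σ` to `σ'` and establish the zone lines `lines`. -/
structure LeftRun (lo hi : V → ℤ) (σs : MixedRep V) (s : Step V) (l : List (Step V)) (Z : Set ℤ)
    (m : ℤ → ℝ) (σ : MixedRep V) (Z' : Set ℤ) (m' : ℤ → ℝ) (σ' : MixedRep V) (lines : List ℝ) :
    Prop where
  ext : Extends Z m σ Z' m' σ'
  untouched : ∀ v, (∀ t ∈ l, v ∉ t.roles) → σ' v = σ v
  of_lines : ∀ x ∈ lines, ∃ z ∈ Z', z ∉ Z ∧ m' z = x
  top : ∀ z ∈ Z', z ∉ Z → ∃ t ∈ l, lo t.a = z ∧ (σ' t.a).L = ⟨m' z, true, true⟩ ∧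
    ∃ x, LLink lo hi t.a x ∧ (t.b = some x ∨ t.c = some x) ∧ (σ' x).L = ⟨m' z, false, true⟩
  bot : ∀ z, (z ∈ Z' ∧ z ∉ Z) ∨ z = lo s.a → ∃ t ∈ l, hi t.a = z ∧
    (∀ u, hi u = z → lo t.a ≤ lo u) ∧ (σ' t.a).R = ⟨m' z, true, true⟩
  newL : ∀ v, (σ v).L.red = false → (σ' v).L.red = true →
    (∃ z ∈ Z', z ∉ Z ∧ (σ' v).L.pos = m' z) ∨
      ∃ t ∈ l.getLast?, t.Merging σs ∧ t.c = some v
  newR : ∀ v, (σ v).R.red = false → (σ' v).R.red = true →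
    ∃ z, ((z ∈ Z' ∧ z ∉ Z) ∨ z = lo s.a) ∧ (σ' v).R.pos = m' z
  merge : ∀ t ∈ l.getLast?, t.Merging σs → ∀ c, t.c = some c →
    (σs c).L.red = false ∧ (σ' c).L.red = true
  steps : ∀ t ∈ l, (σs t.a).R.red = false ∧ (σ' t.a).R.red = true

theorem WroteLast.leftRun {σs : MixedRep V} {s t : Step V}
    (hn : NextOK lo hi σ s t) (hend : t.Terminal ∨ t.Merging σ) (hm' : t.Merging σ → t.Merging σs)
    (hσ : ∀ v, hi v ≤ lo s.a → σ v = σs v) (E : Extends Z m σ Z m σ')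
    (W : WroteLast σ t (m (lo s.a)) σ') :
    LeftRun lo hi σs s [{ t with d := none }] Z m σ Z m σ' [] where
  ext := E
  untouched v hv := by
    have := hv _ (List.mem_singleton_self _)
    rw [mem_roles] at this
    push Not at this
    exact W.other v this.1 this.2.2.1
  of_lines x hx := by cases hx
  top z hz hz' := absurd hz hz'
  bot z hz := by
    rcases hz with ⟨hz, hz'⟩ | rfl
    · exact absurd hz hz'
    · exact ⟨_, List.mem_singleton_self _, hn.hi_a, hn.min, by simp only [W.a]⟩
  newL v hv hv' := by
    right
    rcases W.cases v with ⟨rfl, e⟩ | ⟨h', e⟩ | e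
    · rw [e] at hv'; simp only at hv'; rw [hv] at hv'; cases hv'
    · refine ⟨_, rfl, ?_, h'⟩
      rcases hend with hend | hend
      · rw [hend.2] at h'; cases h'
      · exact hm' hend
    · rw [e, hv] at hv'; cases hv'
  newR v hv hv' := by
    refine ⟨_, .inr rfl, ?_⟩
    rcases W.cases v with ⟨rfl, e⟩ | ⟨h', e⟩ | e
    · rw [e]
    · rw [e]; rfl
    · rw [e, hv] at hv'; cases hv'
  merge t' ht' hm₁ c hc := by
    obtain rfl : _ = t' := by simpa using ht'
    simp only at hc
    have hc' := hn.c c hc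
    have hia := hn.hi_a
    rw [← hσ c (by omega), W.c c hc]
    exact ⟨hc'.2.2.2.1, rfl⟩
  steps t' ht' := by
    rw [List.mem_singleton] at ht'
    subst ht'
    simp only
    rw [← hσ t.a hn.hi_a.le, W.a]
    exact ⟨hn.whiteR, rfl⟩

theorem LeftRun.cons {σs : MixedRep V} {s t : Step V} {l : List (Step V)} {x y : ℝ} {D : Prop}
    {σ₁ : MixedRep V} {m₁ : ℤ → ℝ} {Z' : Set ℤ} {m' : ℤ → ℝ} {lines : List ℝ}
    (W : Wrote σ t x y D σ₁) (E : Extends Z m σ (insert (lo t.a) Z) m₁ σ₁)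
    (hj : lo s.a ∈ Z) (hy : y = m (lo s.a)) (hx : m₁ (lo t.a) = x) (hi₀ : lo t.a ∉ Z)
    (hn : NextOK lo hi σ s t) (ht : StepOK lo hi t) (hl : l ≠ [])
    (hσ : ∀ v, hi v ≤ lo s.a → σ v = σs v)
    (R : LeftRun lo hi σs t l (insert (lo t.a) Z) m₁ σ₁ Z' m' σ' lines) :
    LeftRun lo hi σs s (t :: l) Z m σ Z' m' σ' (x :: lines) := by
  have hlast : ∀ t', t' ∈ (t :: l).getLast? → t' ∈ l.getLast? := fun t' h => by
    cases l with
    | nil => exact absurd rfl hl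
    | cons t'' l => simpa [List.getLast?_cons_cons] using h
  have hlast' : ∀ t', t' ∈ l.getLast? → t' ∈ (t :: l).getLast? := fun t' h => by
    cases l with
    | nil => exact absurd rfl hl
    | cons t'' l => simpa [List.getLast?_cons_cons] using h
  have hmi : m' (lo t.a) = x := by rw [R.ext.pos _ (.inl rfl), hx]
  have hmj : m' (lo s.a) = y := by rw [R.ext.pos _ (.inr hj), E.pos _ hj, hy]
  have hiZ : lo t.a ∈ Z' := R.ext.sub (.inl rfl)
  have hsplit : ∀ z ∈ Z', z ∉ Z → z = lo t.a ∨ z ∉ insert (lo t.a) Z := fun z hz hz' => by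
    by_cases h : z = lo t.a
    · exact .inl h
    · exact .inr fun h' => h'.elim h hz'
  have hout : ∀ z, z ∉ insert (lo t.a) Z → z ∉ Z := fun z hz hz' => hz (.inr hz')
  have hbot : (σ' t.a).R = ⟨m' (lo s.a), true, true⟩ := by
    rw [R.ext.keepR _ (by rw [W.a]; rfl), W.a, hmj]; rfl
  refine ⟨E.trans R.ext, ?_, ?_, ?_, ?_, ?_, ?_, ?_, ?_⟩
  · intro v hv
    rw [R.untouched v fun t' ht' => hv t' (.tail _ ht')]
    have := hv t (.head _)
    rw [mem_roles] at this
    push Not at this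
    exact W.other v this.1 this.2.1 (fun h => absurd h this.2.2.1) fun h => absurd h this.2.2.2
  · intro x' hx'
    rcases List.mem_cons.1 hx' with rfl | hx'
    · exact ⟨_, hiZ, hi₀, hmi⟩
    · obtain ⟨z, h₁, h₂, h₃⟩ := R.of_lines x' hx'
      exact ⟨z, h₁, hout z h₂, h₃⟩
  · intro z hz hz'
    rcases hsplit z hz hz' with rfl | h
    · refine ⟨t, .head _, rfl, ?_, ?_⟩
      · rw [R.ext.keepL _ (by rw [W.a]; rfl), W.a, hmi]; rfl
      · obtain ⟨X, hX, hX'⟩ := ht.link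
        refine ⟨X, hX, hX', ?_⟩
        have e : (σ₁ X).L = ⟨x, false, true⟩ := by
          rcases hX' with h | h
          · rw [W.b X h]; rfl
          · rw [W.c X h (MInterval.isWhite_iff.2 (hn.c X h).2.2.2)]; rfl
        rw [R.ext.keepL _ (by rw [e]), e, hmi]
    · obtain ⟨t', h₁, h₂⟩ := R.top z hz h
      exact ⟨t', .tail _ h₁, h₂⟩
  · intro z hz
    have : (z ∈ Z' ∧ z ∉ insert (lo t.a) Z ∨ z = lo t.a) ∨ z = lo s.a := by
      rcases hz with ⟨h₁, h₂⟩ | h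
      · rcases hsplit z h₁ h₂ with h | h
        · exact .inl (.inr h)
        · exact .inl (.inl ⟨h₁, h⟩)
      · exact .inr h
    rcases this with h | rfl
    · obtain ⟨t', h₁, h₂⟩ := R.bot z h
      exact ⟨t', .tail _ h₁, h₂⟩
    · exact ⟨t, .head _, hn.hi_a, hn.min, hbot⟩
  · intro v hv hv'
    rcases hr : (σ₁ v).L.red with _ | _
    · rcases R.newL v hr hv' with ⟨z, h₁, h₂, h₃⟩ | ⟨t', h₁, h₂⟩
      · exact .inl ⟨z, h₁, hout z h₂, h₃⟩
      · exact .inr ⟨t', hlast' t' h₁, h₂⟩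
    · left
      refine ⟨_, hiZ, hi₀, ?_⟩
      rw [R.ext.keepL v hr, hmi]
      rcases W.cases v with ⟨-, e⟩ | ⟨-, e⟩ | ⟨-, -, e⟩ | ⟨-, -, -, e⟩ | e
      · rw [e]; rfl
      · rw [e]; rfl
      · rw [e]; rfl
      · rw [e]; rfl
      · rw [e, hv] at hr; cases hr
  · intro v hv hv'
    rcases hr : (σ₁ v).R.red with _ | _
    · obtain ⟨z, h₁, h₂⟩ := R.newR v hr hv'
      rcases h₁ with ⟨h₁, h₃⟩ | rfl
      · exact ⟨z, .inl ⟨h₁, hout z h₃⟩, h₂⟩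
      · exact ⟨_, .inl ⟨hiZ, hi₀⟩, h₂⟩
    · refine ⟨_, .inr rfl, ?_⟩
      rw [R.ext.keepR v hr, hmj]
      rcases W.cases v with ⟨-, e⟩ | ⟨-, e⟩ | ⟨-, -, e⟩ | ⟨-, -, -, e⟩ | e
      · rw [e]; rfl
      · rw [e]; rfl
      · rw [e]; rfl
      · rw [e]; rfl
      · rw [e, hv] at hr; cases hr
  · intro t' ht'
    exact R.merge t' (hlast t' ht')
  · intro t' ht'
    rcases List.mem_cons.1 ht' with rfl | ht'
    · rw [← hσ t'.a hn.hi_a.le, hbot]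
      exact ⟨hn.whiteR, rfl⟩
    · exact R.steps t' ht'

/-- Induction along the steps. Vertices are identified in the representation `σs` at the beginning
of the sweep; this remains valid because, by `hσ`, nothing that ends in or before the clique `lo
s.a` has been touched yet. -/
theorem LeftSteps.leftRun [DecidableEq V] (M : Model G lo hi) (Λ : Layout lo hi σ₀) {σs : MixedRep V}
    {Zs : Set ℤ} {ms : ℤ → ℝ} (h₀ : SweepInv lo hi σ₀ Zs ms ∅ ∅ σs) {s : Step V}
    {l : List (Step V)} (hl : LeftSteps G σs s l) (hw : (σs s.a).L.red = false)
    (hs : StepOK lo hi s) (h : SweepInv lo hi σ₀ Z m {lo s.a} PR σ)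
    (hj : lo s.a ∈ Z) (hj₂ : hi s.a ∈ Z) (hPR : ∀ z ∈ PR, lo s.a < z)
    (hsa : σ s.a = redInterval true (m (lo s.a)) (m (hi s.a)) true)
    (hσ : ∀ v, hi v ≤ lo s.a → σ v = σs v) :
    ∃ Z' m', SweepInv lo hi σ₀ Z' m' ∅ PR
        (execLeft σ (m (hi s.a)) (m (lo s.a)) s.d l).1 ∧
      LeftRun lo hi σs s l Z m σ Z' m' (execLeft σ (m (hi s.a)) (m (lo s.a)) s.d l).1
        (execLeft σ (m (hi s.a)) (m (lo s.a)) s.d l).2 := by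
  induction hl generalizing Z m σ with
  | @finish s t ht hend =>
    have o := (ht.nextOK M Λ h₀ hs hw).congr hσ
    have hac : t.c ≠ some t.a := fun e => by have := o.c _ e; omega
    have W := execLast_wrote (σ := σ) hac (m (hi s.a)) (m (lo s.a)) s.d
    have hta := hσ t.a o.hi_a.le
    have hm : t.Merging σs → t.Merging σ := fun ⟨k₁, k₂⟩ => ⟨k₁, by rwa [hta]⟩
    have hm' : t.Merging σ → t.Merging σs := fun ⟨k₁, k₂⟩ => ⟨k₁, by rwa [← hta]⟩
    have hend' := hend.imp_right hm
    obtain ⟨i, E, -⟩ := W.last_inv M Λ h rfl hj hs o hend'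
    exact ⟨Z, m, i, W.leftRun o hend' hm' hσ E⟩
  | @cont s t l ht hend hl ih =>
    have o₀ := ht.nextOK M Λ h₀ hs hw
    have o := o₀.congr hσ
    have ht' := hs.next M o₀ (o₀.link_of_cont hend) ht.2.2
    have hlt := ht'.lo_lt_hi M
    have hia := o.hi_a
    have hwt := o₀.white_of_cont hend
    have hta := hσ t.a o.hi_a.le
    have W := execStep_wrote (σ := σ) ht' (m₂ := m (hi s.a)) (m₁ := m (lo s.a)) (e := s.d)
      (fun w hw' hr => by
        have := ht'.lt_hi M hr
        have := (hs.d w hw').2.2.1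
        omega)
      (fun c hc => MInterval.isWhite_iff.2 (o.c c hc).2.2.2)
    obtain ⟨m₁, i, E, hi₀, hm₁⟩ := W.step_inv M Λ h hj hj₂ hPR hsa hs o ht' (by rwa [hta]) ht.2.2
    have hmj : m₁ (lo s.a) = m (lo s.a) := E.pos _ hj
    obtain ⟨Z', m', i', R⟩ := ih hwt ht' i (.inl rfl) (by rw [hia]; exact .inr hj)
      (fun z hz => by have := hPR z hz; omega) (by rw [W.a, hia, hm₁, hmj])
      (fun v hv => by
        rw [← hσ v (by omega)]
        refine W.other v ?_ ?_ ?_ ?_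
        · rintro rfl; omega
        · intro hb; have := ht'.b v hb; have := M.le v; omega
        · intro hc; have := ht'.c v hc; have := M.le v; omega
        · intro hd; have := (ht'.d v hd).2.2.1; omega)
    rw [hia, hm₁, hmj] at i' R
    have hne := hl.ne_nil
    cases l with
    | nil => exact absurd rfl hne
    | cons t' l =>
      rw [execLeft_cons]
      exact ⟨Z', m', i', R.cons W E hj rfl hm₁ hi₀ o ht' hne hσ⟩

end LeftPart

section Sweep

variable {V : Type u} [DecidableEq V] {G : SimpleGraph V} {lo hi : V → ℤ} {σ₀ : MixedRep V}
  {Z : Set ℤ} {m : ℤ → ℝ} {PL PR : Set ℤ} {σ σ' : MixedRep V}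

/-! ### A whole sweep -/

/-- The effect of a sweep. -/
structure SweepEffect (lo hi : V → ℤ) (D : SweepData V) (Z : Set ℤ) (m : ℤ → ℝ) (Z' : Set ℤ)
    (m' : ℤ → ℝ) : Prop where
  ext : Extends Z m D.start Z' m' D.final
  untouched : ∀ v, v ∉ D.roles → D.final v = D.start v
  of_line : ∀ x, D.IsZoneLine x → ∃ z ∈ Z', z ∉ Z ∧ m' z = x
  top : ∀ z ∈ Z', z ∉ Z → ∃ a, D.IsTypeA a ∧ lo a = z ∧ (∀ u, lo u = z → hi u ≤ hi a) ∧
    (D.final a).L = ⟨m' z, true, true⟩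
  bot : ∀ z ∈ Z', z ∉ Z → ∃ a, D.IsTypeA a ∧ hi a = z ∧ (∀ u, hi u = z → lo a ≤ lo u) ∧
    (D.final a).R = ⟨m' z, true, true⟩
  openL : ∀ x ∈ D.leftLines, ∃ v, D.IsLeftTypeBC v ∧ (D.final v).L = ⟨x, false, true⟩
  openR : ∀ x ∈ D.rightLines, ∃ v, D.IsRightTypeBD v ∧ (D.final v).R = ⟨x, false, true⟩
  newL : ∀ v, (D.start v).L.red = false → (D.final v).L.red = true →
    (∃ z ∈ Z', z ∉ Z ∧ (D.final v).L.pos = m' z) ∨ D.IsMergingC v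
  newR : ∀ v, (D.start v).R.red = false → (D.final v).R.red = true →
    (∃ z ∈ Z', z ∉ Z ∧ (D.final v).R.pos = m' z) ∨ D.IsMergingD v
  mergeC : ∀ v, D.IsMergingC v → (D.start v).L.red = false ∧ (D.final v).L.red = true
  mergeD : ∀ v, D.IsMergingD v → (D.start v).R.red = false ∧ (D.final v).R.red = true
  base : ∃ b, D.base.b = some b ∧ (D.start D.base.a).L.red = false ∧
    (D.final D.base.a).L.red = true ∧ (D.final b).L.red = true
  left : ∀ t ∈ D.left, (D.start t.a).R.red = false ∧ (D.final t.a).R.red = true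
  right : ∀ t ∈ D.right, (D.start t.a).L.red = false ∧ (D.final t.a).L.red = true

omit [DecidableEq V] in
theorem IsBase.stepOK_swap (M : Model G lo hi) (Λ : Layout lo hi σ₀)
    (h : SweepInv lo hi σ₀ Z m ∅ ∅ σ) {s : Step V} (hb : IsBase G σ s) :
    StepOK (fun v => -hi v) (fun v => -lo v) s.swap := by
  have h' := h.mirror
  rw [negSet_empty] at h'
  exact hb.mirror.stepOK M.mirror Λ.mirror h'

theorem IsSweep.effect (M : Model G lo hi) (Λ : Layout lo hi σ₀) {D : SweepData V}
    (h : SweepInv lo hi σ₀ Z m ∅ ∅ D.start) (hD : IsSweep G D) :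
    ∃ Z' m', SweepInv lo hi σ₀ Z' m' ∅ ∅ D.final ∧ SweepEffect lo hi D Z m Z' m' := by
  obtain ⟨hb, hl, hr⟩ := hD
  have h' := h.mirror
  rw [negSet_empty] at h'
  have hs := hb.stepOK M Λ h
  have hs' := hb.stepOK_swap M Λ h
  obtain ⟨b, hb₁, hb₂, hb₃, w₁, w₂, w₃, w₄⟩ := hb.white M Λ h
  set a := D.base.a with ha
  have hlt : lo a < hi a := hs.lo_lt_hi M
  have hcl : (D.start a).L.closed = true := by rw [h.whiteL _ w₁]; exact Λ.closed a .left
  have hcr : (D.start a).R.closed = true := by rw [h.whiteR _ w₂]; exact Λ.closed a .right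
  have W := execBase_wrote hs hcl hcr
  set σ₁ := execBase D.start D.base with hσ₁
  obtain ⟨m₁, i₁, E₁, hi₀, hj₀, em, em'⟩ := W.base_inv M Λ h hs hs' hb₁ ⟨w₁, w₂, w₃, w₄⟩
  set Z₁ : Set ℤ := insert (lo a) (insert (hi a) Z) with hZ₁
  have hiZ₁ : lo a ∈ Z₁ := .inl rfl
  have hjZ₁ : hi a ∈ Z₁ := .inr (.inl rfl)
  have hbase : ∀ v, (v ∉ D.base.roles) → σ₁ v = D.start v := fun v hv => by
    rw [mem_roles] at hv
    push Not at hv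
    exact W.other v hv.1 hv.2.1 (fun h => absurd h hv.2.2.1) fun h => absurd h hv.2.2.2
  obtain ⟨Z₂, m₂, i₂, L⟩ := hl.leftRun M Λ h w₁ hs i₁ hiZ₁ hjZ₁
    (by rintro z rfl; exact hlt) (by rw [W.a, em, em'])
    (fun v hv => hbase v fun hv' => by have := hs.lt_hi M hv'; omega)
  rw [em, em'] at i₂ L
  change SweepInv lo hi σ₀ Z₂ m₂ ∅ {hi a} D.leftResult.1 at i₂
  change LeftRun lo hi D.start D.base D.left Z₁ m₁ σ₁ Z₂ m₂ D.leftResult.1 D.leftResult.2 at L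
  set σ₂ := D.leftResult.1 with hσ₂
  have em₂ : m₂ (lo a) = (D.start a).L.pos := by rw [L.ext.pos _ hiZ₁, em]
  have em₂' : m₂ (hi a) = (D.start a).R.pos := by rw [L.ext.pos _ hjZ₁, em']
  have hleft := hl.roles_le M Λ h hs w₁
  have hsa₂ : σ₂ a = redInterval true (m₂ (lo a)) (m₂ (hi a)) true := by
    rw [L.untouched a fun t ht hat => by have := hleft t ht a hat; rw [← ha] at this; omega, W.a, em₂, em₂']
  -- The clique `hi a`, still pending on the right, becomes after reflection the pending clique of a
  -- left part.
  have i₂' := i₂.mirror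
  rw [negSet_empty, negSet_singleton] at i₂'
  have en₂ : negPos m₂ (-lo a) = -D.m0 := by simp only [negPos, neg_neg, em₂]; rfl
  have en₂' : negPos m₂ (-hi a) = -D.m0' := by simp only [negPos, neg_neg, em₂']; rfl
  obtain ⟨Z₃, m₃, i₃, R⟩ := hr.leftRun M.mirror Λ.mirror h' (s := D.base.swap) (PR := ∅)
    (by simpa [Step.swap, MixedRep.mirror_apply] using w₂) hs' i₂'
    (by simpa [Step.swap] using L.ext.sub hjZ₁) (by simpa [Step.swap] using L.ext.sub hiZ₁)
    (by simp)
    (by simp only [Step.swap, MixedRep.mirror_apply]; rw [← ha, hsa₂, redInterval_mirror]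
        simp [negPos])
    (fun v hv => by
      simp only [Step.swap] at hv
      have lv := M.le v
      simp only [MixedRep.mirror_apply]
      rw [L.untouched v fun t ht hat => by
        have := hleft t ht v hat; rw [← ha] at this hv; omega, hbase v]
      intro hv'
      have := hs'.lt_hi M.mirror (v := v) (by
        rw [mem_roles] at hv' ⊢
        simp only [Step.swap]
        tauto)
      simp only [Step.swap] at this
      omega)
  simp only [Step.swap] at i₃ R
  rw [← ha, en₂, en₂'] at i₃ R
  change SweepInv _ _ σ₀.mirror Z₃ m₃ ∅ ∅ D.rightResult.1 at i₃
  change LeftRun _ _ D.start.mirror D.base.swap D.right (negSet Z₂) (negPos m₂) σ₂.mirror Z₃ m₃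
    D.rightResult.1 D.rightResult.2 at R
  have i₄ := i₃.mirror
  simp only [neg_neg, MixedRep.mirror_mirror, negSet_empty] at i₄
  change SweepInv lo hi σ₀ (negSet Z₃) (negPos m₃) ∅ ∅ D.final at i₄
  have E₃ := R.ext.mirror
  simp only [negSet_negSet, negPos_negPos, MixedRep.mirror_mirror] at E₃
  change Extends Z₂ m₂ σ₂ (negSet Z₃) (negPos m₃) D.final at E₃
  have E := (E₁.trans L.ext).trans E₃
  have E₂₃ := L.ext.trans E₃
  have efin : D.rightResult.1 = D.final.mirror := by
    simp only [SweepData.final, MixedRep.mirror_mirror]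
  rw [efin] at R
  have hsplit : ∀ z ∈ negSet Z₃, z ∉ Z → z = lo a ∨ z = hi a ∨ (z ∈ Z₂ ∧ z ∉ Z₁) ∨
      (-z ∈ Z₃ ∧ -z ∉ negSet Z₂) := fun z hz hz' => by
    by_cases k₁ : z ∈ Z₁
    · rcases k₁ with k | k | k
      · exact .inl k
      · exact .inr (.inl k)
      · exact absurd k hz'
    · by_cases k₂ : z ∈ Z₂
      · exact .inr (.inr (.inl ⟨k₂, k₁⟩))
      · exact .inr (.inr (.inr ⟨hz, by simpa using k₂⟩))
  have hZ01 : ∀ z, z ∉ Z₁ → z ∉ Z := fun z hz hz' => hz (.inr (.inr hz'))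
  have hZ02 : ∀ z, z ∉ Z₂ → z ∉ Z := fun z hz hz' => hz (L.ext.sub (.inr (.inr hz')))
  have n₂ : ∀ z ∈ Z₂, negPos m₃ z = m₂ z := E₃.pos
  have nx : negPos m₃ (lo a) = D.m0 := by rw [n₂ _ (L.ext.sub hiZ₁), em₂]; rfl
  have ny : negPos m₃ (hi a) = D.m0' := by rw [n₂ _ (L.ext.sub hjZ₁), em₂']; rfl
  have hiZ : lo a ∈ negSet Z₃ := E₂₃.sub hiZ₁
  have hjZ : hi a ∈ negSet Z₃ := E₂₃.sub hjZ₁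
  have fa : (D.final a).L = ⟨D.m0, true, true⟩ ∧ (D.final a).R = ⟨D.m0', true, true⟩ := by
    rw [E₂₃.keepL a (by rw [W.a]; rfl), E₂₃.keepR a (by rw [W.a]; rfl), W.a]
    exact ⟨rfl, rfl⟩
  have fb : (D.final b).L = ⟨D.m0, false, true⟩ ∧ (D.final b).R = ⟨D.m0', false, true⟩ := by
    rw [E₂₃.keepL b (by rw [W.b b hb₁]; rfl), E₂₃.keepR b (by rw [W.b b hb₁]; rfl), W.b b hb₁]
    exact ⟨rfl, rfl⟩
  have hstep₀ : D.base ∈ D.steps := .head _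
  have hstepl : ∀ t ∈ D.left, t ∈ D.steps := fun t ht => by simp [SweepData.steps, ht]
  have hstepr : ∀ t ∈ D.right, t ∈ D.steps := fun t ht => by simp [SweepData.steps, ht]
  have hmir : ∀ v x cl, (D.final.mirror v).L = ⟨x, cl, true⟩ → (D.final v).R = ⟨-x, cl, true⟩ := by
    intro v x cl e
    rw [MixedRep.mirror_apply, MInterval.mirror_L, ← neg_neg x, Endpoint.neg_eq] at e
    exact e
  have hmir' : ∀ v x cl, (D.final.mirror v).R = ⟨x, cl, true⟩ → (D.final v).L = ⟨-x, cl, true⟩ := by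
    intro v x cl e
    rw [MixedRep.mirror_apply, MInterval.mirror_R, ← neg_neg x, Endpoint.neg_eq] at e
    exact e
  have hLmax : ∀ {t : Step V} {x : V}, LLink lo hi t.a x → ∀ u, lo u = lo t.a → hi u ≤ hi t.a := by
    intro t x hx u hu
    by_contra hc
    rw [hx.max M (v := u) (by omega) (by omega)] at hc
    exact hc le_rfl
  have hRmin : ∀ {t : Step V} {x : V}, RLink lo hi t.a x → ∀ u, hi u = hi t.a → lo t.a ≤ lo u := by
    intro t x hx u hu
    by_contra hc
    rw [hx.max M (v := u) (by omega) (by omega)] at hc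
    exact hc le_rfl
  refine ⟨negSet Z₃, negPos m₃, i₄, E, ?_, ?_, ?_, ?_, ?_, ?_, ?_, ?_, ?_, ?_, ?_, ?_, ?_⟩
  · intro v hv
    have hv' : ∀ t ∈ D.steps, v ∉ t.roles := fun t ht hvt =>
      hv (List.mem_flatMap.2 ⟨t, ht, hvt⟩)
    have e := R.untouched v fun t ht => hv' t (hstepr t ht)
    rw [MixedRep.mirror_apply, MixedRep.mirror_apply, MInterval.mirror_inj] at e
    rw [e, L.untouched v fun t ht => hv' t (hstepl t ht), hbase v (hv' _ hstep₀)]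
  · rintro x (hx | hx)
    · rcases List.mem_cons.1 hx with rfl | hx
      · exact ⟨lo a, hiZ, hi₀, nx⟩
      · obtain ⟨z, k₁, k₂, k₃⟩ := L.of_lines x hx
        exact ⟨z, E₃.sub k₁, hZ01 z k₂, by rw [n₂ z k₁, k₃]⟩
    · rcases List.mem_cons.1 hx with rfl | hx
      · exact ⟨hi a, hjZ, hj₀, ny⟩
      · obtain ⟨x', hx', rfl⟩ := List.mem_map.1 hx
        obtain ⟨z, k₁, k₂, k₃⟩ := R.of_lines x' hx'
        exact ⟨-z, by simpa using k₁, hZ02 _ k₂, by simp only [negPos, neg_neg, k₃]⟩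
  · intro z hz hz'
    have hR : ((-z ∈ Z₃ ∧ -z ∉ negSet Z₂) ∨ -z = -hi a) → ∃ a, D.IsTypeA a ∧ lo a = z ∧
        (∀ u, lo u = z → hi u ≤ hi a) ∧ (D.final a).L = ⟨negPos m₃ z, true, true⟩ := by
      intro k
      obtain ⟨t, k₁, k₂, k₃, k₄⟩ := R.bot (-z) k
      exact ⟨t.a, ⟨t, hstepr t k₁, rfl⟩, by omega,
        fun u hu => by have := k₃ u (by omega); omega, hmir' _ _ _ k₄⟩
    rcases hsplit z hz hz' with rfl | rfl | ⟨k₁, k₂⟩ | k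
    · exact ⟨a, ⟨_, hstep₀, rfl⟩, rfl, hLmax (.base hb₂ hb₃), by rw [fa.1, nx]⟩
    · exact hR (.inr rfl)
    · obtain ⟨t, k₃, rfl, k₄, x, hx, -⟩ := L.top z k₁ k₂
      exact ⟨t.a, ⟨t, hstepl t k₃, rfl⟩, rfl, hLmax hx, by
        rw [E₃.keepL _ (by rw [k₄]), k₄, n₂ _ k₁]⟩
    · exact hR (.inl k)
  · intro z hz hz'
    have hL : ((z ∈ Z₂ ∧ z ∉ Z₁) ∨ z = lo a) → ∃ a, D.IsTypeA a ∧ hi a = z ∧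
        (∀ u, hi u = z → lo a ≤ lo u) ∧ (D.final a).R = ⟨negPos m₃ z, true, true⟩ := by
      intro k
      obtain ⟨t, k₁, k₂, k₃, k₄⟩ := L.bot z k
      have hzZ : z ∈ Z₂ := by
        rcases k with k | rfl
        · exact k.1
        · exact L.ext.sub hiZ₁
      exact ⟨t.a, ⟨t, hstepl t k₁, rfl⟩, k₂, k₃, by
        rw [E₃.keepR _ (by rw [k₄]), k₄, n₂ _ hzZ]⟩
    rcases hsplit z hz hz' with rfl | rfl | k | ⟨k₁, k₂⟩
    · exact hL (.inr rfl)
    · exact ⟨a, ⟨_, hstep₀, rfl⟩, rfl, hRmin (RLink.base hb₂ hb₃), by rw [fa.2, ny]⟩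
    · exact hL (.inl k)
    · obtain ⟨t, k₃, k₄, k₅, x, hx, -⟩ := R.top (-z) k₁ k₂
      obtain rfl : hi t.a = z := by omega
      exact ⟨t.a, ⟨t, hstepr t k₃, rfl⟩, rfl, hRmin hx, hmir _ _ _ k₅⟩
  · intro x hx
    rcases List.mem_cons.1 hx with rfl | hx
    · exact ⟨b, ⟨D.base, .head _, .inl hb₁⟩, fb.1⟩
    · obtain ⟨z, k₁, k₂, rfl⟩ := L.of_lines x hx
      obtain ⟨t, k₃, -, -, y, -, hy, k₄⟩ := L.top z k₁ k₂
      exact ⟨y, ⟨t, .tail _ k₃, hy⟩, by rw [E₃.keepL _ (by rw [k₄]), k₄]⟩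
  · intro x hx
    rcases List.mem_cons.1 hx with rfl | hx
    · exact ⟨b, ⟨D.base.swap, .head _, .inl hb₁⟩, fb.2⟩
    · obtain ⟨x', hx', rfl⟩ := List.mem_map.1 hx
      obtain ⟨z, k₁, k₂, rfl⟩ := R.of_lines x' hx'
      obtain ⟨t, k₃, -, -, y, -, hy, k₄⟩ := R.top z k₁ k₂
      exact ⟨y, ⟨t, .tail _ k₃, hy⟩, hmir _ _ _ k₄⟩
  · intro v hv hv'
    rcases r₁ : (σ₁ v).L.red with _ | _
    · rcases r₂ : (σ₂ v).L.red with _ | _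
      · obtain ⟨z, k, k'⟩ := R.newR v (by simpa [MixedRep.mirror_apply] using r₂)
          (by simpa [MixedRep.mirror_apply] using hv')
        left
        simp only [MixedRep.mirror_apply, MInterval.mirror_R_pos] at k'
        have e : (D.final v).L.pos = negPos m₃ (-z) := by simp only [negPos, neg_neg]; linarith
        rcases k with ⟨k₁, k₂⟩ | rfl
        · exact ⟨-z, by simpa using k₁, hZ02 _ k₂, e⟩
        · exact ⟨hi a, hjZ, hj₀, by rw [e]; congr 1; simp [Step.swap, ha]⟩
      · rcases L.newL v r₁ r₂ with ⟨z, k₁, k₂, k₃⟩ | k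
        · exact .inl ⟨z, E₃.sub k₁, hZ01 z k₂, by rw [E₃.keepL v r₂, k₃, n₂ z k₁]⟩
        · exact .inr k
    · left
      refine ⟨lo a, hiZ, hi₀, ?_⟩
      rw [E₂₃.keepL v r₁, nx]
      rcases W.cases v with ⟨-, e⟩ | ⟨-, e⟩ | ⟨-, -, e⟩ | ⟨-, -, -, e⟩ | e
      · rw [e]; rfl
      · rw [e]; rfl
      · rw [e]; rfl
      · rw [e]; rfl
      · rw [e, hv] at r₁; cases r₁
  · intro v hv hv'
    rcases r₁ : (σ₁ v).R.red with _ | _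
    · rcases r₂ : (σ₂ v).R.red with _ | _
      · rcases R.newL v (by simpa [MixedRep.mirror_apply] using r₂)
          (by simpa [MixedRep.mirror_apply] using hv') with ⟨z, k₁, k₂, k₃⟩ | k
        · left
          simp only [MixedRep.mirror_apply, MInterval.mirror_L_pos] at k₃
          exact ⟨-z, by simpa using k₁, hZ02 _ k₂, by simp only [negPos, neg_neg]; linarith⟩
        · exact .inr k
      · obtain ⟨z, k, k'⟩ := L.newR v r₁ r₂
        left
        rcases k with ⟨k₁, k₂⟩ | rfl
        · exact ⟨z, E₃.sub k₁, hZ01 z k₂, by rw [E₃.keepR v r₂, k', n₂ z k₁]⟩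
        · exact ⟨lo a, hiZ, hi₀, by rw [E₃.keepR v r₂, k', n₂ _ (L.ext.sub hiZ₁)]⟩
    · left
      refine ⟨hi a, hjZ, hj₀, ?_⟩
      rw [E₂₃.keepR v r₁, ny]
      rcases W.cases v with ⟨-, e⟩ | ⟨-, e⟩ | ⟨-, -, e⟩ | ⟨-, -, -, e⟩ | e
      · rw [e]; rfl
      · rw [e]; rfl
      · rw [e]; rfl
      · rw [e]; rfl
      · rw [e, hv] at r₁; cases r₁
  · rintro v ⟨t, k₁, k₂, k₃⟩
    have := L.merge t k₁ k₂ v k₃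
    exact ⟨this.1, E₃.redL this.2⟩
  · rintro v ⟨t, k₁, k₂, k₃⟩
    have := R.merge t k₁ k₂ v k₃
    simpa [MixedRep.mirror_apply] using this
  · exact ⟨b, hb₁, w₁, by rw [fa.1], by rw [fb.1]⟩
  · intro t ht
    have := L.steps t ht
    exact ⟨this.1, E₃.redR this.2⟩
  · intro t ht
    have := R.steps t ht
    simpa [MixedRep.mirror_apply] using this

end Sweep

section Runs

variable {V : Type u} [DecidableEq V] {G : SimpleGraph V} {lo hi : V → ℤ} {σ₀ : MixedRep V}
  {Z : Set ℤ} {m : ℤ → ℝ} {σ σ' : MixedRep V}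

/-! ### The assertions about one sweep -/

omit [DecidableEq V] in
theorem IsBase.white_start (M : Model G lo hi) (Λ : Layout lo hi σ₀)
    (h : SweepInv lo hi σ₀ Z m ∅ ∅ σ) {s : Step V} (hb : IsBase G σ s) :
    (σ s.a).L.red = false ∧ (σ s.a).R.red = false := by
  obtain ⟨b, -, -, -, h₁, h₂, -⟩ := hb.white M Λ h
  exact ⟨h₁, h₂⟩

omit [DecidableEq V] in
theorem SweepInv.mirror_empty (h : SweepInv lo hi σ₀ Z m ∅ ∅ σ) :
    SweepInv (fun v => -hi v) (fun v => -lo v) σ₀.mirror (negSet Z) (negPos m) ∅ ∅ σ.mirror := by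
  have := h.mirror
  rwa [negSet_empty] at this

omit [DecidableEq V] in
theorem mem_roles_swap {s : Step V} {v : V} : v ∈ s.swap.roles ↔ v ∈ s.roles := by
  rw [mem_roles, mem_roles]
  simp only [Step.swap]
  tauto

omit [DecidableEq V] in
theorem IsSweep.nodup (M : Model G lo hi) (Λ : Layout lo hi σ₀) {D : SweepData V}
    (h : SweepInv lo hi σ₀ Z m ∅ ∅ D.start) (hD : IsSweep G D) : D.roles.Nodup := by
  obtain ⟨hb, hl, hr⟩ := hD
  have hs := hb.stepOK M Λ h
  have hs' := hb.stepOK_swap M Λ h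
  obtain ⟨w₁, w₂⟩ := hb.white_start M Λ h
  have w₂' : (D.start.mirror D.base.swap.a).L.red = false := w₂
  have hlt := hs.lo_lt_hi M
  have hL := hl.roles_le M Λ h hs w₁
  have hR := hr.roles_le M.mirror Λ.mirror h.mirror_empty hs' w₂'
  have hLt : ∀ v ∈ D.left.flatMap Step.roles, hi v ≤ lo D.base.a := fun v hv => by
    obtain ⟨t, ht, hvt⟩ := List.mem_flatMap.1 hv
    exact hL t ht v hvt
  have hRt : ∀ v ∈ D.right.flatMap Step.roles, hi D.base.a ≤ lo v := fun v hv => by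
    obtain ⟨t, ht, hvt⟩ := List.mem_flatMap.1 hv
    have := hR t ht v hvt
    simp only [Step.swap] at this
    omega
  rw [SweepData.roles, SweepData.steps, List.flatMap_cons, List.flatMap_append,
    List.nodup_append, List.nodup_append]
  refine ⟨hs.roles_nodup, ⟨hl.nodup M Λ h hs w₁,
    hr.nodup M.mirror Λ.mirror h.mirror_empty hs' w₂', ?_⟩, ?_⟩
  · intro v hv w hw e
    subst e
    have := hLt v hv
    have := hRt v hw
    have := M.le v
    omega
  · intro v hv w hw e
    subst e
    rcases List.mem_append.1 hw with hw | hw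
    · have := hLt v hw
      have := hs.lt_hi M hv
      omega
    · have := hRt v hw
      have := hs'.lt_hi M.mirror (mem_roles_swap.2 hv)
      simp only [Step.swap] at this
      omega

theorem IsSweep.consistent (M : Model G lo hi) (Λ : Layout lo hi σ₀) {D : SweepData V}
    (h : SweepInv lo hi σ₀ Z m ∅ ∅ D.start) (hD : IsSweep G D) : D.Consistent where
  nodup := hD.nodup M Λ h
  left_lt := hD.2.1.lt M Λ h (hD.1.stepOK M Λ h) (hD.1.white_start M Λ h).1
  right_lt t ht d hd := by
    have := hD.2.2.lt M.mirror Λ.mirror h.mirror_empty (hD.1.stepOK_swap M Λ h)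
      (hD.1.white_start M Λ h).2 t ht d hd
    simpa [MixedRep.mirror_apply] using this
  lt v := by
    obtain ⟨Z', m', h', -⟩ := hD.effect M Λ h
    exact h'.lt v

namespace SweepEffect

variable {D : SweepData V} {Z' : Set ℤ} {m' : ℤ → ℝ}

/-- Red endpoints lie on old lines and stay there, and lines of different cliques are different; so
whatever lies on a new line was white before. -/
theorem start_ne (S : SweepEffect lo hi D Z m Z' m') (h : SweepInv lo hi σ₀ Z m ∅ ∅ D.start)
    (h' : SweepInv lo hi σ₀ Z' m' ∅ ∅ D.final) {v : V} {z : ℤ} (hz : z ∈ Z') (hz' : z ∉ Z) :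
    ((D.final v).L.pos = m' z → (D.start v).L.red = false) ∧
      ((D.final v).R.pos = m' z → (D.start v).R.red = false) := by
  constructor
  · intro e
    by_contra hc
    have hc : (D.start v).L.red = true := by simpa using hc
    obtain ⟨z', k₁, k₂⟩ := h.redL_pos hc
    rw [S.ext.keepL v hc, k₂, ← S.ext.pos z' k₁] at e
    exact hz' (h'.pos_inj (S.ext.sub k₁) hz e ▸ k₁)
  · intro e
    by_contra hc
    have hc : (D.start v).R.red = true := by simpa using hc
    obtain ⟨z', k₁, k₂⟩ := h.redR_pos hc
    rw [S.ext.keepR v hc, k₂, ← S.ext.pos z' k₁] at e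
    exact hz' (h'.pos_inj (S.ext.sub k₁) hz e ▸ k₁)

theorem endParticipates (S : SweepEffect lo hi D Z m Z' m')
    (h : SweepInv lo hi σ₀ Z m ∅ ∅ D.start) (h' : SweepInv lo hi σ₀ Z' m' ∅ ∅ D.final) {v : V}
    {s : Side} (hp : D.EndParticipates v s) :
    ((D.start v).pt s).red = false ∧ ((D.final v).pt s).red = true := by
  rcases hp with ⟨-, hx⟩ | ⟨rfl, hc⟩ | ⟨rfl, hc⟩
  · obtain ⟨z, k₁, k₂, k₃⟩ := S.of_line _ hx
    have := S.start_ne h h' (v := v) k₁ k₂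
    cases s
    · exact ⟨this.1 k₃.symm, h'.redL_of_pos k₁ k₃.symm⟩
    · exact ⟨this.2 k₃.symm, h'.redR_of_pos k₁ k₃.symm⟩
  · exact S.mergeC v hc
  · exact S.mergeD v hc

theorem role_of_red (S : SweepEffect lo hi D Z m Z' m') {v : V} {s : Side}
    (h₁ : ((D.start v).pt s).red = false) (h₂ : ((D.final v).pt s).red = true) :
    v ∈ D.roles := by
  by_contra hc
  rw [S.untouched v hc, h₁] at h₂
  cases h₂

end SweepEffect

omit [DecidableEq V] in
theorem SweepData.IsTypeA.mem_roles {D : SweepData V} {a : V} (h : D.IsTypeA a) :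
    a ∈ D.roles := by
  obtain ⟨t, ht, rfl⟩ := h
  exact List.mem_flatMap.2 ⟨t, ht, by simp [Step.roles]⟩

/-! ### The history of a zone line -/

/-- What is known about the zone line `x` of the sweep `D` after the sweeps in `later`. -/
structure LineInfo (lo hi : V → ℤ) (Z : Set ℤ) (m : ℤ → ℝ) (σ : MixedRep V) (D : SweepData V)
    (later : List (SweepData V)) (x : ℝ) (z : ℤ) : Prop where
  mem : z ∈ Z
  pos : m z = x
  top : ∃ a, D.IsTypeA a ∧ D.Participates a ∧ lo a = z ∧ (∀ u, lo u = z → hi u ≤ hi a) ∧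
    (σ a).L = ⟨x, true, true⟩
  bot : ∃ a, D.IsTypeA a ∧ D.Participates a ∧ hi a = z ∧ (∀ u, hi u = z → lo a ≤ lo u) ∧
    (σ a).R = ⟨x, true, true⟩
  openL : x ∈ D.leftLines → ∃ v, D.IsLeftTypeBC v ∧ (σ v).L = ⟨x, false, true⟩
  openR : x ∈ D.rightLines → ∃ v, D.IsRightTypeBD v ∧ (σ v).R = ⟨x, false, true⟩
  origin : ∀ v s, ((σ v).pt s).pos = x →
    D.Participates v ∨ ∃ E ∈ later,
      (E.IsMergingC v ∧ (E.final v).L.pos = x) ∨ (E.IsMergingD v ∧ (E.final v).R.pos = x)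

theorem SweepEffect.lineInfo {D : SweepData V} {Z' : Set ℤ} {m' : ℤ → ℝ}
    (S : SweepEffect lo hi D Z m Z' m') (h : SweepInv lo hi σ₀ Z m ∅ ∅ D.start)
    (h' : SweepInv lo hi σ₀ Z' m' ∅ ∅ D.final) {x : ℝ} (hx : D.IsZoneLine x) :
    ∃ z, LineInfo lo hi Z' m' D.final D [] x z := by
  obtain ⟨z, k₁, k₂, rfl⟩ := S.of_line x hx
  refine ⟨z, k₁, rfl, ?_, ?_, S.openL _, S.openR _, ?_⟩
  · obtain ⟨a, a₁, a₂, a₃, a₄⟩ := S.top z k₁ k₂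
    exact ⟨a, a₁, ⟨.left, .inl ⟨a₁.mem_roles, by
      simp only [MInterval.pt, a₄]; exact hx⟩⟩, a₂, a₃, a₄⟩
  · obtain ⟨a, a₁, a₂, a₃, a₄⟩ := S.bot z k₁ k₂
    exact ⟨a, a₁, ⟨.right, .inl ⟨a₁.mem_roles, by
      simp only [MInterval.pt, a₄]; exact hx⟩⟩, a₂, a₃, a₄⟩
  · intro v s hv
    left
    refine ⟨s, .inl ⟨?_, by rw [hv]; exact hx⟩⟩
    have := S.start_ne h h' (v := v) k₁ k₂
    cases s
    · exact S.role_of_red (s := .left) (this.1 hv) (h'.redL_of_pos k₁ hv)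
    · exact S.role_of_red (s := .right) (this.2 hv) (h'.redR_of_pos k₁ hv)

/-- An endpoint that turns red goes to a new line unless it belongs to a merging vertex. Everything
else on an old line was red already and has not moved. -/
theorem LineInfo.next {D E : SweepData V} {later : List (SweepData V)} {Z' : Set ℤ} {m' : ℤ → ℝ}
    {x : ℝ} {z : ℤ} (I : LineInfo lo hi Z m E.start D later x z)
    (S : SweepEffect lo hi E Z m Z' m') (h' : SweepInv lo hi σ₀ Z' m' ∅ ∅ E.final) :
    LineInfo lo hi Z' m' E.final D (later ++ [E]) x z where
  mem := S.ext.sub I.mem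
  pos := by rw [S.ext.pos z I.mem, I.pos]
  top := by
    obtain ⟨a, h₁, h₂, h₃, h₄, h₅⟩ := I.top
    exact ⟨a, h₁, h₂, h₃, h₄, by rw [S.ext.keepL a (by rw [h₅]), h₅]⟩
  bot := by
    obtain ⟨a, h₁, h₂, h₃, h₄, h₅⟩ := I.bot
    exact ⟨a, h₁, h₂, h₃, h₄, by rw [S.ext.keepR a (by rw [h₅]), h₅]⟩
  openL hx := by
    obtain ⟨v, h₁, h₂⟩ := I.openL hx
    exact ⟨v, h₁, by rw [S.ext.keepL v (by rw [h₂]), h₂]⟩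
  openR hx := by
    obtain ⟨v, h₁, h₂⟩ := I.openR hx
    exact ⟨v, h₁, by rw [S.ext.keepR v (by rw [h₂]), h₂]⟩
  origin v s hv := by
    have hold : ((E.start v).pt s).pos = x → D.Participates v ∨ ∃ F ∈ later ++ [E],
        (F.IsMergingC v ∧ (F.final v).L.pos = x) ∨ (F.IsMergingD v ∧ (F.final v).R.pos = x) := by
      intro hs
      rcases I.origin v s hs with k | ⟨F, k₁, k₂⟩
      · exact .inl k
      · exact .inr ⟨F, List.mem_append_left _ k₁, k₂⟩
    have hmz : m' z = x := by rw [S.ext.pos z I.mem, I.pos]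
    have hz := S.ext.sub I.mem
    cases s with
    | left =>
      have hr' := h'.redL_of_pos (v := v) hz (by rw [hmz]; exact hv)
      rcases hr : (E.start v).L.red with _ | _
      · rcases S.newL v hr hr' with ⟨z', k₁, k₂, k₃⟩ | k
        · have := h'.pos_inj hz k₁ (by rw [hmz, ← k₃]; exact hv.symm)
          exact absurd (this ▸ I.mem) k₂
        · exact .inr ⟨E, by simp, .inl ⟨k, hv⟩⟩
      · exact hold (by rw [← hv]; simp only [MInterval.pt]; rw [S.ext.keepL v hr])
    | right =>
      have hr' := h'.redR_of_pos (v := v) hz (by rw [hmz]; exact hv)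
      rcases hr : (E.start v).R.red with _ | _
      · rcases S.newR v hr hr' with ⟨z', k₁, k₂, k₃⟩ | k
        · have := h'.pos_inj hz k₁ (by rw [hmz, ← k₃]; exact hv.symm)
          exact absurd (this ▸ I.mem) k₂
        · exact .inr ⟨E, by simp, .inr ⟨k, hv⟩⟩
      · exact hold (by rw [← hv]; simp only [MInterval.pt]; rw [S.ext.keepR v hr])

omit [DecidableEq V] in
-- A closed endpoint on the line shares its ends with the longest vertex starting in that clique,
-- which is `a`. An open one shares its ends with a vertex that starts in the clique and must itself
-- be closed on the line, which reduces to the first case.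
theorem SweepInv.sameEnds_of_posL (M : Model G lo hi) (h : SweepInv lo hi σ₀ Z m ∅ ∅ σ) {v a : V}
    {z : ℤ} (hz : z ∈ Z) (ha : lo a = z) (hmax : ∀ u, lo u = z → hi u ≤ hi a)
    (hv : (σ v).L.pos = m z) : (σ v).SameEnds (σ a) := by
  have hclosed : ∀ w, (σ w).L.pos = m z → ClosedL lo hi Z m σ w → (σ w).SameEnds (σ a) := by
    intro w hw hc
    have e : lo w = z := h.pos_inj hc.mem hz (by rw [← hw, hc.eq])
    obtain ⟨a', h₁, h₂, -, h₃⟩ := hc.same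
    have h₄ := hmax a' (by omega)
    have h₅ := h₂ a (by omega)
    rwa [M.inj a' a (by omega) (by omega)] at h₃
  rcases h.left v (h.redL_of_pos hz hv) with hc | hc
  · exact hclosed v hv hc
  · have e : lo v - 1 = z := h.pos_inj hc.mem hz (by rw [← hv, hc.eq])
    obtain ⟨w, h₁, -, h₂⟩ := hc.same
    have hw : (σ w).L.pos = m z := by rw [← h₂.1, hv]
    rcases h.left w (h.redL_of_pos hz hw) with hc' | hc'
    · have h₃ := hclosed w hw hc'
      exact ⟨h₂.1.trans h₃.1, h₂.2.trans h₃.2⟩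
    · have : lo w - 1 = z := h.pos_inj hc'.mem hz (by rw [← hw, hc'.eq])
      omega

theorem LineInfo.zoneLineProps (M : Model G lo hi) (h : SweepInv lo hi σ₀ Z m ∅ ∅ σ)
    {D : SweepData V} {later : List (SweepData V)} {x : ℝ} {z : ℤ}
    (I : LineInfo lo hi Z m σ D later x z) : ZoneLineProps σ D later x where
  red v s hv := by
    cases s
    · exact h.redL_of_pos I.mem (by rw [I.pos]; exact hv)
    · exact h.redR_of_pos I.mem (by rw [I.pos]; exact hv)
  typeA := by
    obtain ⟨a, h₁, h₂, -, -, h₃⟩ := I.bot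
    obtain ⟨a', h₁', h₂', -, -, h₃'⟩ := I.top
    exact ⟨a, a', h₁, h₂, h₁', h₂', by rw [h₃], by rw [h₃']⟩
  sameEnds v s hv := by
    cases s with
    | left =>
      obtain ⟨a, h₁, h₂, h₃, h₄, -⟩ := I.top
      exact ⟨a, h₁, h₂, h.sameEnds_of_posL M I.mem h₃ h₄ (by rw [I.pos]; exact hv)⟩
    | right =>
      obtain ⟨a, h₁, h₂, h₃, h₄, -⟩ := I.bot
      refine ⟨a, h₁, h₂, ?_⟩
      have := h.mirror_empty.sameEnds_of_posL M.mirror (v := v) (a := a) (z := -z)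
        (by simpa using I.mem) (by simp [h₃])
        (fun u hu => by have := h₄ u (by omega); omega)
        (by simp only [MixedRep.mirror_apply, MInterval.mirror_L_pos, negPos, neg_neg, I.pos]
            rw [← hv]; rfl)
      simpa only [MixedRep.mirror_apply, MInterval.mirror_sameEnds] using this
  openLeft hx := by
    obtain ⟨v, h₁, h₂⟩ := I.openL hx
    exact ⟨v, h₁, by rw [h₂], by rw [h₂]⟩
  openRight hx := by
    obtain ⟨v, h₁, h₂⟩ := I.openR hx
    exact ⟨v, h₁, by rw [h₂], by rw [h₂]⟩
  origin := I.origin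

/-! ### Induction over the runs of the algorithm -/

omit [DecidableEq V] in
theorem Layout.sweepInv (Λ : Layout lo hi σ₀) (hlt : ∀ v, (σ₀ v).L.pos < (σ₀ v).R.pos) :
    SweepInv lo hi σ₀ ∅ m ∅ ∅ σ₀ := by
  have hL : ∀ v, (σ₀ v).L.red = false := fun v => Λ.white v .left
  have hR : ∀ v, (σ₀ v).R.red = false := fun v => Λ.white v .right
  refine ⟨fun v hv => ?_, fun v hv => ?_, fun _ _ => rfl, fun _ _ => rfl, ?_, ?_, ?_, ?_, ?_, ?_,
    fun _ _ _ h => h.elim, fun _ _ _ h => h.elim, fun _ _ _ h => h.elim, fun _ _ _ h => h.elim,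
    fun a b _ _ => .inl ⟨hL a, hR a, hL b, hR b⟩, fun _ x _ _ => hL x, fun _ x _ _ => hR x, hlt⟩
  · rw [hL] at hv; cases hv
  · rw [hR] at hv; cases hv
  all_goals exact fun _ h => h.elim

/-- What holds after the sweeps in `H`. -/
structure RunInfo (lo hi : V → ℤ) (σ₀ : MixedRep V) (H : List (SweepData V)) (σ : MixedRep V)
    (Z : Set ℤ) (m : ℤ → ℝ) : Prop where
  inv : SweepInv lo hi σ₀ Z m ∅ ∅ σ
  line : ∀ H₁ D H₂, H = H₁ ++ D :: H₂ → ∀ x, D.IsZoneLine x →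
    ∃ z, LineInfo lo hi Z m σ D H₂ x z
  nodup : (H.map fun D => D.base.a).Nodup
  red : ∀ D ∈ H, (σ D.base.a).L.red = true

/-- A sweep begins at a vertex whose left endpoint is white and leaves it red for good, so the
starting vertices of the sweeps are distinct; this bounds their number. -/
theorem IsRun.info (M : Model G lo hi) (Λ : Layout lo hi σ₀)
    (hlt : ∀ v, (σ₀ v).L.pos < (σ₀ v).R.pos) {H : List (SweepData V)} (hr : IsRun G σ₀ H σ) :
    ∃ Z m, RunInfo lo hi σ₀ H σ Z m := by
  induction hr with
  | nil =>
    refine ⟨∅, fun _ => 0, Λ.sweepInv hlt, ?_, by simp, by simp⟩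
    intro H₁ D H₂ h
    simp at h
  | @snoc H σ D _ hσ hD ih =>
    subst hσ
    obtain ⟨Z, m, R⟩ := ih
    obtain ⟨Z', m', h', S⟩ := hD.effect M Λ R.inv
    obtain ⟨b, -, b₁, b₂, -⟩ := S.base
    refine ⟨Z', m', h', ?_, ?_, ?_⟩
    · intro H₁ E H₂ hH x hx
      rcases List.eq_nil_or_concat H₂ with rfl | ⟨H₃, F, rfl⟩
      · obtain ⟨-, e⟩ := List.append_inj' hH rfl
        obtain rfl : D = E := by simpa using e
        exact S.lineInfo R.inv h' hx
      · rw [List.concat_eq_append] at hH ⊢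
        rw [← List.cons_append, ← List.append_assoc] at hH
        obtain ⟨e₁, e₂⟩ := List.append_inj' hH rfl
        obtain rfl : D = F := by simpa using e₂
        obtain ⟨z, I⟩ := R.line H₁ E H₃ e₁ x hx
        exact ⟨z, I.next S h'⟩
    · rw [List.map_append, List.map_singleton, List.nodup_append]
      refine ⟨R.nodup, by simp, fun v hv w hw e => ?_⟩
      rw [List.mem_singleton] at hw
      obtain ⟨E, hE, rfl⟩ := List.mem_map.1 hv
      have := R.red E hE
      rw [e, hw, b₁] at this
      cases this
    · intro E hE
      rcases List.mem_append.1 hE with hE | hE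
      · exact S.ext.redL (R.red E hE)
      · rw [List.mem_singleton] at hE
        rw [hE]; exact b₂

omit [DecidableEq V] in
theorem exists_sweep [Fintype V] (M : Model G lo hi) (Λ : Layout lo hi σ₀)
    (h : SweepInv lo hi σ₀ Z m ∅ ∅ σ) (htf : TwinFree G) {a b : V}
    (hab : (σ b).StrictlyIn (σ a)) :
    ∃! D : SweepData V, D.start = σ ∧ D.base.a = a ∧ D.base.b = some b ∧ IsSweep G D := by
  obtain ⟨c, hc⟩ := exists_picks fun v =>
    closedNbhd G v = closedNbhd G a \ {x | PeeksLeft σ x a b}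
  obtain ⟨d, hd⟩ := exists_picks fun v =>
    closedNbhd G v = closedNbhd G a \ {x | PeeksRight σ x a b}
  have hb : IsBase G σ ⟨a, some b, c, d⟩ := ⟨b, rfl, hab, hc, hd⟩
  have hs := hb.stepOK M Λ h
  have hs' := hb.stepOK_swap M Λ h
  obtain ⟨w₁, w₂⟩ := hb.white_start M Λ h
  have w₂' : (σ.mirror (Step.swap ⟨a, some b, c, d⟩).a).L.red = false := w₂
  obtain ⟨l, hl⟩ := exists_leftSteps M Λ h hs w₁
  obtain ⟨r, hr⟩ := exists_leftSteps M.mirror Λ.mirror h.mirror_empty hs' w₂'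
  refine ⟨⟨σ, ⟨a, some b, c, d⟩, l, r⟩, ⟨rfl, rfl, rfl, hb, hl, hr⟩, ?_⟩
  rintro ⟨σ', ⟨a', b', c', d'⟩, l', r'⟩ ⟨e₁, e₂, e₃, hb', hl', hr'⟩
  simp only at e₁ e₂ e₃
  subst e₁ e₂ e₃
  obtain ⟨b', h₁, -, hc', hd'⟩ := hb'
  simp only [Option.some.injEq] at h₁
  subst h₁
  -- Only the uniqueness of `c_0` and `d_0` appeals to twin-freeness directly.
  obtain rfl := picks_unique (fun u v hu hv => htf u v (hu.trans hv.symm)) hc hc'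
  obtain rfl := picks_unique (fun u v hu hv => htf u v (hu.trans hv.symm)) hd hd'
  rw [hl.unique M Λ h hs w₁ hl', hr.unique M.mirror Λ.mirror h.mirror_empty hs' w₂' hr']

theorem IsRun.invariants [Fintype V] {H : List (SweepData V)} (hyp : InitialHyp G σ₀)
    (hr : IsRun G σ₀ H σ) :
    (∀ v s, ((σ v).pt s).red = false → (σ v).pt s = (σ₀ v).pt s) ∧
    (∀ u v, (σ u).StrictlyIn (σ v) →
      (∀ s, ((σ u).pt s).red = false ∧ ((σ v).pt s).red = false) ∧
      (∀ x, PeeksLeft σ x v u → (σ x).R.red = false) ∧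
      (∀ x, PeeksRight σ x v u → (σ x).L.red = false)) ∧
    (∀ a b, (σ b).StrictlyIn (σ a) →
      ∃! D : SweepData V, D.start = σ ∧ D.base.a = a ∧ D.base.b = some b ∧ IsSweep G D) ∧
    (∀ D : SweepData V, D.start = σ → IsSweep G D →
      D.Consistent ∧
      (∀ v s, D.EndParticipates v s →
        ((σ v).pt s).red = false ∧ ((D.final v).pt s).red = true) ∧
      (∀ v s, ((σ v).pt s).red = true → (D.final v).pt s = (σ v).pt s)) ∧
    (∀ (H₁ : List (SweepData V)) (D : SweepData V) (H₂ : List (SweepData V)),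
      H = H₁ ++ D :: H₂ → ∀ x, D.IsZoneLine x → ZoneLineProps σ D H₂ x) ∧
    Represents σ G ∧ H.length ≤ Fintype.card V := by
  obtain ⟨lo, hi, M, Λ⟩ := exists_model hyp
  obtain ⟨Z, m, R⟩ := hr.info M Λ hyp.lt
  have h := R.inv
  refine ⟨?_, ?_, fun a b => exists_sweep M Λ h hyp.twinFree, ?_, ?_, h.represents Λ M, ?_⟩
  · intro v s hv
    cases s
    · exact h.whiteL v hv
    · exact h.whiteR v hv
  · intro u v huv
    obtain ⟨h₁, h₂, h₃, h₄, h₅, h₆⟩ := (h.strictlyIn_iff Λ M).1 huv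
    have e₁ := nested_lo M h₁ h₂
    have e₂ := nested_hi M h₁ h₂
    have lu := M.le u
    refine ⟨fun s => ?_, fun x hx => ?_, fun x hx => ?_⟩
    · cases s
      · exact ⟨h₅, h₃⟩
      · exact ⟨h₆, h₄⟩
    · rw [h.peeksLeft_iff Λ] at hx
      exact h.block_white M (.base h₁ h₂) h₃ (by omega)
    · rw [h.peeksRight_iff Λ] at hx
      exact h.mirror_empty.block_white M.mirror (v := x) (RLink.base h₁ h₂) h₄ (by omega)
  · rintro D rfl hD
    obtain ⟨Z', m', h', S⟩ := hD.effect M Λ h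
    refine ⟨hD.consistent M Λ h, fun v s => S.endParticipates h h', fun v s hv => ?_⟩
    cases s
    · exact S.ext.keepL v hv
    · exact S.ext.keepR v hv
  · intro H₁ D H₂ hH x hx
    obtain ⟨z, I⟩ := R.line H₁ D H₂ hH x hx
    exact I.zoneLineProps M h
  · have := R.nodup.length_le_card
    rwa [List.length_map] at this

end Runs

section Program

variable {V : Type u}

/-! ### The program: elementary computations -/

namespace Timed

variable {α β : Type*}

@[simp] theorem charge_val (k : ℕ) (x : α) : (charge k x).val = x := rfl
@[simp] theorem charge_time (k : ℕ) (x : α) : (charge k x).time = k := rfl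
@[simp] theorem bind_val (x : Timed α) (f : α → Timed β) : (x.bind f).val = (f x.val).val := rfl
@[simp] theorem bind_time (x : Timed α) (f : α → Timed β) :
    (x.bind f).time = x.time + (f x.val).time := rfl

end Timed

theorem scan_val (p : V → Timed Bool) (l : List V) :
    (scan p l).val = l.filter fun v => (p v).val := by
  induction l with
  | nil => rfl
  | cons v l ih =>
    rw [scan, List.filter_cons]
    simp only [Timed.bind_val, Timed.charge_val, ih]

theorem scan_time_le {p : V → Timed Bool} {k : ℕ} (hp : ∀ v, (p v).time ≤ k) (l : List V) :
    (scan p l).time ≤ (k + 1) * l.length + 1 := by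
  induction l with
  | nil => simp [scan]
  | cons v l ih =>
    have := hp v
    simp only [scan, Timed.bind_time, Timed.charge_time, List.length_cons]
    linarith

theorem count_val (p : V → Timed Bool) (l : List V) :
    (count p l).val = (l.filter fun v => (p v).val).length := by
  induction l with
  | nil => rfl
  | cons v l ih =>
    rw [count, List.filter_cons]
    simp only [Timed.bind_val, Timed.charge_val, ih]
    split_ifs <;> simp

theorem count_time_le {p : V → Timed Bool} {k : ℕ} (hp : ∀ v, (p v).time ≤ k) (l : List V) :
    (count p l).time ≤ (k + 1) * l.length + 1 := by
  induction l with
  | nil => simp [count]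
  | cons v l ih =>
    have := hp v
    simp only [count, Timed.bind_time, Timed.charge_time, List.length_cons]
    linarith

theorem tabulate_time_le {β : Type*} {f : V → Timed β} {k : ℕ} (hf : ∀ v, (f v).time ≤ k)
    (l : List V) : (tabulate f l).time ≤ (k + 1) * l.length := by
  simp only [tabulate]
  induction l with
  | nil => simp
  | cons v l ih =>
    have := hf v
    simp only [List.map_cons, List.sum_cons, List.length_cons]
    linarith

theorem head?_of_picks {P : V → Prop} (hP : ∀ u v, P u → P v → u = v) {l : List V}
    (hl : ∀ v, v ∈ l ↔ P v) {o : Option V} (ho : Picks P o) : l.head? = o := by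
  refine picks_unique hP ?_ ho
  cases l with
  | nil => exact fun v hv => by simpa using (hl v).2 hv
  | cons v l => exact (hl v).1 (.head _)

theorem length_le_two {l : List V} (hn : l.Nodup)
    (h : ∀ p ∈ l, ∀ q ∈ l, ∀ r ∈ l, p = q ∨ q = r ∨ p = r) : l.length ≤ 2 := by
  match l with
  | [] => simp
  | [_] => simp
  | [_, _] => simp
  | p :: q :: r :: l =>
    simp only [List.nodup_cons, List.mem_cons, not_or] at hn
    rcases h p (by simp) q (by simp) r (by simp) with h | h | h
    · exact absurd h hn.1.1
    · exact absurd h hn.2.1.1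
    · exact absurd h hn.1.2.1

/-! ### The tables -/

/-- The tables answer queries about the graph correctly. -/
structure Tables.Correct (G : SimpleGraph V) (T : Tables V) : Prop where
  meets : ∀ u v, (T.init u).meetsTest (T.init v) = true ↔ u ∈ closedNbhd G v
  trim : ∀ a X v, X.Nodup → (∀ x ∈ X, x ∈ closedNbhd G a) →
    ((trimTest T a X v).val = true ↔ closedNbhd G v = closedNbhd G a \ {x | x ∈ X})

/-- The non-neighbours of a vertex split into those before and those after it. Sets of either kind
are linearly ordered by inclusion, so comparing their sizes decides inclusion, and the equation
between the totals then forces equality. Counters thus replace a comparison of whole neighbourhoods.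
-/
theorem Model.nbhd_eq_iff [Fintype V] {G : SimpleGraph V} {lo hi : V → ℤ} (M : Model G lo hi)
    {a v : V} {X : Finset V} (hX : ∀ x ∈ X, x ∈ closedNbhd G a) :
    closedNbhd G v = closedNbhd G a \ {x | x ∈ X} ↔
      (v ∈ closedNbhd G a ∧
        (Finset.univ.filter fun w => hi w < lo a).card ≤
          (Finset.univ.filter fun w => hi w < lo v).card ∧
        (Finset.univ.filter fun w => hi a < lo w).card ≤
          (Finset.univ.filter fun w => hi v < lo w).card ∧
        (Finset.univ.filter fun w => hi w < lo v).card +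
          (Finset.univ.filter fun w => hi v < lo w).card =
        (Finset.univ.filter fun w => hi w < lo a).card +
          (Finset.univ.filter fun w => hi a < lo w).card + X.card ∧
        ∀ x ∈ X, x ∉ closedNbhd G v) := by
  classical
  set B : V → Finset V := fun u => Finset.univ.filter fun w => hi w < lo u with hB
  set A : V → Finset V := fun u => Finset.univ.filter fun w => hi u < lo w with hA
  have mB : ∀ u w, w ∈ B u ↔ hi w < lo u := fun u w => by simp [hB]
  have mA : ∀ u w, w ∈ A u ↔ hi u < lo w := fun u w => by simp [hA]
  have hdisj : ∀ u, Disjoint (B u) (A u) := fun u => Finset.disjoint_left.2 fun w hw hw' => by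
    rw [mB] at hw
    rw [mA] at hw'
    have := M.le u
    have := M.le w
    omega
  have hmem : ∀ u w, w ∈ closedNbhd G u ↔ w ∉ B u ∪ A u := fun u w => by
    rw [M.mem_nbhd, Finset.mem_union, mB, mA]
    omega
  have hcard : ∀ u, (B u ∪ A u).card = (B u).card + (A u).card := fun u =>
    Finset.card_union_of_disjoint (hdisj u)
  have hXdisj : Disjoint (B a ∪ A a) X := Finset.disjoint_right.2 fun x hx =>
    (hmem a x).1 (hX x hx)
  have hXcard : (B a ∪ A a ∪ X).card = (B a).card + (A a).card + X.card := by
    rw [Finset.card_union_of_disjoint hXdisj, hcard]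
  constructor
  · intro h
    have hv : v ∈ closedNbhd G a := by
      have : v ∈ closedNbhd G v := .inl rfl
      rw [h] at this
      exact this.1
    have hva := M.mem_nbhd.1 hv
    have hset : B v ∪ A v = B a ∪ A a ∪ X := by
      ext w
      have := Set.ext_iff.1 h w
      rw [Set.mem_sdiff, hmem, hmem] at this
      rw [Finset.mem_union (s := B a ∪ A a)]
      simp only [Set.mem_ofPred_eq] at this
      tauto
    have hBA : ∀ w, w ∈ B a ∪ A a → w ∈ B v ∪ A v := fun w hw => by
      rw [hset]
      exact Finset.mem_union_left _ hw
    refine ⟨hv, Finset.card_le_card fun w hw => ?_, Finset.card_le_card fun w hw => ?_, ?_, ?_⟩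
    · have := hBA w (Finset.mem_union_left _ hw)
      rw [Finset.mem_union, mB, mA] at this
      rw [mB] at hw ⊢
      have := M.le w
      omega
    · have := hBA w (Finset.mem_union_right _ hw)
      rw [Finset.mem_union, mB, mA] at this
      rw [mA] at hw ⊢
      have := M.le w
      omega
    · rw [← hcard, hset, hXcard]
    · intro x hx
      rw [h]
      exact fun h' => h'.2 hx
  · rintro ⟨hv, h₁, h₂, h₃, h₄⟩
    have hBs : B a ⊆ B v := by
      by_contra hc
      have hlt : lo v < lo a := by
        by_contra hle
        exact hc fun w hw => by rw [mB] at hw ⊢; omega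
      have : B v ⊂ B a := ⟨fun w hw => by rw [mB] at hw ⊢; omega, hc⟩
      exact absurd h₁ (not_le.2 (Finset.card_lt_card this))
    have hAs : A a ⊆ A v := by
      by_contra hc
      have hlt : hi a < hi v := by
        by_contra hle
        exact hc fun w hw => by rw [mA] at hw ⊢; omega
      have : A v ⊂ A a := ⟨fun w hw => by rw [mA] at hw ⊢; omega, hc⟩
      exact absurd h₂ (not_le.2 (Finset.card_lt_card this))
    have hXs : X ⊆ B v ∪ A v := fun x hx => by
      by_contra hc
      exact h₄ x hx ((hmem v x).2 hc)
    have hset : B a ∪ A a ∪ X = B v ∪ A v := by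
      refine Finset.eq_of_subset_of_card_le
        (Finset.union_subset (Finset.union_subset_union hBs hAs) hXs) ?_
      rw [hXcard, hcard, h₃]
    ext w
    rw [Set.mem_sdiff, hmem, hmem, ← hset, Finset.mem_union (s := B a ∪ A a)]
    simp only [Set.mem_ofPred_eq]
    tauto

theorem length_filter_eq_card [Fintype V] {vs : List V} (hn : vs.Nodup) (hvs : ∀ v, v ∈ vs)
    (p : V → Bool) (q : V → Prop) [DecidablePred q] (hpq : ∀ v, p v = true ↔ q v) :
    (vs.filter p).length = (Finset.univ.filter q).card := by
  classical
  rw [← List.toFinset_card_of_nodup (hn.filter p)]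
  congr 1
  ext v
  simp [hvs, hpq]

theorem makeTables_correct [Fintype V] {G : SimpleGraph V} {σ₀ : MixedRep V}
    (hyp : InitialHyp G σ₀) {vs : List V} (hn : vs.Nodup) (hvs : ∀ v, v ∈ vs) :
    (makeTables vs σ₀).val.Correct G := by
  classical
  obtain ⟨lo, hi, M, Λ⟩ := exists_model hyp
  have h := Λ.sweepInv (m := fun _ => 0) hyp.lt
  have hmeets : ∀ u v, (σ₀ u).meetsTest (σ₀ v) = true ↔ u ∈ closedNbhd G v := fun u v => by
    rw [MInterval.meetsTest_iff (hyp.lt u) (hyp.lt v), h.meets_iff Λ, M.mem_nbhd]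
  have hB : ∀ v, (makeTables vs σ₀).val.before v =
      (Finset.univ.filter fun w => hi w < lo v).card := fun v => by
    simp only [makeTables, Timed.bind_val, Timed.charge_val, tabulate, count_val]
    refine length_filter_eq_card hn hvs _ _ fun w => ?_
    rw [decide_eq_true_eq, ← not_le, ← Λ.reach, not_le]
  have hA : ∀ v, (makeTables vs σ₀).val.after v =
      (Finset.univ.filter fun w => hi v < lo w).card := fun v => by
    simp only [makeTables, Timed.bind_val, Timed.charge_val, tabulate, count_val]
    refine length_filter_eq_card hn hvs _ _ fun w => ?_
    rw [decide_eq_true_eq, ← not_le, ← Λ.reach, not_le]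
  have hinit : (makeTables vs σ₀).val.init = σ₀ := rfl
  refine ⟨fun u v => by rw [hinit, hmeets], fun a X v hX hXa => ?_⟩
  have key := M.nbhd_eq_iff (a := a) (v := v) (X := X.toFinset)
    (fun x hx => hXa x (List.mem_toFinset.1 hx))
  simp only [List.mem_toFinset, List.toFinset_card_of_nodup hX] at key
  rw [key]
  simp only [trimTest, Timed.charge_val, Bool.and_eq_true, decide_eq_true_eq, hA, hB, hinit,
    hmeets, List.all_eq_true, Bool.not_eq_true', ← Bool.not_eq_true, and_assoc]
  have hsymm : ∀ x, v ∈ closedNbhd G x ↔ x ∈ closedNbhd G v := fun x => by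
    rw [M.mem_nbhd, M.mem_nbhd]; tauto
  simp only [hsymm]

theorem makeTables_time_le (vs : List V) (σ₀ : MixedRep V) :
    (makeTables vs σ₀).time ≤ 5 * (vs.length + 1) ^ 2 := by
  have h₁ := tabulate_time_le (fun v => count_time_le (p := fun w =>
    .charge 1 (decide ((σ₀ w).R.pos < (σ₀ v).L.pos))) (k := 1) (fun _ => le_rfl) vs) vs
  have h₂ := tabulate_time_le (fun v => count_time_le (p := fun w =>
    .charge 1 (decide ((σ₀ v).R.pos < (σ₀ w).L.pos))) (k := 1) (fun _ => le_rfl) vs) vs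
  simp only [makeTables, Timed.bind_time, Timed.charge_time]
  -- With `n = vs.length`, each table costs at most `(2n + 2)n`, and storing adds `n`.
  nlinarith

end Program

section FindSteps

variable {V : Type u} {G : SimpleGraph V} {lo hi : V → ℤ} {σ₀ : MixedRep V}
  {Z : Set ℤ} {m : ℤ → ℝ} {σ : MixedRep V}

/-! ### The program: identification -/

/-- What `findSteps` does once the vertices of type a and c are known. -/
noncomputable def findRest (vs : List V) (T : Tables V) (σ : MixedRep V) (k : ℕ) (s : Step V)
    (a : V) (c : Option V) : Timed (List (Step V)) :=
  (scan (fun u => .charge 1 ((σ u).strictTest (σ a))) vs).bind fun bs =>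
    if (bs.isEmpty && c.isNone) || (c.isSome && (σ a).L.red) then
      .charge 1 [⟨a, bs.head?, c, none⟩]
    else
      (scan (trimTest T a (trimList T s a)) vs).bind fun ds =>
      (findSteps vs T σ k ⟨a, bs.head?, c, ds.head?⟩).bind fun r =>
        .charge 1 (⟨a, bs.head?, c, ds.head?⟩ :: r)

/-- The scan may list two peeking vertices in either order; comparing right endpoints puts the one
of type a first. -/
theorem findSteps_succ {vs : List V} {T : Tables V} {k : ℕ} {s : Step V} {a : V} {c : Option V}
    (h : (c = none ∧ (findPeekers vs σ s).val = [a]) ∨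
      ∃ c', c = some c' ∧ (σ a).R.pos < (σ c').R.pos ∧
        ((findPeekers vs σ s).val = [a, c'] ∨ (findPeekers vs σ s).val = [c', a])) :
    (findSteps vs T σ (k + 1) s).val = (findRest vs T σ k s a c).val ∧
      (findSteps vs T σ (k + 1) s).time =
        (findPeekers vs σ s).time + (findRest vs T σ k s a c).time := by
  rcases h with ⟨rfl, h⟩ | ⟨c', rfl, hlt, h | h⟩
  · simp only [findSteps, Timed.bind_val, Timed.bind_time, h]
    exact ⟨rfl, rfl⟩
  · simp only [findSteps, Timed.bind_val, Timed.bind_time, h, if_pos hlt]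
    exact ⟨rfl, rfl⟩
  · simp only [findSteps, Timed.bind_val, Timed.bind_time, h, if_neg hlt.not_gt]
    exact ⟨rfl, rfl⟩

theorem findPeekers_time_le (vs : List V) (σ : MixedRep V) (s : Step V) :
    (findPeekers vs σ s).time ≤ 2 * vs.length + 1 :=
  scan_time_le (k := 1) (fun _ => le_rfl) vs

theorem trimTest_scan_time_le (vs : List V) (T : Tables V) (a : V) {X : List V}
    (hX : X.length ≤ 2) : (scan (trimTest T a X) vs).time ≤ 4 * vs.length + 1 :=
  scan_time_le (fun _ => by simp only [trimTest, Timed.charge_time]; omega) vs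

theorem trimList_length_le (T : Tables V) (s : Step V) (a : V) :
    (trimList T s a).length ≤ 2 := by
  refine (List.length_filter_le _ _).trans ?_
  cases s.d <;> simp

theorem SweepInv.peekTest_iff (h : SweepInv lo hi σ₀ Z m ∅ ∅ σ) {x a b : V} :
    peekTest σ x a b = true ↔ PeeksLeft σ x a b := by
  simp only [peekTest, PeeksLeft, Bool.and_eq_true, Bool.not_eq_true', ← Bool.not_eq_true,
    decide_eq_true_eq, MInterval.meetsTest_iff (h.lt _) (h.lt _), and_assoc]

theorem eq_singleton_of_mem {l : List V} (hn : l.Nodup) {a : V} (h : ∀ v, v ∈ l ↔ v = a) :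
    l = [a] := by
  have : l.Perm [a] := (List.perm_ext_iff_of_nodup hn (by simp)).2 fun v => by simp [h]
  exact List.perm_singleton.1 this

theorem eq_pair_of_mem {l : List V} (hn : l.Nodup) {a c : V} (hac : a ≠ c)
    (h : ∀ v, v ∈ l ↔ v = a ∨ v = c) : l = [a, c] ∨ l = [c, a] := by
  have hp : l.Perm [a, c] :=
    (List.perm_ext_iff_of_nodup hn (by simp [hac])).2 fun v => by simp [h]
  match l, hp with
  | [x, y], hp =>
    have hx := (h x).1 (by simp)
    have hy := (h y).1 (by simp)
    have hxy : x ≠ y := by simpa using hn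
    rcases hx with rfl | rfl <;> rcases hy with rfl | rfl
    · exact absurd rfl hxy
    · exact .inl rfl
    · exact .inr rfl
    · exact absurd rfl hxy
  | [], hp => simpa using hp.length_eq
  | [_], hp => simpa using hp.length_eq
  | _ :: _ :: _ :: _, hp => simpa using hp.length_eq

theorem NextStep.findPeekers (h : SweepInv lo hi σ₀ Z m ∅ ∅ σ) {vs : List V} (hn : vs.Nodup)
    (hvs : ∀ v, v ∈ vs) {s t : Step V} (ht : NextStep G σ s t) :
    (t.c = none ∧ (findPeekers vs σ s).val = [t.a]) ∨
      ∃ c', t.c = some c' ∧ (σ t.a).R.pos < (σ c').R.pos ∧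
        ((_root_.findPeekers vs σ s).val = [t.a, c'] ∨
          (_root_.findPeekers vs σ s).val = [c', t.a]) := by
  have hmem : ∀ v, v ∈ (_root_.findPeekers vs σ s).val ↔ v ∈ peekers σ s := by
    intro v
    simp only [_root_.findPeekers, scan_val, List.mem_filter, hvs, true_and, Timed.charge_val,
      Bool.or_eq_true, Option.any_eq_true, h.peekTest_iff]
    rfl
  have hnd : (_root_.findPeekers vs σ s).val.Nodup := by
    simp only [_root_.findPeekers, scan_val]
    exact hn.filter _
  rcases ht.1 with ⟨h₁, h₂⟩ | ⟨c, h₁, h₂, h₃⟩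
  · left
    refine ⟨h₁, eq_singleton_of_mem hnd fun v => ?_⟩
    rw [hmem, h₂, Set.mem_singleton_iff]
  · right
    refine ⟨c, h₁, h₃, eq_pair_of_mem hnd ?_ fun v => ?_⟩
    · intro e; rw [e] at h₃; exact lt_irrefl _ h₃
    · rw [hmem, h₂]
      simp

theorem NextStep.head?_b (M : Model G lo hi) (Λ : Layout lo hi σ₀)
    (h : SweepInv lo hi σ₀ Z m ∅ ∅ σ) {vs : List V} (hvs : ∀ v, v ∈ vs) {s t : Step V}
    (ht : NextStep G σ s t) :
    (vs.filter fun u => (σ u).strictTest (σ t.a)).head? = t.b := by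
  refine head?_of_picks (fun u v hu hv => ?_) (fun v => ?_) ht.2.1
  · have hu' := (h.strictlyIn_iff Λ M).1 hu
    have hv' := (h.strictlyIn_iff Λ M).1 hv
    exact M.inj u v (by rw [nested_lo M hu'.1 hu'.2.1, nested_lo M hv'.1 hv'.2.1])
      (by rw [nested_hi M hu'.1 hu'.2.1, nested_hi M hv'.1 hv'.2.1])
  · rw [List.mem_filter, MInterval.strictTest_iff (h.lt _) (h.lt _)]
    exact and_iff_right (hvs v)

theorem Tables.Correct.head?_trim {T : Tables V} (hT : T.Correct G) (htf : TwinFree G)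
    {vs : List V} (hvs : ∀ v, v ∈ vs) {a : V} {X : List V} (hX : X.Nodup)
    (hXa : ∀ x ∈ X, x ∈ closedNbhd G a) {S : Set V} (hS : ∀ x, x ∈ X ↔ x ∈ S) {o : Option V}
    (ho : Picks (fun v => closedNbhd G v = closedNbhd G a \ S) o) :
    (scan (trimTest T a X) vs).val.head? = o := by
  have e : {x | x ∈ X} = S := Set.ext hS
  refine head?_of_picks (fun u v hu hv => htf u v (hu.trans hv.symm)) (fun v => ?_) ho
  rw [scan_val, List.mem_filter, hT.trim a X v hX hXa, e]
  exact and_iff_right (hvs v)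

/-- The filter removes nothing, as `s.a` and `s.d` start exactly where `a` ends. -/
theorem StepOK.mem_trimList (M : Model G lo hi) {T : Tables V} (hT : T.Correct G) {s : Step V}
    (hs : StepOK lo hi s) {a : V} (ha : hi a = lo s.a) :
    (trimList T s a).Nodup ∧ (∀ x ∈ trimList T s a, x ∈ closedNbhd G a) ∧
      ∀ x, x ∈ trimList T s a ↔ x ∈ {x | x = s.a ∨ s.d = some x} := by
  have la := M.le a
  have hlt := hs.lo_lt_hi M
  refine ⟨List.Nodup.filter _ ?_, fun x hx => ?_, fun x => ?_⟩
  · cases hd : s.d with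
    | none => simp
    | some d =>
      have hne : s.a ≠ d := by
        rintro e
        have := hs.d d hd
        rw [← e] at this
        omega
      simp [hne]
  · rw [trimList, List.mem_filter, hT.meets] at hx
    exact hx.2
  · rw [trimList, List.mem_filter, hT.meets, M.mem_nbhd]
    simp only [List.mem_cons, Option.mem_toList, Set.mem_ofPred_eq]
    constructor
    · exact fun h => h.1
    · rintro (rfl | hx)
      · exact ⟨.inl rfl, by omega, by omega⟩
      · have := hs.d x hx
        exact ⟨.inr hx, by omega, by omega⟩

theorem LeftSteps.findSteps (M : Model G lo hi) (Λ : Layout lo hi σ₀)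
    (h : SweepInv lo hi σ₀ Z m ∅ ∅ σ) (htf : TwinFree G) {T : Tables V} (hT : T.Correct G)
    {vs : List V} (hn : vs.Nodup) (hvs : ∀ v, v ∈ vs) {s : Step V} {l : List (Step V)}
    (hl : LeftSteps G σ s l) (hs : StepOK lo hi s) (hw : (σ s.a).L.red = false) {k : ℕ}
    (hk : l.length ≤ k) :
    (findSteps vs T σ k s).val = l ∧
      (_root_.findSteps vs T σ k s).time ≤ 8 * (vs.length + 1) * l.length := by
  have hpk := findPeekers_time_le vs σ
  have hend : ∀ {s t : Step V}, NextStep G σ s t →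
      (((vs.filter fun u => (σ u).strictTest (σ t.a)).isEmpty && t.c.isNone ||
        t.c.isSome && (σ t.a).L.red) = true ↔ t.Terminal ∨ t.Merging σ) := by
    intro s t ht
    have hb := ht.head?_b M Λ h hvs
    have e : (vs.filter fun u => (σ u).strictTest (σ t.a)).isEmpty = t.b.isNone := by
      rw [← hb]
      cases vs.filter fun u => (σ u).strictTest (σ t.a) <;> rfl
    rw [e]
    cases hb' : t.b <;> cases hc' : t.c <;>
      simp [Step.Terminal, Step.Merging, hb', hc']
  have hscan : ∀ a, (scan (fun u => Timed.charge 1 ((σ u).strictTest (σ a))) vs).val =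
      vs.filter fun u => (σ u).strictTest (σ a) := fun a => scan_val _ _
  have hscan_time : ∀ a, (scan (fun u => Timed.charge 1 ((σ u).strictTest (σ a))) vs).time ≤
      2 * vs.length + 1 := fun a => scan_time_le (k := 1) (fun _ => le_rfl) vs
  induction hl generalizing k with
  | @finish s t ht hfin =>
    obtain ⟨k, rfl⟩ : ∃ k', k = k' + 1 := ⟨k - 1, by simp at hk; omega⟩
    obtain ⟨e₁, e₂⟩ := findSteps_succ (T := T) (k := k) (ht.findPeekers h hn hvs)
    have hif := (hend ht).2 hfin
    have hb := ht.head?_b M Λ h hvs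
    have h₁ := hpk s
    have h₂ := hscan_time t.a
    rw [e₁, e₂]
    simp only [findRest, Timed.bind_val, Timed.bind_time, hscan, hif, if_true, Timed.charge_val,
      Timed.charge_time, hb, List.length_singleton]
    exact ⟨trivial, by omega⟩
  | @cont s t l ht hfin hl ih =>
    obtain ⟨k, rfl⟩ : ∃ k', k = k' + 1 := ⟨k - 1, by simp at hk; omega⟩
    obtain ⟨e₁, e₂⟩ := findSteps_succ (T := T) (k := k) (ht.findPeekers h hn hvs)
    have hif := (not_congr (hend ht)).2 hfin
    have hb := ht.head?_b M Λ h hvs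
    have o := ht.nextOK M Λ h hs hw
    have hs' := hs.next M o (o.link_of_cont hfin) ht.2.2
    obtain ⟨x₁, x₂, x₃⟩ := hs.mem_trimList M hT o.hi_a
    have hd := hT.head?_trim htf hvs x₁ x₂ x₃ ht.2.2
    obtain ⟨i₁, i₂⟩ := ih hs' (o.white_of_cont hfin) (k := k) (by simpa using hk)
    have h₁ := hpk s
    have h₂ := hscan_time t.a
    have h₃ := trimTest_scan_time_le vs T t.a (trimList_length_le T s t.a)
    rw [e₁, e₂]
    simp only [findRest, Timed.bind_val, Timed.bind_time, hscan, if_neg hif, Timed.charge_val,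
      Timed.charge_time, hb, hd, List.length_cons, i₁]
    -- One round costs at most `2(2n + 1) + (4n + 1) + 1`, which is less than `8(n + 1)`.
    exact ⟨trivial, by linarith⟩

end FindSteps

section Termination

variable {V : Type u} [DecidableEq V] {G : SimpleGraph V} {lo hi : V → ℤ} {σ₀ : MixedRep V}
  {Z : Set ℤ} {m : ℤ → ℝ} {σ : MixedRep V}

/-! ### The program: sweeps -/

omit [DecidableEq V] in
theorem map_a_sublist (l : List (Step V)) : (l.map Step.a).Sublist (l.flatMap Step.roles) := by
  induction l with
  | nil => simp
  | cons t l ih =>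
    rw [List.map_cons, List.flatMap_cons, Step.roles, List.cons_append]
    exact (ih.trans (List.sublist_append_right _ _)).cons_cons _

theorem IsSweep.sweepOnce [Fintype V] (M : Model G lo hi) (Λ : Layout lo hi σ₀) {D : SweepData V}
    (h : SweepInv lo hi σ₀ Z m ∅ ∅ D.start) (htf : TwinFree G) {T : Tables V} (hT : T.Correct G)
    {vs : List V} (hn : vs.Nodup) (hvs : ∀ v, v ∈ vs) (hD : IsSweep G D) {b : V}
    (hb : D.base.b = some b) :
    (sweepOnce vs T D.start D.base.a b).val = D.final ∧
      (_root_.sweepOnce vs T D.start D.base.a b).time ≤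
        18 * (vs.length + 1) * D.steps.length := by
  have hnd := hD.nodup M Λ h
  obtain ⟨σ, ⟨a, b', c, d⟩, l, r⟩ := D
  simp only at hb
  subst hb
  obtain ⟨hbase, hl, hr⟩ := hD
  simp only at h hbase hl hr
  have hs := hbase.stepOK M Λ h
  have hs' := hbase.stepOK_swap M Λ h
  obtain ⟨w₁, w₂⟩ := hbase.white_start M Λ h
  have w₂' : (σ.mirror (Step.swap ⟨a, some b, c, d⟩).a).L.red = false := w₂
  obtain ⟨b', hb', hba, hc, hd⟩ := hbase
  simp only [Option.some.injEq] at hb'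
  subst hb'
  simp only at hba hc hd
  obtain ⟨n₁, n₂, -⟩ := (h.strictlyIn_iff Λ M).1 hba
  have e₁ := nested_lo M n₁ n₂
  have e₂ := nested_hi M n₁ n₂
  set X := (scan (fun x => Timed.charge 1 (peekTest σ x a b)) vs) with hX
  set Y := (scan (fun x => Timed.charge 1 (peekTest σ.mirror x a b)) vs) with hY
  have mX : ∀ x, x ∈ X.val ↔ PeeksLeft σ x a b := fun x => by
    simp only [hX, scan_val, List.mem_filter, hvs, true_and, Timed.charge_val, h.peekTest_iff]
  have mY : ∀ x, x ∈ Y.val ↔ PeeksRight σ x a b := fun x => by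
    simp only [hY, scan_val, List.mem_filter, hvs, true_and, Timed.charge_val,
      h.mirror_empty.peekTest_iff, peeksLeft_mirror]
  have nX : X.val.Nodup := by rw [hX, scan_val]; exact hn.filter _
  have nY : Y.val.Nodup := by rw [hY, scan_val]; exact hn.filter _
  have cX : ∀ x ∈ X.val, x ∈ closedNbhd G a ∧ hi x = lo a := fun x hx => by
    rw [mX, h.peeksLeft_iff Λ] at hx
    rw [M.mem_nbhd]
    omega
  have cY : ∀ x ∈ Y.val, x ∈ closedNbhd G a ∧ lo x = hi a := fun x hx => by
    rw [mY, h.peeksRight_iff Λ] at hx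
    rw [M.mem_nbhd]
    omega
  have lX : X.val.length ≤ 2 := length_le_two nX fun p hp q hq s hs =>
    (LLink.base n₁ n₂).block_le_two M (cX p hp).2 (cX q hq).2 (cX s hs).2
  have lY : Y.val.length ≤ 2 := length_le_two nY fun p hp q hq s hs =>
    (RLink.base n₁ n₂).block_le_two M (cY p hp).2 (cY q hq).2 (cY s hs).2
  have hc' := hT.head?_trim htf hvs nX (fun x hx => (cX x hx).1) mX hc
  have hd' := hT.head?_trim htf hvs nY (fun x hx => (cY x hx).1) mY hd
  -- The type-a vertices are distinct, so `vs.length` rounds are enough for either part.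
  have hlen : l.length + r.length + 1 ≤ vs.length := by
    have h₁ := (map_a_sublist _).nodup hnd
    have h₂ := (h₁.subperm (l₂ := vs) fun x _ => hvs x).length_le
    simp only [SweepData.steps, List.map_cons, List.map_append, List.length_cons, List.length_append,
      List.length_map] at h₂
    exact h₂
  obtain ⟨f₁, t₁⟩ := hl.findSteps M Λ h htf hT hn hvs hs w₁ (k := vs.length) (by omega)
  obtain ⟨f₂, t₂⟩ := hr.findSteps M.mirror Λ.mirror h.mirror_empty htf hT hn hvs hs' w₂'
    (k := vs.length) (by omega)
  have t₃ : X.time ≤ 2 * vs.length + 1 := scan_time_le (k := 1) (fun _ => le_rfl) vs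
  have t₄ : Y.time ≤ 2 * vs.length + 1 := scan_time_le (k := 1) (fun _ => le_rfl) vs
  have t₅ := trimTest_scan_time_le vs T a lX
  have t₆ := trimTest_scan_time_le vs T a lY
  simp only [_root_.sweepOnce, Timed.bind_val, Timed.bind_time, Timed.charge_val,
    Timed.charge_time, ← hX, ← hY, hc', hd', f₁, f₂, SweepData.steps, List.length_cons,
    List.length_append]
  -- Outside the rounds the cost is at most `15n + 4`, plus ten for every step; the base step
  -- absorbs the first amount.
  exact ⟨trivial, by nlinarith⟩

/-! ### Amortised running time -/

/-- The number of white endpoints. -/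
noncomputable def whiteCount [Fintype V] (σ : MixedRep V) : ℕ :=
  (Finset.univ.filter fun v => (σ v).L.red = false).card +
    (Finset.univ.filter fun v => (σ v).R.red = false).card

omit [DecidableEq V] in
theorem length_add_card_le [Fintype V] {p q : V → Prop} [DecidablePred p] [DecidablePred q]
    (hqp : ∀ v, q v → p v) {l : List V} (hn : l.Nodup) (hl : ∀ v ∈ l, p v ∧ ¬ q v) :
    l.length + (Finset.univ.filter q).card ≤ (Finset.univ.filter p).card := by
  classical
  rw [← List.toFinset_card_of_nodup hn, ← Finset.card_union_of_disjoint]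
  · refine Finset.card_le_card fun v hv => ?_
    rw [Finset.mem_union, List.mem_toFinset, Finset.mem_filter] at hv
    rcases hv with hv | hv
    · simp [(hl v hv).1]
    · simp [hqp v hv.2]
  · refine Finset.disjoint_left.2 fun v hv hv' => ?_
    exact (hl v (List.mem_toFinset.1 hv)).2 (Finset.mem_filter.1 hv').2

/-- Every step turns an endpoint of its own red: the left one of `a_0`, the right ones of the type-a
vertices in the left part, and the left ones in the right part. -/
theorem SweepEffect.whiteCount [Fintype V] {D : SweepData V} {Z' : Set ℤ} {m' : ℤ → ℝ}
    (S : SweepEffect lo hi D Z m Z' m') (hn : D.roles.Nodup) :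
    D.steps.length + whiteCount D.final ≤ _root_.whiteCount D.start := by
  have h₀ := (map_a_sublist _).nodup hn
  simp only [SweepData.steps, List.map_cons, List.map_append] at h₀
  obtain ⟨b, -, b₁, b₂, -⟩ := S.base
  have h₁ : (D.base.a :: D.right.map Step.a).Nodup :=
    h₀.sublist ((List.sublist_append_right _ _).cons_cons _)
  have h₂ : (D.left.map Step.a).Nodup :=
    h₀.sublist ((List.sublist_append_left _ _).trans (List.sublist_cons_self _ _))
  have k₁ := length_add_card_le (p := fun v => (D.start v).L.red = false)
    (q := fun v => (D.final v).L.red = false) (fun v hv => by rw [← S.ext.whiteL v hv, hv]) h₁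
    (by
      intro v hv
      rcases List.mem_cons.1 hv with rfl | hv
      · simp [b₁, b₂]
      · obtain ⟨t, ht, rfl⟩ := List.mem_map.1 hv
        simp [S.right t ht])
  have k₂ := length_add_card_le (p := fun v => (D.start v).R.red = false)
    (q := fun v => (D.final v).R.red = false) (fun v hv => by rw [← S.ext.whiteR v hv, hv]) h₂
    (by
      intro v hv
      obtain ⟨t, ht, rfl⟩ := List.mem_map.1 hv
      simp [S.left t ht])
  simp only [SweepData.steps, List.length_cons, List.length_append, List.length_map,
    _root_.whiteCount] at *
  omega

/-- The cost of a sweep is paid by the white endpoints it uses up, so the bound carries `whiteCount`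
as a potential. Strict containments only disappear, so a pair that has been treated needs no second
visit. -/
theorem IsRun.sweepPairs [Fintype V] (hyp : InitialHyp G σ₀) {T : Tables V} (hT : T.Correct G)
    {vs : List V} (hn : vs.Nodup) (hvs : ∀ v, v ∈ vs) (l : List (V × V)) {H : List (SweepData V)}
    (hr : IsRun G σ₀ H σ) :
    ∃ (H' : List (SweepData V)) (σ' : MixedRep V), IsRun G σ₀ H' σ' ∧
      (sweepPairs vs T l σ).val = σ' ∧
      (_root_.sweepPairs vs T l σ).time + 18 * (vs.length + 1) * whiteCount σ' ≤
        2 * l.length + 1 + 18 * (vs.length + 1) * whiteCount σ ∧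
      (∀ u v, (σ' u).StrictlyIn (σ' v) → (σ u).StrictlyIn (σ v)) ∧
      ∀ p ∈ l, ¬ (σ' p.2).StrictlyIn (σ' p.1) := by
  obtain ⟨lo, hi, M, Λ⟩ := exists_model hyp
  induction l generalizing H σ with
  | nil => exact ⟨H, σ, hr, rfl, by simp [_root_.sweepPairs], fun _ _ => id, by simp⟩
  | cons p l ih =>
    obtain ⟨Z, m, R⟩ := hr.info M Λ hyp.lt
    have h := R.inv
    have htest := MInterval.strictTest_iff (h.lt p.2) (h.lt p.1)
    by_cases hp : (σ p.2).StrictlyIn (σ p.1)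
    · obtain ⟨D, ⟨rfl, ha, hb, hD⟩, -⟩ := exists_sweep M Λ h hyp.twinFree hp
      obtain ⟨Z', m', h', S⟩ := hD.effect M Λ h
      obtain ⟨o₁, o₂⟩ := hD.sweepOnce M Λ h hyp.twinFree hT hn hvs hb
      have hw := S.whiteCount (hD.nodup M Λ h)
      obtain ⟨H', σ', hr', hval, htime, hmono, hnot⟩ := ih (hr.snoc rfl hD)
      have hmono' : ∀ u v, (D.final u).StrictlyIn (D.final v) →
          (D.start u).StrictlyIn (D.start v) := fun u v huv => by
        rw [h'.strictlyIn_iff Λ M] at huv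
        rw [h.strictlyIn_iff Λ M]
        obtain ⟨k₁, k₂, k₃, k₄, k₅, k₆⟩ := huv
        exact ⟨k₁, k₂, by rw [← S.ext.whiteL v k₃, k₃], by rw [← S.ext.whiteR v k₄, k₄],
          by rw [← S.ext.whiteL u k₅, k₅], by rw [← S.ext.whiteR u k₆, k₆]⟩
      rw [ha] at o₁ o₂
      refine ⟨H', σ', hr', ?_, ?_, fun u v huv => hmono' u v (hmono u v huv), ?_⟩
      · simp only [_root_.sweepPairs, Timed.bind_val, Timed.charge_val, htest.2 hp, if_true, o₁,
          hval]
      · simp only [_root_.sweepPairs, Timed.bind_time, Timed.charge_time, Timed.charge_val,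
          htest.2 hp, if_true, o₁, List.length_cons]
        have := Nat.mul_le_mul_left (18 * (vs.length + 1)) hw
        rw [Nat.mul_add] at this
        linarith
      · intro q hq
        rcases List.mem_cons.1 hq with rfl | hq
        · intro hs
          have := ((h'.strictlyIn_iff Λ M).1 (hmono _ _ hs)).2.2.1
          obtain ⟨b, -, -, b₂, -⟩ := S.base
          rw [← ha, b₂] at this
          cases this
        · exact hnot q hq
    · obtain ⟨H', σ', hr', hval, htime, hmono, hnot⟩ := ih hr
      have hf : (σ p.2).strictTest (σ p.1) = false := by
        rw [← Bool.not_eq_true, htest]; exact hp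
      refine ⟨H', σ', hr', ?_, ?_, hmono, ?_⟩
      · simp only [_root_.sweepPairs, Timed.bind_val, Timed.charge_val, hf, Bool.false_eq_true,
          if_false, hval]
      · simp only [_root_.sweepPairs, Timed.bind_time, Timed.charge_time, Timed.charge_val, hf,
          Bool.false_eq_true, if_false, List.length_cons]
        linarith
      · intro q hq
        rcases List.mem_cons.1 hq with rfl | hq
        · exact fun hs => hp (hmono _ _ hs)
        · exact hnot q hq

theorem sweepProgram_spec [Fintype V] (hyp : InitialHyp G σ₀) {vs : List V} (hn : vs.Nodup)
    (hvs : ∀ v, v ∈ vs) :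
    (∃ (H : List (SweepData V)) (σ : MixedRep V), IsRun G σ₀ H σ ∧
      (sweepProgram vs σ₀).val = σ ∧ Represents σ G ∧ σ.IsStrict) ∧
    (sweepProgram vs σ₀).time ≤ 50 * (Fintype.card V + 1) ^ 2 := by
  have hT := makeTables_correct hyp hn hvs
  obtain ⟨H, σ, hr, hval, htime, -, hnot⟩ := IsRun.sweepPairs hyp hT hn hvs (vs ×ˢ vs)
    (IsRun.nil (G := G) (σ₀ := σ₀))
  have hcard : vs.length = Fintype.card V := by
    rw [← List.toFinset_card_of_nodup hn, ← Finset.card_univ]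
    congr 1
    ext v
    simp [hvs]
  refine ⟨⟨H, σ, hr, hval, (hr.invariants hyp).2.2.2.2.2.1, fun u v huv => ?_⟩, ?_⟩
  · exact hnot (v, u) (List.pair_mem_product.2 ⟨hvs v, hvs u⟩) huv
  · have h₁ := makeTables_time_le vs σ₀
    have h₂ : whiteCount σ₀ ≤ 2 * vs.length := by
      rw [hcard, two_mul]
      exact Nat.add_le_add (Finset.card_le_univ _) (Finset.card_le_univ _)
    have h₃ : (vs ×ˢ vs).length = vs.length * vs.length := List.length_product _ _
    have h₄ := Nat.mul_le_mul_left (18 * (vs.length + 1)) h₂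
    rw [h₃] at htime
    simp only [sweepProgram, Timed.bind_time]
    rw [← hcard]
    -- The three contributions are `5(n + 1)²` for the tables, `2n² + 1` for the pass through the
    -- pairs and `36n(n + 1)` for all the sweeps.
    nlinarith

end Termination

theorem theorem4p7 :
    ∃ C : ℕ, ∀ (V : Type u) [Fintype V] [DecidableEq V] (G : SimpleGraph V) (σ₀ : MixedRep V),
      InitialHyp G σ₀ →
      -- the invariants, for every choice of the `ab`-pairs, after any number of sweeps
      (∀ (H : List (SweepData V)) (σ : MixedRep V), IsRun G σ₀ H σ →
        -- white endpoints have never been moved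
        (∀ v s, ((σ v).pt s).red = false → (σ v).pt s = (σ₀ v).pt s) ∧
        -- (1) strictly nested intervals, and the vertices that peek into them
        (∀ u v, (σ u).StrictlyIn (σ v) →
          (∀ s, ((σ u).pt s).red = false ∧ ((σ v).pt s).red = false) ∧
          (∀ x, PeeksLeft σ x v u → (σ x).R.red = false) ∧
          (∀ x, PeeksRight σ x v u → (σ x).L.red = false)) ∧
        -- (2) from every `ab`-pair the next sweep is well defined, and it moves white endpoints only
        (∀ a b, (σ b).StrictlyIn (σ a) →
          ∃! D : SweepData V, D.start = σ ∧ D.base.a = a ∧ D.base.b = some b ∧ IsSweep G D) ∧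
        (∀ D : SweepData V, D.start = σ → IsSweep G D →
          D.Consistent ∧
          (∀ v s, D.EndParticipates v s →
            ((σ v).pt s).red = false ∧ ((D.final v).pt s).red = true) ∧
          (∀ v s, ((σ v).pt s).red = true → (D.final v).pt s = (σ v).pt s)) ∧
        -- (3) the zone lines of all sweeps so far
        (∀ (H₁ : List (SweepData V)) (D : SweepData V) (H₂ : List (SweepData V)),
          H = H₁ ++ D :: H₂ → ∀ x, D.IsZoneLine x → ZoneLineProps σ D H₂ x) ∧
        -- (4) the graph represented is still `G`
        Represents σ G ∧
        -- the number of sweeps is at most the number of vertices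
        H.length ≤ Fintype.card V) ∧
      -- the algorithm terminates with a strict mixed interval representation in quadratic time
      (∀ vs : List V, vs.Nodup → (∀ v, v ∈ vs) →
        (∃ (H : List (SweepData V)) (σ : MixedRep V), IsRun G σ₀ H σ ∧
          (sweepProgram vs σ₀).val = σ ∧ Represents σ G ∧ σ.IsStrict) ∧
        (sweepProgram vs σ₀).time ≤ C * (Fintype.card V + 1) ^ 2) := by
  refine ⟨50, fun V _ _ G σ₀ hyp => ⟨fun H σ hr => hr.invariants hyp, fun vs hn hvs => ?_⟩⟩
  exact sweepProgram_spec hyp hn hvs
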